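/- **Conventions.** Let $c\in\mathbb C$. The Neveu–Schwarz $N=2$ algebra has basis $L_m,H_m$ ($m\in\mathbb Z$), $G^\pm_r$ ($r\in\mathbb Z+\frac12$) and a central element $C$, with $[L_m,L_n]=(m-n)L_{m+n}+\frac{C}{12}(m^3-m)\delta_{m+n,0}$, $[H_m,H_n]=\frac C3 m\,\delta_{m+n,0}$, $[L_m,H_n]=-nH_{m+n}$, $[L_m,G^\pm_r]=(\frac m2-r)G^\pm_{m+r}$, $[H_m,G^\pm_r]=\pm G^\pm_{m+r}$, $\{G^\pm_r,G^\pm_s\}=0$, $\{G^\pm_r,G^\mp_s\}=2L_{r+s}\pm(r-s)H_{r+s}+\frac C3(r^2-\frac14)\delta_{r+s,0}$. The topological $N=2$ algebra has basis $\mathcal L_m,\mathcal H_m,\mathcal G_m,\mathcal Q_m$ ($m\in\mathbb Z$) and a central element $C$, with $[\mathcal L_m,\mathcal L_n]=(m-n)\mathcal L_{m+n}$, $[\mathcal H_m,\mathcal H_n]=\frac C3m\,\delta_{m+n,0}$, $[\mathcal L_m,\mathcal G_n]=(m-n)\mathcal G_{m+n}$, $[\mathcal H_m,\mathcal G_n]=\mathcal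 G_{m+n}$, $[\mathcal L_m,\mathcal Q_n]=-n\mathcal Q_{m+n}$, $[\mathcal H_m,\mathcal Q_n]=-\mathcal Q_{m+n}$, $[\mathcal L_m,\mathcal H_n]=-n\mathcal H_{m+n}+\frac C6(m^2+m)\delta_{m+n,0}$, $\{\mathcal G_m,\mathcal Q_n\}=2\mathcal L_{m+n}-2n\mathcal H_{m+n}+\frac C3(m^2+m)\delta_{m+n,0}$, $\{\mathcal G_m,\mathcal G_n\}=\{\mathcal Q_m,\mathcal Q_n\}=0$. For $\Delta,q\in\mathbb C$ let $V^{NS}_{\Delta,q}$ be the (complete) Neveu–Schwarz Verma module generated by a highest weight vector $|\Delta,q\rangle$ on which $L_0,H_0,C$ act by $\Delta,q,c$ and which is annihilated by the positive operators $L_m,H_m$ ($m\ge1$), $G^\pm_r$ ($r\ge\frac12$). Let $V^{G}_{\Delta,q}$ be the topological Verma module generated by a highest weight vector $|\Delta,q\rangle^G$ on which $\mathcal L_0,\mathcal H_0,C$ act by $\Delta,q,c$ and which is annihilated by $\mathcal G_0$ and by all generators of positive mode. A singular vector at level $m$ and with charge $n$ is a vector with $L_0$- (resp. $\mathcal L_0$-)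 eigenvalue $\Delta+m$ and $H_0$- (resp. $\mathcal H_0$-) eigenvalue $q+n$ which is annihilated by all positive operators and is not proportional to the highest weight vector. In $V^{NS}_{\Delta,q}$, the singular vectors at level $m\in\mathbb Q$ and charge $n\in\mathbb Z$ are denoted $\Psi^{n}_{m,|\Delta,q\rangle}$; those annihilated in addition by $G^+_{-1/2}$ (chiral), respectively $G^-_{-1/2}$ (antichiral), are denoted $\Psi^{ch,n}_{m,|\Delta,q\rangle}$, respectively $\Psi^{a,n}_{m,|\Delta,q\rangle}$. In $V^G_{\Delta,q}$, $\Psi^{G,n}_{m,|\Delta,q\rangle^G}$ denotes the singular vectors annihilated by $\mathcal G_0$, and $\Psi^{GQ,n}_{m,|\Delta,q\rangle^G}$ those annihilated by both $\mathcal G_0$ and $\mathcal Q_0$. The dimension of a family of vectors is the maximal number of linearly independent vectors in it. **Theorem.** (i) For each sign $\pm$, the topological twist $\mathcal L_m\mapsto L_m\pm\frac12(m+1)H_m$, $\mathcal H_m\mapsto\pm H_m$, $\mathcal G_m\mapsto G^\pm_{m+1/2}$, $\mathcal Q_m\mapsto G^\mp_{m-1/2}$, $C\mapsto C$ is an isomorphism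 of the enveloping algebras, and for all $\Delta,q$ there is a linear isomorphism $V^{NS}_{\Delta,q}\to V^G_{\Delta\pm q/2,\pm q}$ which intertwines the actions along the twist and maps highest weight vector to highest weight vector. For all $m,n$ it maps the set of singular vectors $\Psi^n_{m,|\Delta,q\rangle}$ onto the set of $\Psi^{G,\pm n}_{m\pm n/2,|\Delta\pm q/2,\pm q\rangle^G}$, and the set of those annihilated by $G^{\mp}_{-1/2}$ (antichiral for the upper sign, chiral for the lower sign) onto the set of $\Psi^{GQ,\pm n}_{m\pm n/2,|\Delta\pm q/2,\pm q\rangle^G}$. In particular the corresponding dimensions are equal. (ii) Suppose $c\neq3$. For all $\Delta,q$ and all levels, the number of linearly independent singular vectors at the same level and with the same charge $n$ is at most $$\begin{array}{l|ccc} & n=-1&n=0&n=1\\\hline \Psi^{G,n}\text{ in }V^G_{\Delta,q}&1&2&1\\ \Psi^{GQ,n}\text{ in }V^G_{\Delta,q}&1&1&0\\ \Psi^{n}\text{ in }V^{NS}_{\Delta,q}&1&2&1\\ \Psi^{ch,n}\text{ in }V^{NS}_{\Delta,q}&0&1&1\\ \Psi^{a,n}\text{ in }V^{NS}_{\Delta,q}&1&1&0\end{array}$$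 and there are no such singular vectors for any other charge $n$. In $V^{NS}_{\Delta,q}$, singular vectors with $n=0$ occur only at levels $m\in\{1,2,3,\dots\}$ and those with $n=\pm1$ only at levels $m\in\{\frac12,\frac32,\dots\}$. (iii) If $V^{NS}_{\Delta,q}$ has a chiral (respectively antichiral) singular vector at level $m$ and with charge $n$, then $\Delta+m=\frac12(q+n)$ (respectively $\Delta+m=-\frac12(q+n)$). -/

import Mathlib

namespace N2

/-! ### The Neveu-Schwarz `N = 2` superconformal algebra -/

/-- Basis of the Neveu-Schwarz `N = 2` algebra. For a sign `ε = ±1` and `k : ℤ`, the symbol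
`G ε k` stands for the mode `G^±_{k + 1/2}` of the fermionic current with half-integer modes, so
that `G ε 0 = G^±_{1/2}` and `G ε (-1) = G^±_{-1/2}`. -/
inductive NSGen : Type
  | L (m : ℤ)
  | H (m : ℤ)
  | G (ε : ℤˣ) (k : ℤ)
  | C

namespace NSGen

/-- A basis element as an element of the free associative algebra. -/
abbrev ι (x : NSGen) : FreeAlgebra ℂ NSGen := FreeAlgebra.ι ℂ x

end NSGen

open NSGen in
/-- The (anti)commutation relations of the Neveu-Schwarz `N = 2` algebra. With `r = k + 1/2` and
`s = l + 1/2`, the relation `GG'` reads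
`{G^±_r, G^∓_s} = 2 L_{r+s} ± (r - s) H_{r+s} + (C/3) (r² - 1/4) δ_{r+s,0}`. -/
inductive NSRel : FreeAlgebra ℂ NSGen → FreeAlgebra ℂ NSGen → Prop
  | LL (m n : ℤ) : NSRel (ι (L m) * ι (L n) - ι (L n) * ι (L m))
      (((m : ℂ) - n) • ι (L (m + n))
        + (if m + n = 0 then ((m : ℂ) ^ 3 - m) / 12 else 0) • ι C)
  | HH (m n : ℤ) : NSRel (ι (H m) * ι (H n) - ι (H n) * ι (H m))
      ((if m + n = 0 then (m : ℂ) / 3 else 0) • ι C)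
  | LH (m n : ℤ) : NSRel (ι (L m) * ι (H n) - ι (H n) * ι (L m))
      ((-(n : ℂ)) • ι (H (m + n)))
  | LG (m : ℤ) (ε : ℤˣ) (k : ℤ) : NSRel (ι (L m) * ι (G ε k) - ι (G ε k) * ι (L m))
      (((m : ℂ) / 2 - ((k : ℂ) + 1 / 2)) • ι (G ε (m + k)))
  | HG (m : ℤ) (ε : ℤˣ) (k : ℤ) : NSRel (ι (H m) * ι (G ε k) - ι (G ε k) * ι (H m))
      (((ε : ℤ) : ℂ) • ι (G ε (m + k)))
  | GG (ε : ℤˣ) (k l : ℤ) : NSRel (ι (G ε k) * ι (G ε l) + ι (G ε l) * ι (G ε k)) 0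
  | GG' (ε : ℤˣ) (k l : ℤ) : NSRel (ι (G ε k) * ι (G (-ε) l) + ι (G (-ε) l) * ι (G ε k))
      ((2 : ℂ) • ι (L (k + l + 1)) + (((ε : ℤ) : ℂ) * ((k : ℂ) - l)) • ι (H (k + l + 1))
        + (if k + l + 1 = 0 then (((k : ℂ) + 1 / 2) ^ 2 - 1 / 4) / 3 else 0) • ι C)
  | central (x : NSGen) : NSRel (ι C * ι x) (ι x * ι C)

/-- The universal enveloping algebra of the Neveu-Schwarz `N = 2` algebra. -/
def NSAlg : Type := RingQuot NSRel

noncomputable instance : Ring NSAlg := inferInstanceAs (Ring (RingQuot NSRel))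

noncomputable instance : Algebra ℂ NSAlg := inferInstanceAs (Algebra ℂ (RingQuot NSRel))

/-- The image of a basis element in the enveloping algebra. -/
noncomputable def ns (x : NSGen) : NSAlg := RingQuot.mkAlgHom ℂ NSRel (FreeAlgebra.ι ℂ x)

/-- The positive operators: `L_m, H_m` with `m ≥ 1` and `G^±_r` with `r ≥ 1/2`. -/
def NSPos : Set NSAlg :=
  {a | (∃ m : ℤ, 0 < m ∧ (a = ns (.L m) ∨ a = ns (.H m)))
    ∨ ∃ (ε : ℤˣ) (k : ℤ), 0 ≤ k ∧ a = ns (.G ε k)}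

/-- The left ideal defining the (complete) Neveu-Schwarz Verma module. -/
noncomputable def NSIdeal (c Δ q : ℂ) : Submodule NSAlg NSAlg :=
  Submodule.span NSAlg (NSPos ∪
    {ns (.L 0) - algebraMap ℂ NSAlg Δ, ns (.H 0) - algebraMap ℂ NSAlg q,
      ns .C - algebraMap ℂ NSAlg c})

/-- The complete Neveu-Schwarz Verma module `V_{Δ,q}` at central charge `c`: the module induced
from the one-dimensional module on which the positive operators vanish and `L_0, H_0, C` act by
`Δ, q, c`. -/
def NSVerma (c Δ q : ℂ) : Type := NSAlg ⧸ NSIdeal c Δ q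

noncomputable instance (c Δ q : ℂ) : AddCommGroup (NSVerma c Δ q) :=
  inferInstanceAs (AddCommGroup (NSAlg ⧸ NSIdeal c Δ q))

noncomputable instance (c Δ q : ℂ) : Module NSAlg (NSVerma c Δ q) :=
  inferInstanceAs (Module NSAlg (NSAlg ⧸ NSIdeal c Δ q))

noncomputable instance (c Δ q : ℂ) : Module ℂ (NSVerma c Δ q) :=
  inferInstanceAs (Module ℂ (NSAlg ⧸ NSIdeal c Δ q))

instance (c Δ q : ℂ) : IsScalarTower ℂ NSAlg (NSVerma c Δ q) :=
  inferInstanceAs (IsScalarTower ℂ NSAlg (NSAlg ⧸ NSIdeal c Δ q))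

/-- The highest weight vector. -/
noncomputable def nsHW (c Δ q : ℂ) : NSVerma c Δ q := (NSIdeal c Δ q).mkQ 1

/-- Neveu-Schwarz singular vectors at level `m` and with charge `n`. -/
def NSSing (c Δ q : ℂ) (m : ℚ) (n : ℤ) : Set (NSVerma c Δ q) :=
  {v | ns (.L 0) • v = (Δ + (m : ℂ)) • v ∧ ns (.H 0) • v = (q + (n : ℂ)) • v
    ∧ (∀ a ∈ NSPos, a • v = 0) ∧ v ∉ Submodule.span ℂ {nsHW c Δ q}}

/-- Singular vectors annihilated in addition by `G^±_{-1/2}`, `± = ε`. -/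
def NSSingChir (ε : ℤˣ) (c Δ q : ℂ) (m : ℚ) (n : ℤ) : Set (NSVerma c Δ q) :=
  {v | v ∈ NSSing c Δ q m n ∧ ns (.G ε (-1)) • v = 0}

/-- Chiral singular vectors: annihilated in addition by `G^+_{-1/2}`. -/
abbrev NSSingCh (c Δ q : ℂ) (m : ℚ) (n : ℤ) : Set (NSVerma c Δ q) := NSSingChir 1 c Δ q m n

/-- Antichiral singular vectors: annihilated in addition by `G^-_{-1/2}`. -/
abbrev NSSingA (c Δ q : ℂ) (m : ℚ) (n : ℤ) : Set (NSVerma c Δ q) := NSSingChir (-1) c Δ q m n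

/-! ### The topological `N = 2` superconformal algebra -/

/-- Basis of the topological `N = 2` algebra. -/
inductive TopGen : Type
  | L (m : ℤ)
  | H (m : ℤ)
  | G (m : ℤ)
  | Q (m : ℤ)
  | C

namespace TopGen

/-- A basis element as an element of the free associative algebra. -/
abbrev ι (x : TopGen) : FreeAlgebra ℂ TopGen := FreeAlgebra.ι ℂ x

end TopGen

open TopGen in
/-- The (anti)commutation relations of the topological `N = 2` algebra. -/
inductive TopRel : FreeAlgebra ℂ TopGen → FreeAlgebra ℂ TopGen → Prop
  | LL (m n : ℤ) : TopRel (ι (L m) * ι (L n) - ι (L n) * ι (L m))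
      (((m : ℂ) - n) • ι (L (m + n)))
  | HH (m n : ℤ) : TopRel (ι (H m) * ι (H n) - ι (H n) * ι (H m))
      ((if m + n = 0 then (m : ℂ) / 3 else 0) • ι C)
  | LG (m n : ℤ) : TopRel (ι (L m) * ι (G n) - ι (G n) * ι (L m))
      (((m : ℂ) - n) • ι (G (m + n)))
  | HG (m n : ℤ) : TopRel (ι (H m) * ι (G n) - ι (G n) * ι (H m)) (ι (G (m + n)))
  | LQ (m n : ℤ) : TopRel (ι (L m) * ι (Q n) - ι (Q n) * ι (L m))
      ((-(n : ℂ)) • ι (Q (m + n)))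
  | HQ (m n : ℤ) : TopRel (ι (H m) * ι (Q n) - ι (Q n) * ι (H m)) (-ι (Q (m + n)))
  | LH (m n : ℤ) : TopRel (ι (L m) * ι (H n) - ι (H n) * ι (L m))
      ((-(n : ℂ)) • ι (H (m + n))
        + (if m + n = 0 then ((m : ℂ) ^ 2 + m) / 6 else 0) • ι C)
  | GQ (m n : ℤ) : TopRel (ι (G m) * ι (Q n) + ι (Q n) * ι (G m))
      ((2 : ℂ) • ι (L (m + n)) - (2 * (n : ℂ)) • ι (H (m + n))
        + (if m + n = 0 then ((m : ℂ) ^ 2 + m) / 3 else 0) • ι C)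
  | GG (m n : ℤ) : TopRel (ι (G m) * ι (G n) + ι (G n) * ι (G m)) 0
  | QQ (m n : ℤ) : TopRel (ι (Q m) * ι (Q n) + ι (Q n) * ι (Q m)) 0
  | central (x : TopGen) : TopRel (ι C * ι x) (ι x * ι C)

/-- The universal enveloping algebra of the topological `N = 2` algebra. -/
def TopAlg : Type := RingQuot TopRel

noncomputable instance : Ring TopAlg := inferInstanceAs (Ring (RingQuot TopRel))

noncomputable instance : Algebra ℂ TopAlg := inferInstanceAs (Algebra ℂ (RingQuot TopRel))

/-- The image of a basis element in the enveloping algebra. -/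
noncomputable def tp (x : TopGen) : TopAlg := RingQuot.mkAlgHom ℂ TopRel (FreeAlgebra.ι ℂ x)

/-- The positive operators: all basis elements of positive mode. -/
def TopPos : Set TopAlg :=
  {a | ∃ m : ℤ, 0 < m ∧ (a = tp (.L m) ∨ a = tp (.H m) ∨ a = tp (.G m) ∨ a = tp (.Q m))}

/-- The left ideal defining the topological Verma module on a `G_0`-closed highest weight
vector. -/
noncomputable def TopIdealG (c Δ q : ℂ) : Submodule TopAlg TopAlg :=
  Submodule.span TopAlg (TopPos ∪
    {tp (.G 0), tp (.L 0) - algebraMap ℂ TopAlg Δ, tp (.H 0) - algebraMap ℂ TopAlg q,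
      tp .C - algebraMap ℂ TopAlg c})

/-- The topological Verma module `V^G_{Δ,q}` at central charge `c`, built on a `G_0`-closed highest
weight vector. -/
def TopVermaG (c Δ q : ℂ) : Type := TopAlg ⧸ TopIdealG c Δ q

noncomputable instance (c Δ q : ℂ) : AddCommGroup (TopVermaG c Δ q) :=
  inferInstanceAs (AddCommGroup (TopAlg ⧸ TopIdealG c Δ q))

noncomputable instance (c Δ q : ℂ) : Module TopAlg (TopVermaG c Δ q) :=
  inferInstanceAs (Module TopAlg (TopAlg ⧸ TopIdealG c Δ q))

noncomputable instance (c Δ q : ℂ) : Module ℂ (TopVermaG c Δ q) :=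
  inferInstanceAs (Module ℂ (TopAlg ⧸ TopIdealG c Δ q))

instance (c Δ q : ℂ) : IsScalarTower ℂ TopAlg (TopVermaG c Δ q) :=
  inferInstanceAs (IsScalarTower ℂ TopAlg (TopAlg ⧸ TopIdealG c Δ q))

/-- The `G_0`-closed highest weight vector. -/
noncomputable def topHW (c Δ q : ℂ) : TopVermaG c Δ q := (TopIdealG c Δ q).mkQ 1

/-- Singular vectors of `V^G_{Δ,q}` at level `l` and with charge `n` that are annihilated by
`G_0`. -/
def TopSingG (c Δ q : ℂ) (l : ℚ) (n : ℤ) : Set (TopVermaG c Δ q) :=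
  {v | tp (.L 0) • v = (Δ + (l : ℂ)) • v ∧ tp (.H 0) • v = (q + (n : ℂ)) • v
    ∧ (∀ a ∈ TopPos, a • v = 0) ∧ tp (.G 0) • v = 0 ∧ v ∉ Submodule.span ℂ {topHW c Δ q}}

/-- Chiral singular vectors of `V^G_{Δ,q}`: annihilated by both `G_0` and `Q_0`. -/
def TopSingGQ (c Δ q : ℂ) (l : ℚ) (n : ℤ) : Set (TopVermaG c Δ q) :=
  {v | v ∈ TopSingG c Δ q l n ∧ tp (.Q 0) • v = 0}

/-- The maximal number of linearly independent vectors in a set `S` of vectors. -/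
noncomputable def indepNumber {V : Type} [AddCommGroup V] [Module ℂ V] (S : Set V) : Cardinal :=
  Module.rank ℂ (Submodule.span ℂ S)

end N2

/-! The bounds come from a filtration of the Neveu-Schwarz Verma module whose associated graded
algebra is built from Heisenberg and Clifford algebras over a central variable t. Give L_{-1} weight
2, every other L_m and every G weight 1, every H_m weight 0. Brackets do not raise the weight, and
only the following ones survive for the leading parts (`hat`), where t is the leading part of
L_{-1}: [L_m, L_n] = (m-n) t for m+n = -1 and m, n ≠ -1; {G^+_r, G^-_s} = 2t for r+s = -1; [H_m,
H_n] = (c/3) m δ; [H_m, G^±_r] = ±G^±_{m+r}.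

Thus each positive L_k is conjugate to L_{-k-1}, and each positive G^±_r to G^∓_{-r-1}. The H are
coupled to the fermions, but the modes Z_k = 2 t H_k - Σ G^+ G^- commute with the G and satisfy
[Z_k, H_{-k}] = 2k (c/3 - 1) t, which is nonzero exactly because c ≠ 3 (`Z_H`).

The leading component of a singular vector is killed by the leading parts of all positive operators.
It therefore contains no letter conjugate to a positive one, and only L_{-1} and G^±_{-1/2} remain
(`isKernelWord_of_mem_support`). Level and charge then leave two words for charge 0 (L_{-1}^m and
L_{-1}^{m-1} G^+ G^-), one word for charge ±1, and none otherwise. A nonzero singular vector has a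
nonzero coordinate at one of them (`exists_coord_ne_zero`), which bounds the dimension. If
G^ε_{-1/2} also annihilates the vector, it annihilates the leading component; this rules out charge
-ε and, for charge 0, makes the coordinate at the word with both fermions decisive
(`exists_coord_ne_zero_of_chiral`).

Coordinates presuppose a Poincaré-Birkhoff-Witt basis (`pbw`), obtained from a diamond lemma for
words acting on a vacuum (`good`). The weights in (iii) follow from {G^ε_{-1/2}, G^{-ε}_{1/2}} = 2
L_0 - ε H_0. Part (i) is a check on generators, and it carries the bounds over to the topological
modules. -/

namespace SuperPBW

/-! ### Straightening of words in a Lie superalgebra: the diamond lemma. -/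

/-- The sign of the exchange of two homogeneous elements of given parities. -/
def sgb (a b : Bool) : ℂ := if a && b then -1 else 1

lemma sgb_mul_self (a b : Bool) : sgb a b * sgb a b = 1 := by
  cases a <;> cases b <;> simp [sgb]

lemma sgb_comm (a b : Bool) : sgb a b = sgb b a := by
  cases a <;> cases b <;> simp [sgb]

lemma sgb_xor (a b c : Bool) : sgb (xor a b) c = sgb a c * sgb b c := by
  cases a <;> cases b <;> cases c <;> simp [sgb]

lemma eq_zero_of_add_self {α : Type} {f : α →₀ ℂ} (h : f + f = 0) : f = 0 := by
  ext a
  have := DFunLike.congr_fun h a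
  simpa using this

/-- The parity extended to the central element `none`. -/
def oddO {I : Type} (odd : I → Bool) (o : Option I) : Bool := o.elim false odd

/-- A Lie superalgebra with basis `Option I` and central element `none`, which will be identified
with the scalar `1`, together with a down-closed set `neg` of basis elements whose complement spans
a subalgebra. -/
structure Data (I : Type) [LinearOrder I] where
  odd : I → Bool
  neg : I → Prop
  br : Option I → Option I → Option I →₀ ℂ
  br_none_left : ∀ y, br none y = 0
  antisymm : ∀ x y, br y x = -(sgb (oddO odd x) (oddO odd y) • br x y)
  br_self : ∀ x, odd x = true → br (some x) (some x) = 0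
  parity : ∀ x y z, br x y z ≠ 0 → oddO odd z = xor (oddO odd x) (oddO odd y)
  jacobi : ∀ x y z : I,
    Finsupp.linearCombination ℂ (fun o => br o (some z)) (br (some x) (some y))
      - Finsupp.linearCombination ℂ (fun o => br (some x) o) (br (some y) (some z))
      + sgb (odd x) (odd y) •
        Finsupp.linearCombination ℂ (fun o => br (some y) o) (br (some x) (some z)) = 0
  neg_of_lt : ∀ x y, x < y → neg y → neg x
  -- No central term is allowed here: the central element acts as 1, so it cannot kill the vacuum.
  closed : ∀ x y, ¬ neg x → ¬ neg y → ∀ o, br (some x) (some y) o ≠ 0 → ∃ z, o = some z ∧ ¬ neg z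

section inversions

variable {I : Type} [LinearOrder I]

/-- The number of inversions of a word. -/
def inv : List I → ℕ
  | [] => 0
  | x :: l => l.countP (· < x) + inv l

lemma inv_swap_lt (u : List I) {x y : I} (v : List I) (h : y < x) :
    inv (u ++ y :: x :: v) < inv (u ++ x :: y :: v) := by
  induction u with
  | nil => simp [inv, h, not_lt.2 h.le]; omega
  | cons a u ih =>
    have hp : (u ++ y :: x :: v).countP (· < a) = (u ++ x :: y :: v).countP (· < a) :=
      List.Perm.countP_eq _ (List.Perm.append_left u (List.Perm.swap x y v))
    simp only [List.cons_append, inv, hp]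
    omega

/-- The measure for the straightening of words: length first, then inversions. -/
def meas (l : List I) : ℕ ×ₗ ℕ := toLex (l.length, inv l)

lemma meas_swap_lt (u : List I) {x y : I} (v : List I) (h : y < x) :
    meas (u ++ y :: x :: v) < meas (u ++ x :: y :: v) :=
  Prod.Lex.toLex_lt_toLex.2 (Or.inr ⟨by simp, inv_swap_lt u v h⟩)

lemma meas_lt_of_length_lt {l l' : List I} (h : l.length < l'.length) : meas l < meas l' :=
  Prod.Lex.toLex_lt_toLex.2 (Or.inl h)

lemma meas_insert_lt (u : List I) (x y : I) (o : Option I) (v : List I) :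
    meas (u ++ (o.toList ++ v)) < meas (u ++ x :: y :: v) := by
  apply meas_lt_of_length_lt
  cases o <;> simp

end inversions

namespace Data

variable {I : Type} [LinearOrder I] (D : Data I)

/-- The exchange sign of two basis elements. -/
def sg (x y : I) : ℂ := sgb (D.odd x) (D.odd y)

/-- Two letters in this order are to be exchanged. -/
def Desc (x y : I) : Prop := y < x ∨ (x = y ∧ D.odd x = true)

/-- The word ends in a letter outside `neg`. -/
def EndsPos (l : List I) : Prop := ∃ u z, ¬ D.neg z ∧ l = u ++ [z]

/-- The word has two neighbouring letters to be exchanged. -/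
def HasDesc (l : List I) : Prop :=
  ∃ p : List I × I × I × List I, l = p.1 ++ p.2.1 :: p.2.2.1 :: p.2.2.2 ∧ D.Desc p.2.1 p.2.2.1

/-- One straightening step applied to a function on words. -/
noncomputable def step (f : List I → List I →₀ ℂ) (u : List I) (x y : I) (v : List I) :
    List I →₀ ℂ :=
  D.sg x y • f (u ++ y :: x :: v)
    + Finsupp.linearCombination ℂ (fun o : Option I => f (u ++ (o.toList ++ v)))
        (D.br (some x) (some y))

open Classical in
/-- The normal form of a word applied to a vacuum vector that is killed by the letters outside
`neg`. -/
noncomputable def nf (l : List I) : List I →₀ ℂ :=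
  if D.EndsPos l then 0
  else if h : D.HasDesc l then
    if hxy : h.choose.2.1 = h.choose.2.2.1 then 0
    else
      D.sg h.choose.2.1 h.choose.2.2.1 •
          nf (h.choose.1 ++ h.choose.2.2.1 :: h.choose.2.1 :: h.choose.2.2.2)
        + Finsupp.linearCombination ℂ
          (fun o : Option I => nf (h.choose.1 ++ (o.toList ++ h.choose.2.2.2)))
          (D.br (some h.choose.2.1) (some h.choose.2.2.1))
  else Finsupp.single l 1
termination_by meas l
decreasing_by
  · obtain ⟨h1, h2⟩ := h.choose_spec
    conv_rhs => rw [h1]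
    exact meas_swap_lt _ _ (h2.resolve_right fun h' => hxy h'.1)
  · obtain ⟨h1, h2⟩ := h.choose_spec
    conv_rhs => rw [h1]
    exact meas_insert_lt _ _ _ _ _

open Classical in
/-- The straightening step, including the vanishing of squares of odd letters. -/
noncomputable def stepE (f : List I → List I →₀ ℂ) (u : List I) (x y : I) (v : List I) :
    List I →₀ ℂ :=
  if x = y then 0 else D.step f u x y v

lemma nf_endsPos {l : List I} (h : D.EndsPos l) : D.nf l = 0 := by
  rw [nf, if_pos h]

lemma nf_normal {l : List I} (h : ¬ D.EndsPos l) (h' : ¬ D.HasDesc l) :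
    D.nf l = Finsupp.single l 1 := by
  rw [nf, if_neg h, dif_neg h']

lemma nf_desc {l : List I} (h : ¬ D.EndsPos l) (h' : D.HasDesc l) :
    ∃ u x y v, l = u ++ x :: y :: v ∧ D.Desc x y ∧ D.nf l = D.stepE D.nf u x y v := by
  refine ⟨h'.choose.1, h'.choose.2.1, h'.choose.2.2.1, h'.choose.2.2.2, h'.choose_spec.1,
    h'.choose_spec.2, ?_⟩
  rw [nf, if_neg h, dif_pos h', stepE, step]
  split_ifs <;> rfl

/-- Every exchange in the word is compatible with the normal form. -/
def Good (l : List I) : Prop :=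
  ∀ u x y v, l = u ++ x :: y :: v → D.Desc x y → D.nf l = D.stepE D.nf u x y v

variable {D}

lemma br_self_even {x : I} (h : D.odd x = false) : D.br (some x) (some x) = 0 := by
  have := D.antisymm (some x) (some x)
  simp only [oddO, Option.elim, h, sgb] at this
  simp only [Bool.and_self, Bool.false_eq_true, if_false, one_smul] at this
  exact self_eq_neg.1 this

lemma sg_mul_self (x y : I) : D.sg x y * D.sg x y = 1 := sgb_mul_self _ _

lemma sg_comm (x y : I) : D.sg x y = D.sg y x := sgb_comm _ _

lemma antisymm_some (x y : I) :
    D.br (some y) (some x) = -(D.sg x y • D.br (some x) (some y)) := D.antisymm _ _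

/-- Compatibility of the normal form with an arbitrary exchange. -/
lemma rel_of_good {u : List I} {x y : I} {v : List I}
    (h1 : D.Good (u ++ x :: y :: v)) (h2 : D.Good (u ++ y :: x :: v)) :
    D.nf (u ++ x :: y :: v) = D.step D.nf u x y v := by
  rcases lt_trichotomy y x with h | h | h
  · rw [h1 u x y v rfl (Or.inl h), stepE, if_neg h.ne']
  · subst h
    cases ho : D.odd y
    · simp [step, br_self_even ho, sg, ho, sgb]
    · rw [h1 u y y v rfl (Or.inr ⟨rfl, ho⟩), stepE, if_pos rfl, step,
        h1 u y y v rfl (Or.inr ⟨rfl, ho⟩), stepE, if_pos rfl, D.br_self y ho]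
      simp
  · rw [step, h2 u y x v rfl (Or.inl h), stepE, if_neg h.ne', step, antisymm_some x y,
      map_neg, map_smul, smul_add, smul_smul, sg_comm y x, sg_mul_self, one_smul, smul_neg,
      smul_smul, sg_mul_self, one_smul]
    abel

/-- The exchange of a basis element, possibly the central one, with a letter. -/
lemma rel_option {n : ℕ} (H : ∀ l : List I, l.length = n → D.Good l) {u : List I} {z : I}
    {v : List I} (hn : (u ++ v).length + 2 = n) (o : Option I) :
    D.nf (u ++ (o.toList ++ z :: v))
      = sgb (oddO D.odd o) (D.odd z) • D.nf (u ++ z :: (o.toList ++ v))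
        + Finsupp.linearCombination ℂ (fun o => D.nf (u ++ (o.toList ++ v))) (D.br o (some z)) := by
  cases o with
  | none => simp [D.br_none_left, sgb, oddO]
  | some a =>
    refine rel_of_good (H _ ?_) (H _ ?_) <;>
    · simp at hn ⊢
      omega

/-- `rel_option` summed over a homogeneous combination `f`: homogeneity makes the sign the same in
every term. It serves to move a bracket standing inside a word past a third letter. -/
lemma swap_left {n : ℕ} (H : ∀ l : List I, l.length = n → D.Good l) {u : List I} {z : I}
    {v : List I} (hn : (u ++ v).length + 2 = n) (f : Option I →₀ ℂ) (p : Bool)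
    (hf : ∀ o, f o ≠ 0 → oddO D.odd o = p) :
    Finsupp.linearCombination ℂ (fun o : Option I => D.nf (u ++ (o.toList ++ z :: v))) f
      = sgb p (D.odd z) •
        Finsupp.linearCombination ℂ (fun o : Option I => D.nf (u ++ z :: (o.toList ++ v))) f
        + Finsupp.linearCombination ℂ (fun o : Option I => D.nf (u ++ (o.toList ++ v)))
          (Finsupp.linearCombination ℂ (fun o => D.br o (some z)) f) := by
  rw [Finsupp.apply_linearCombination]
  simp only [Finsupp.linearCombination_apply, Finsupp.sum, Finset.smul_sum,
    ← Finset.sum_add_distrib, Function.comp_apply]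
  refine Finset.sum_congr rfl fun o ho => ?_
  rw [rel_option H hn o, hf o (Finsupp.mem_support_iff.1 ho), smul_add, smul_comm]
  simp only [Finsupp.linearCombination_apply, Finsupp.sum, Finset.smul_sum]

lemma brR_eq (f : Option I →₀ ℂ) (p : Bool) (hf : ∀ o, f o ≠ 0 → oddO D.odd o = p) (z : I) :
    Finsupp.linearCombination ℂ (fun o => D.br (some z) o) f
      = -(sgb p (D.odd z) • Finsupp.linearCombination ℂ (fun o => D.br o (some z)) f) := by
  simp only [Finsupp.linearCombination_apply, Finsupp.sum, Finset.smul_sum,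
    ← Finset.sum_neg_distrib]
  refine Finset.sum_congr rfl fun o ho => ?_
  rw [D.antisymm o (some z), hf o (Finsupp.mem_support_iff.1 ho), smul_neg, smul_comm]
  rfl

lemma swap_right {n : ℕ} (H : ∀ l : List I, l.length = n → D.Good l) {u : List I} {z : I}
    {v : List I} (hn : (u ++ v).length + 2 = n) (f : Option I →₀ ℂ) (p : Bool)
    (hf : ∀ o, f o ≠ 0 → oddO D.odd o = p) :
    Finsupp.linearCombination ℂ (fun o : Option I => D.nf (u ++ z :: (o.toList ++ v))) f
      = sgb p (D.odd z) •
        Finsupp.linearCombination ℂ (fun o : Option I => D.nf (u ++ (o.toList ++ z :: v))) f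
        + Finsupp.linearCombination ℂ (fun o : Option I => D.nf (u ++ (o.toList ++ v)))
          (Finsupp.linearCombination ℂ (fun o => D.br (some z) o) f) := by
  rw [swap_left H hn f p hf, brR_eq f p hf, smul_add, smul_smul, sgb_mul_self, one_smul, map_neg,
    map_smul]
  abel

lemma br_parity (x y : I) (o : Option I) (h : D.br (some x) (some y) o ≠ 0) :
    oddO D.odd o = xor (D.odd x) (D.odd y) := D.parity _ _ _ h

/-- The critical pair `x y z` is resolved by the super Jacobi identity. Words produced by a bracket
are shorter, so the induction hypothesis covers them. The cases of a repeated odd letter need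
[x,[x,z]] = 0 and [[x,y],y] = 0, which Jacobi gives after division by 2. -/
lemma diamond_overlap {u : List I} {x y z : I} {v : List I}
    (IH : ∀ l, meas l < meas (u ++ x :: y :: z :: v) → D.Good l)
    (hxy : D.Desc x y) (hyz : D.Desc y z) :
    D.stepE D.nf u x y (z :: v) = D.stepE D.nf (u ++ [x]) y z v := by
  have H : ∀ l : List I, l.length = (u ++ v).length + 2 → D.Good l := fun l hl =>
    IH l (meas_lt_of_length_lt (by simp at hl ⊢; omega))
  have e1 : ∀ (a : I) (w : List I), (u ++ [a]) ++ w = u ++ a :: w := by simp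
  by_cases h1 : x = y
  · subst h1
    by_cases h2 : x = z
    · subst h2; simp [stepE]
    · have hzx : z < x := hyz.resolve_right fun h => h2 h.1
      have hodd : D.odd x = true := (hxy.resolve_left (lt_irrefl x)).2
      rw [stepE, if_pos rfl, stepE, if_neg h2, step, e1]
      have a1 := IH (u ++ x :: z :: x :: v) (by
        simpa using meas_swap_lt (u ++ [x]) v hzx) u x z (x :: v) rfl (Or.inl hzx)
      have a2 := IH (u ++ z :: x :: x :: v) (by
        refine lt_trans (meas_swap_lt u (x :: v) hzx) ?_
        simpa using meas_swap_lt (u ++ [x]) v hzx) (u ++ [z]) x x v (by simp) (Or.inr ⟨rfl, hodd⟩)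
      rw [stepE, if_neg h2, step, a2, stepE, if_pos rfl, smul_zero, zero_add] at a1
      simp only [e1]
      rw [a1, swap_right H rfl _ _ (br_parity x z), sgb_xor]
      -- For an odd letter occurring twice, Jacobi reads -2 [x,[x,z]] = 0.
      have j := D.jacobi x x z
      rw [D.br_self x hodd, map_zero, zero_sub] at j
      have hs : sgb (D.odd x) (D.odd x) = -1 := by simp [hodd, sgb]
      have j2 : Finsupp.linearCombination ℂ (fun o => D.br (some x) o) (D.br (some x) (some z))
          = 0 := by
        rw [hs, neg_smul, one_smul, ← sub_eq_add_neg, ← neg_add', neg_eq_zero] at j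
        exact eq_zero_of_add_self j
      rw [j2, map_zero, hs, sgb_comm (D.odd z) (D.odd x)]
      simp [sg]
  · have hyx : y < x := hxy.resolve_right fun h => h1 h.1
    by_cases h2 : y = z
    · subst h2
      have hodd : D.odd y = true := (hyz.resolve_left (lt_irrefl y)).2
      rw [stepE, if_neg h1, step, stepE, if_pos rfl]
      have a1 := IH (u ++ y :: x :: y :: v) (meas_swap_lt u (y :: v) hyx) (u ++ [y]) x y v
        (by simp) (Or.inl hyx)
      have a2 := IH (u ++ y :: y :: x :: v) (by
        refine lt_trans ?_ (meas_swap_lt u (y :: v) hyx)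
        simpa using meas_swap_lt (u ++ [y]) v hyx) u y y (x :: v) rfl (Or.inr ⟨rfl, hodd⟩)
      rw [stepE, if_neg h1, step, e1, a2, stepE, if_pos rfl, smul_zero, zero_add] at a1
      simp only [e1] at a1
      rw [a1, swap_left H rfl _ _ (br_parity x y), sgb_xor]
      have j := D.jacobi x y y
      rw [D.br_self y hodd, map_zero, sub_zero, brR_eq _ _ (br_parity x y), sgb_xor] at j
      have hs : sgb (D.odd y) (D.odd y) = -1 := by simp [hodd, sgb]
      have j2 : Finsupp.linearCombination ℂ (fun o => D.br o (some y)) (D.br (some x) (some y))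
          = 0 := by
        rw [hs, mul_neg_one, neg_smul, neg_neg, smul_smul, sgb_mul_self, one_smul] at j
        exact eq_zero_of_add_self j
      rw [j2, map_zero, hs]
      simp [sg]
    · have hzy : z < y := hyz.resolve_right fun h => h2 h.1
      have hzx := hzy.trans hyx
      have m1 := meas_swap_lt u (z :: v) hyx
      have m2 : meas (u ++ y :: z :: x :: v) < meas (u ++ y :: x :: z :: v) := by
        simpa using meas_swap_lt (u ++ [y]) v hzx
      have n1 : meas (u ++ x :: z :: y :: v) < meas (u ++ x :: y :: z :: v) := by
        simpa using meas_swap_lt (u ++ [x]) v hzy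
      have n2 := meas_swap_lt u (y :: v) hzx
      -- Both routes are continued to the fully reversed word `z y x`; the remaining bracket terms
      -- are compared through `j`.
      have a1 := IH _ m1 (u ++ [y]) x z v (by simp) (Or.inl hzx)
      have a2 := IH _ (m2.trans m1) u y z (x :: v) rfl (Or.inl hzy)
      have b1 := IH _ n1 u x z (y :: v) rfl (Or.inl hzx)
      have b2 := IH _ (n2.trans n1) (u ++ [z]) x y v (by simp) (Or.inl hyx)
      simp only [stepE, if_neg h1, if_neg h2, if_neg hzx.ne', step, e1] at a1 a2 b1 b2 ⊢
      rw [a1, a2, b1, b2, swap_left H rfl _ _ (br_parity x y), swap_right H rfl _ _ (br_parity x z),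
        swap_right H rfl _ _ (br_parity y z), sgb_xor, sgb_xor, sgb_xor]
      have j := congrArg (Finsupp.linearCombination ℂ (fun o : Option I => D.nf (u ++ (o.toList ++ v))))
        (D.jacobi x y z)
      simp only [map_add, map_sub, map_smul, map_zero] at j
      rw [sub_add_eq_add_sub, sub_eq_zero] at j
      simp only [sg, sgb_comm (D.odd z) (D.odd y), sgb_comm (D.odd z) (D.odd x),
        sgb_comm (D.odd y) (D.odd x)]
      rw [← j]
      have s1 := sgb_mul_self (D.odd x) (D.odd y)
      generalize sgb (D.odd x) (D.odd y) = s at *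
      generalize sgb (D.odd x) (D.odd z) = t at *
      generalize sgb (D.odd y) (D.odd z) = r at *
      simp only [smul_add, smul_smul]
      rw [show s * (s * r) = r by rw [← mul_assoc, s1, one_mul], show r * (t * s) = s * (t * r) by ring,
        show r * t = t * r by ring]
      abel

/-- Exchanges at disjoint places commute: both orders produce the same double sum over the two
brackets. -/
lemma diamond_disjoint {u : List I} {x y : I} {m : List I} {x' y' : I} {v : List I}
    (IH : ∀ l, meas l < meas (u ++ x :: y :: (m ++ x' :: y' :: v)) → D.Good l)
    (hxy : D.Desc x y) (hxy' : D.Desc x' y') :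
    D.stepE D.nf u x y (m ++ x' :: y' :: v) = D.stepE D.nf (u ++ x :: y :: m) x' y' v := by
  have e2 : ∀ w, u ++ x :: y :: m ++ w = u ++ x :: y :: (m ++ w) := by simp
  have k1 : ∀ o : Option I, D.nf (u ++ (o.toList ++ (m ++ x' :: y' :: v)))
      = D.stepE D.nf (u ++ (o.toList ++ m)) x' y' v := fun o =>
    IH _ (meas_insert_lt u x y o _) _ x' y' v (by simp) hxy'
  have k2 : ∀ o : Option I, D.nf (u ++ x :: y :: (m ++ (o.toList ++ v)))
      = D.stepE D.nf u x y (m ++ (o.toList ++ v)) := fun o =>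
    IH _ (by simpa using meas_insert_lt (u ++ x :: y :: m) x' y' o v) _ x y _ rfl hxy
  by_cases h1 : x = y
  · by_cases h2 : x' = y'
    · simp [stepE, h1, h2]
    · have h3 := hxy'.resolve_right fun h => h2 h.1
      have k3 := IH (u ++ x :: y :: (m ++ y' :: x' :: v))
        (by simpa using meas_swap_lt (u ++ x :: y :: m) v h3) _ x y _ rfl hxy
      simp only [stepE, if_pos h1] at k2 k3
      rw [stepE, if_pos h1, stepE, if_neg h2, step, e2, k3]
      simp only [e2, k2]
      simp [Finsupp.linearCombination_apply]
  · have h3 := hxy.resolve_right fun h => h1 h.1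
    have k4 := IH (u ++ y :: x :: (m ++ x' :: y' :: v)) (meas_swap_lt u _ h3)
      (u ++ y :: x :: m) x' y' v (by simp) hxy'
    by_cases h2 : x' = y'
    · simp only [stepE, if_pos h2] at k1 k4
      rw [stepE, if_neg h1, stepE, if_pos h2, step, k4]
      simp only [k1]
      simp [Finsupp.linearCombination_apply]
    · have h4 := hxy'.resolve_right fun h => h2 h.1
      have k3 := IH (u ++ x :: y :: (m ++ y' :: x' :: v))
        (by simpa using meas_swap_lt (u ++ x :: y :: m) v h4) _ x y _ rfl hxy
      simp only [stepE, if_neg h1, if_neg h2, step] at k1 k2 k3 k4 ⊢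
      rw [k4, e2, k3]
      simp only [e2, k1, k2]
      simp only [Finsupp.linearCombination_apply, Finsupp.sum, smul_add, Finset.sum_add_distrib,
        Finset.smul_sum, List.append_assoc, List.cons_append]
      rw [smul_smul, smul_smul, mul_comm (D.sg x y)]
      have hc := Finset.sum_comm (s := (D.br (some x) (some y)).support)
        (t := (D.br (some x') (some y')).support)
        (f := fun i j => D.br (some x) (some y) i • D.br (some x') (some y') j •
          D.nf (u ++ (i.toList ++ (m ++ (j.toList ++ v)))))
      rw [hc]
      have s1 : ∀ i j, D.br (some x) (some y) i • D.br (some x') (some y') j •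
          D.nf (u ++ (i.toList ++ (m ++ (j.toList ++ v)))) = D.br (some x') (some y') j •
          D.br (some x) (some y) i • D.nf (u ++ (i.toList ++ (m ++ (j.toList ++ v)))) :=
        fun i j => smul_comm _ _ _
      simp only [s1, smul_comm (D.br (some x') (some y') _) (D.sg x y),
        smul_comm (D.br (some x) (some y) _) (D.sg x' y')]
      abel

/-- The distance of the two places decides: 0 is the same exchange, 1 an overlap in one letter, and
anything more is disjoint. -/
lemma diamond {l : List I} (IH : ∀ l', meas l' < meas l → D.Good l') {u x y v u' x' y' v'}
    (h : l = u ++ x :: y :: v) (h' : l = u' ++ x' :: y' :: v') (hd : D.Desc x y)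
    (hd' : D.Desc x' y') (hl : u.length ≤ u'.length) :
    D.stepE D.nf u x y v = D.stepE D.nf u' x' y' v' := by
  obtain ⟨m, rfl⟩ : ∃ m, u' = u ++ m :=
    (List.prefix_of_prefix_length_le (l₃ := l) ⟨_, h.symm⟩ ⟨_, h'.symm⟩ hl).imp fun m hm => hm.symm
  subst h
  rw [List.append_assoc] at h'
  have h2 := List.append_cancel_left h'
  match m, h2 with
  | [], h2 =>
    simp only [List.nil_append, List.cons.injEq] at h2
    obtain ⟨rfl, rfl, rfl⟩ := h2
    simp
  | [a], h2 =>
    simp only [List.cons_append, List.nil_append, List.cons.injEq] at h2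
    obtain ⟨rfl, rfl, rfl⟩ := h2
    exact diamond_overlap IH hd hd'
  | a :: b :: m, h2 =>
    simp only [List.cons_append, List.cons.injEq] at h2
    obtain ⟨rfl, rfl, rfl⟩ := h2
    exact diamond_disjoint IH hd hd'

/-- Putting words that end outside `neg` equal to zero is consistent with the exchanges. Only an
exchange of the last two letters matters: there `y < x` forces `x` outside `neg` too, and by
`closed` the bracket consists of such letters. -/
lemma stepE_endsPos {u : List I} {x y : I} {v : List I} (h : D.EndsPos (u ++ x :: y :: v))
    (hd : D.Desc x y) : D.stepE D.nf u x y v = 0 := by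
  rw [stepE]
  split_ifs with hxy
  · rfl
  have hyx := hd.resolve_right fun h => hxy h.1
  obtain ⟨w, z, hz, hw⟩ := h
  rcases List.eq_nil_or_concat v with rfl | ⟨v, z', rfl⟩
  · have e : u ++ [x, y] = (u ++ [x]) ++ [y] := by simp
    rw [e] at hw
    obtain ⟨-, h3⟩ := List.append_inj' hw rfl
    simp only [List.cons.injEq, and_true] at h3
    subst h3
    have hx : ¬ D.neg x := fun h => hz (D.neg_of_lt _ _ hyx h)
    rw [step, D.nf_endsPos ⟨u ++ [y], x, hx, by simp⟩, smul_zero, zero_add,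
      Finsupp.linearCombination_apply]
    refine Finset.sum_eq_zero fun o ho => ?_
    obtain ⟨a, rfl, ha⟩ := D.closed x y hx hz o (Finsupp.mem_support_iff.1 ho)
    simp only
    rw [D.nf_endsPos ⟨u, a, ha, by simp⟩, smul_zero]
  · have e : u ++ x :: y :: v.concat z' = (u ++ x :: y :: v) ++ [z'] := by simp
    rw [e] at hw
    obtain ⟨-, h3⟩ := List.append_inj' hw rfl
    simp only [List.cons.injEq, and_true] at h3
    subst h3
    rw [step, D.nf_endsPos ⟨u ++ y :: x :: v, z', hz, by simp⟩, smul_zero, zero_add,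
      Finsupp.linearCombination_apply]
    refine Finset.sum_eq_zero fun o _ => ?_
    simp only
    rw [D.nf_endsPos ⟨u ++ (o.toList ++ v), z', hz, by simp⟩, smul_zero]

/-- Local confluence and termination give uniqueness: by `diamond`, the exchange chosen in `nf`
yields the same value as any other exchange. -/
theorem good (l : List I) : D.Good l := by
  induction hm : meas l using WellFoundedLT.induction generalizing l with
  | _ m ih =>
    subst hm
    have IH : ∀ l', meas l' < meas l → D.Good l' := fun l' h => ih _ h l' rfl
    intro u x y v h hd
    by_cases he : D.EndsPos l
    · rw [D.nf_endsPos he, stepE_endsPos (h ▸ he) hd]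
    · obtain ⟨u', x', y', v', h', hd', e⟩ := D.nf_desc he ⟨(u, x, y, v), h, hd⟩
      rw [e]
      rcases le_total u.length u'.length with hl | hl
      · exact (diamond IH h h' hd hd' hl).symm
      · exact diamond IH h' h hd' hd hl

/-- The normal form is compatible with all commutation relations. -/
theorem nf_rel (u : List I) (x y : I) (v : List I) :
    D.nf (u ++ x :: y :: v) = D.step D.nf u x y v :=
  rel_of_good (good _) (good _)

end Data

end SuperPBW

/-! ### The module spanned by normal words, and normal forms in arbitrary modules. -/

namespace SuperPBW

section words

variable {I V : Type} [AddCommGroup V] [Module ℂ V] (X : I → Module.End ℂ V) (vac : V)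

/-- A word applied to a vector. -/
def vec (l : List I) : V :=
  l.foldr (fun x v => X x v) vac

lemma vec_append (u v : List I) : vec X vac (u ++ v) = vec X (vec X vac v) u := by
  simp [vec]

lemma vec_cons (x : I) (l : List I) : vec X vac (x :: l) = X x (vec X vac l) := rfl

lemma map_vec (u : List I) : ∃ f : Module.End ℂ V, ∀ v, vec X v u = f v := by
  induction u with
  | nil => exact ⟨1, fun v => rfl⟩
  | cons x u ih =>
    obtain ⟨f, hf⟩ := ih
    exact ⟨X x * f, fun v => by rw [vec_cons, hf]; rfl⟩

end words

namespace Data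

variable {I : Type} [LinearOrder I] {D : Data I}

variable (D) in
/-- Sorted words in the letters of `neg` without repeated odd letters. -/
def Normal (l : List I) : Prop := (∀ x ∈ l, D.neg x) ∧ l.Pairwise fun x y => ¬ D.Desc x y

lemma not_desc_trans {x y z : I} (h : ¬ D.Desc x y) (h' : ¬ D.Desc y z) : ¬ D.Desc x z := by
  simp only [Desc, not_or, not_lt, not_and] at h h' ⊢
  refine ⟨h.1.trans h'.1, fun hxz => h.2 ?_⟩
  subst hxz
  exact le_antisymm h.1 h'.1

lemma not_hasDesc_iff {l : List I} :
    ¬ D.HasDesc l ↔ l.Pairwise fun x y => ¬ D.Desc x y := by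
  have : IsTrans I fun x y => ¬ D.Desc x y := ⟨fun _ _ _ => not_desc_trans⟩
  rw [← List.isChain_iff_pairwise, List.isChain_iff_forall_rel_of_append_cons_cons]
  constructor
  · intro h x y u v hl hd
    exact h ⟨(u, x, y, v), hl, hd⟩
  · rintro h ⟨⟨u, x, y, v⟩, hl, hd⟩
    exact h hl hd

lemma Normal.not_endsPos {l : List I} (h : D.Normal l) : ¬ D.EndsPos l := by
  rintro ⟨u, z, hz, rfl⟩
  exact hz (h.1 z (by simp))

lemma normal_of {l : List I} (h : ¬ D.EndsPos l) (h' : ¬ D.HasDesc l) : D.Normal l := by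
  rw [not_hasDesc_iff] at h'
  refine ⟨fun x hx => ?_, h'⟩
  rcases List.eq_nil_or_concat l with rfl | ⟨u, z, rfl⟩
  · simp at hx
  have hz : D.neg z := by
    by_contra hz
    exact h ⟨u, z, hz, by simp⟩
  rw [List.concat_eq_append, List.pairwise_append] at h'
  rw [List.concat_eq_append, List.mem_append, List.mem_singleton] at hx
  rcases hx with hx | rfl
  · have h2 := h'.2.2 x hx z (by simp)
    simp only [Desc, not_or, not_lt] at h2
    rcases h2.1.lt_or_eq with h3 | rfl
    · exact D.neg_of_lt _ _ h3 hz
    · exact hz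
  · exact hz

lemma nf_of_normal {l : List I} (h : D.Normal l) : D.nf l = Finsupp.single l 1 :=
  D.nf_normal h.not_endsPos (not_hasDesc_iff.2 h.2)

lemma nf_sq (u : List I) {x : I} (v : List I) (hx : D.odd x = true) :
    D.nf (u ++ x :: x :: v) = 0 := by
  rw [good _ u x x v rfl (Or.inr ⟨rfl, hx⟩), stepE, if_pos rfl]

/-- Induction along the straightening of words. -/
theorem straighten_induction {P : List I → Prop} (h0 : ∀ l, D.EndsPos l → P l)
    (h1 : ∀ l, D.Normal l → P l)
    (h2 : ∀ u x y v, P (u ++ y :: x :: v) → (∀ o : Option I, P (u ++ (o.toList ++ v))) →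
      P (u ++ x :: y :: v))
    (h3 : ∀ u x v, D.odd x = true → P (u ++ x :: x :: v)) (l : List I) : P l := by
  induction hm : meas l using WellFoundedLT.induction generalizing l with
  | _ m ih =>
    subst hm
    by_cases he : D.EndsPos l
    · exact h0 l he
    by_cases hd : D.HasDesc l
    · obtain ⟨⟨u, x, y, v⟩, rfl, hxy⟩ := hd
      rcases hxy with h | ⟨h, ho⟩
      · exact h2 u x y v (ih _ (meas_swap_lt u v h) _ rfl)
          fun o => ih _ (meas_insert_lt u x y o v) _ rfl
      · obtain rfl : x = y := h
        exact h3 u x v ho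
    · exact h1 l (normal_of he hd)

lemma nf_apply_eq_zero (l w : List I) (hw : ¬ D.Normal w) : D.nf l w = 0 := by
  induction l using D.straighten_induction with
  | h0 l h => rw [D.nf_endsPos h]; rfl
  | h1 l h =>
    rw [nf_of_normal h, Finsupp.single_apply, if_neg]
    rintro rfl
    exact hw h
  | h2 u x y v h h' =>
    rw [nf_rel, step, Finsupp.add_apply, Finsupp.smul_apply, h, smul_zero, zero_add,
      Finsupp.linearCombination_apply, Finsupp.sum, Finsupp.finsetSum_apply]
    refine Finset.sum_eq_zero fun o _ => ?_
    rw [Finsupp.smul_apply, h' o, smul_zero]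
  | h3 u x v h => rw [nf_sq u v h]; rfl

/-- The total weight of a word. -/
def wtw (wt : I → ℕ) (l : List I) : ℕ := (l.map wt).sum

/-- Straightening does not increase a weight that is compatible with the brackets. -/
lemma nf_weight (wt : I → ℕ)
    (hwt : ∀ x y o, D.br (some x) (some y) o ≠ 0 → wtw wt o.toList ≤ wt x + wt y)
    (l w : List I) (hw : D.nf l w ≠ 0) : wtw wt w ≤ wtw wt l := by
  induction l using D.straighten_induction with
  | h0 l h => rw [D.nf_endsPos h] at hw; exact absurd rfl hw
  | h1 l h =>
    rw [nf_of_normal h, Finsupp.single_apply] at hw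
    by_cases hl : l = w
    · rw [hl]
    · rw [if_neg hl] at hw; exact absurd rfl hw
  | h2 u x y v h h' =>
    rw [nf_rel, step, Finsupp.add_apply, Finsupp.smul_apply] at hw
    by_cases h1 : D.nf (u ++ y :: x :: v) w = 0
    · rw [h1, smul_zero, zero_add, Finsupp.linearCombination_apply, Finsupp.sum,
        Finsupp.finsetSum_apply] at hw
      obtain ⟨o, ho, hne⟩ := Finset.exists_ne_zero_of_sum_ne_zero hw
      rw [Finsupp.smul_apply] at hne
      have k1 := h' o (right_ne_zero_of_smul hne)
      have k2 := hwt x y o (Finsupp.mem_support_iff.1 ho)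
      simp only [wtw, List.map_append, List.map_cons, List.sum_append, List.sum_cons] at k1 k2 ⊢
      omega
    · have k1 := h h1
      simp only [wtw, List.map_append, List.map_cons, List.sum_append, List.sum_cons] at k1 ⊢
      omega
  | h3 u x v h => rw [nf_sq u v h] at hw; exact absurd rfl hw

variable (D) in
/-- Letters acting on linear combinations of words through the normal form. -/
noncomputable def opAux (x : I) : (List I →₀ ℂ) →ₗ[ℂ] (List I →₀ ℂ) :=
  Finsupp.linearCombination ℂ fun l => D.nf (x :: l)

lemma opAux_single (x : I) (l : List I) : D.opAux x (Finsupp.single l 1) = D.nf (x :: l) := by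
  simp [opAux]

/-- Prefixing a letter may be done before or after taking normal forms. Hence the action on normal
words inherits every relation that `nf_rel` gives for words. -/
lemma opAux_nf (x : I) (l : List I) : D.opAux x (D.nf l) = D.nf (x :: l) := by
  induction l using D.straighten_induction with
  | h0 l h =>
    obtain ⟨u, z, hz, rfl⟩ := h
    rw [D.nf_endsPos ⟨u, z, hz, rfl⟩, D.nf_endsPos ⟨x :: u, z, hz, by simp⟩, map_zero]
  | h1 l h => rw [nf_of_normal h, opAux_single]
  | h2 u a b v h h' =>
    rw [nf_rel, step, map_add, map_smul, h, Finsupp.apply_linearCombination]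
    have k : D.opAux x ∘ (fun o : Option I => D.nf (u ++ (o.toList ++ v)))
        = fun o : Option I => D.nf ((x :: u) ++ (o.toList ++ v)) := funext h'
    rw [k, ← List.cons_append, ← List.cons_append, nf_rel (x :: u) a b v, step]
  | h3 u a v h => rw [nf_sq u v h, map_zero, ← List.cons_append, nf_sq _ v h]

variable (D) in
/-- The space spanned by the normal words. -/
noncomputable abbrev Wmod : Submodule ℂ (List I →₀ ℂ) := Finsupp.supported ℂ ℂ {l | D.Normal l}

lemma nf_mem (l : List I) : D.nf l ∈ D.Wmod := by
  rw [Finsupp.mem_supported]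
  intro w hw
  by_contra h
  exact Finsupp.mem_support_iff.1 hw (nf_apply_eq_zero l w h)

lemma opAux_mem (x : I) (w : List I →₀ ℂ) : D.opAux x w ∈ D.Wmod := by
  rw [opAux, Finsupp.linearCombination_apply]
  exact Submodule.sum_mem _ fun l _ => Submodule.smul_mem _ _ (nf_mem _)

variable (D) in
/-- The space with basis the normal words. -/
def W : Type := D.Wmod

noncomputable instance : AddCommGroup D.W := inferInstanceAs (AddCommGroup D.Wmod)

noncomputable instance : Module ℂ D.W := inferInstanceAs (Module ℂ D.Wmod)

variable (D) in
/-- The inclusion into the linear combinations of words. -/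
noncomputable def incl : D.W →ₗ[ℂ] (List I →₀ ℂ) := D.Wmod.subtype

lemma incl_injective : Function.Injective D.incl := Subtype.val_injective

variable (D) in
/-- The letters as operators on the space of normal words. -/
noncomputable def op (x : I) : Module.End ℂ D.W :=
  (D.opAux x).restrict (p := D.Wmod) (q := D.Wmod) fun w _ => opAux_mem x w

variable (D) in
/-- The normal form of a word as an element of the space of normal words. -/
noncomputable def nfW (l : List I) : D.W := (⟨D.nf l, nf_mem l⟩ : D.Wmod)

lemma incl_nfW (l : List I) : D.incl (D.nfW l) = D.nf l := rfl

lemma op_nfW (x : I) (l : List I) : D.op x (D.nfW l) = D.nfW (x :: l) :=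
  incl_injective (opAux_nf x l)

lemma span_nfW : Submodule.span ℂ (Set.range D.nfW) = ⊤ := by
  have h : (Submodule.span ℂ (Set.range D.nfW)).map D.incl = (⊤ : Submodule ℂ D.W).map D.incl := by
    refine le_antisymm (Submodule.map_mono le_top) ?_
    rintro v ⟨w, -, rfl⟩
    have hw : D.incl w ∈ D.Wmod := Subtype.property (p := fun v => v ∈ D.Wmod) w
    rw [Wmod, Finsupp.supported_eq_span_single] at hw
    refine Submodule.span_le.2 ?_ hw
    rintro _ ⟨l, hl, rfl⟩
    exact ⟨D.nfW l, Submodule.subset_span ⟨l, rfl⟩, nf_of_normal hl⟩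
  exact Submodule.map_injective_of_injective incl_injective h

lemma hom_ext_nfW {f g : Module.End ℂ D.W} (h : ∀ l, f (D.nfW l) = g (D.nfW l)) : f = g :=
  LinearMap.ext_on_range span_nfW h

variable (D) in
/-- The operator of a basis element, the central one acting as the identity. -/
noncomputable def opO (o : Option I) : Module.End ℂ D.W := o.elim 1 D.op

/-- The operators on the space of normal words satisfy the commutation relations. -/
theorem op_rel (x y : I) : D.op x * D.op y
    = D.sg x y • (D.op y * D.op x)
      + Finsupp.linearCombination ℂ D.opO (D.br (some x) (some y)) := by
  refine hom_ext_nfW fun l => ?_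
  have h := nf_rel (D := D) [] x y l
  rw [LinearMap.add_apply, LinearMap.smul_apply, Module.End.mul_apply, Module.End.mul_apply,
    op_nfW, op_nfW, op_nfW, op_nfW]
  apply incl_injective
  simp only [List.nil_append, step] at h
  simp only [map_add, map_smul, incl_nfW, h]
  congr 1
  simp only [Finsupp.linearCombination_apply, Finsupp.sum, LinearMap.sum_apply,
    LinearMap.smul_apply, map_sum, map_smul]
  refine Finset.sum_congr rfl fun o _ => ?_
  have k : D.opO o (D.nfW l) = D.nfW (o.toList ++ l) := by
    cases o with
    | none => rfl
    | some a => exact op_nfW a l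
  rw [k, incl_nfW]

lemma op_vac {x : I} (h : ¬ D.neg x) : D.op x (D.nfW []) = 0 := by
  rw [op_nfW]
  exact incl_injective (D.nf_endsPos ⟨[], x, h, rfl⟩)

section modules

variable {V : Type} [AddCommGroup V] [Module ℂ V] (X : I → Module.End ℂ V) (vac : V)

/-- In every module with a vacuum vector, words are equal to their normal forms. -/
theorem vec_eq_nf
    (hX : ∀ x y, X x * X y = D.sg x y • (X y * X x)
      + Finsupp.linearCombination ℂ (fun o : Option I => o.elim 1 X) (D.br (some x) (some y)))
    (hvac : ∀ x, ¬ D.neg x → X x vac = 0) (l : List I) :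
    vec X vac l = Finsupp.linearCombination ℂ (vec X vac) (D.nf l) := by
  -- The relation of operators, applied under a prefix, is the same recursion that `nf_rel` gives
  -- for normal forms.
  have hstep : ∀ u x y v, vec X vac (u ++ x :: y :: v)
      = D.sg x y • vec X vac (u ++ y :: x :: v)
        + Finsupp.linearCombination ℂ (fun o : Option I => vec X vac (u ++ (o.toList ++ v)))
          (D.br (some x) (some y)) := by
    intro u x y v
    obtain ⟨f, hf⟩ := map_vec X u
    have h := congrArg f (LinearMap.congr_fun (hX x y) (vec X vac v))
    simp only [vec_append, hf]
    rw [vec_cons, vec_cons, vec_cons, vec_cons, ← Module.End.mul_apply (X x), h, LinearMap.add_apply,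
      map_add, LinearMap.smul_apply, map_smul, Module.End.mul_apply]
    congr 1
    simp only [Finsupp.linearCombination_apply, Finsupp.sum, LinearMap.sum_apply, map_sum,
      LinearMap.smul_apply, map_smul]
    refine Finset.sum_congr rfl fun o _ => ?_
    cases o <;> rfl
  induction l using D.straighten_induction with
  | h0 l h =>
    obtain ⟨u, z, hz, rfl⟩ := h
    obtain ⟨f, hf⟩ := map_vec X u
    rw [D.nf_endsPos ⟨u, z, hz, rfl⟩, map_zero, vec_append, vec_cons, hf]
    simp [vec, hvac z hz]
  | h1 l h => rw [nf_of_normal h]; simp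
  | h2 u x y v h h' =>
    rw [hstep, nf_rel, step, map_add, map_smul, h, Finsupp.apply_linearCombination]
    congr 3
    exact funext h'
  | h3 u x v h =>
    -- An odd square equals its own negative.
    have := hstep u x x v
    rw [D.br_self x h, map_zero, add_zero, sg, h] at this
    simp only [sgb, Bool.and_self, if_true, neg_smul, one_smul] at this
    have h0 : vec X vac (u ++ x :: x :: v) = 0 := by
      have h2 : (2 : ℂ) • vec X vac (u ++ x :: x :: v) = 0 := by
        rw [two_smul]; nth_rewrite 1 [this]; simp
      exact (smul_eq_zero.1 h2).resolve_left two_ne_zero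
    rw [h0, nf_sq u v h, map_zero]

end modules

end Data

end SuperPBW

/-! ### The structure constants of the Neveu-Schwarz algebra. -/

namespace N2

open SuperPBW

/-- The letters of the Neveu-Schwarz algebra besides the central one. -/
inductive Gen : Type
  | L (m : ℤ)
  | H (m : ℤ)
  | G (ε : ℤˣ) (k : ℤ)

namespace Gen

/-- Classes of letters, in the order in which they are written in normal words. -/
def cls : Gen → ℕ
  -- L_{-1} stands first so that its leading part permutes basis words injectively. The negative H
  -- come before the fermions, with which they do not commute even to leading order. Class 4
  -- collects the letters that kill the vacuum.
  | L m => if m = -1 then 0 else if m < 0 then 2 else 4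
  | H m => if m < 0 then 1 else 4
  | G _ k => if k < 0 then 3 else 4

/-- An injective index. -/
def idx : Gen → ℤ
  | L m => 4 * m
  | H m => 4 * m + 1
  | G ε k => 4 * k + 2 + if ε = 1 then 0 else 1

lemma idx_injective : Function.Injective idx := by
  intro x y h
  cases x <;> cases y <;> simp only [idx] at h
  case L.L => congr 1; omega
  case H.H => congr 1; omega
  case G.G ε k δ l =>
    rcases Int.units_eq_one_or ε with rfl | rfl <;> rcases Int.units_eq_one_or δ with rfl | rfl <;>
      simp at h
    · congr 1
    · omega
    · omega
    · congr 1
  all_goals (try split_ifs at h) <;> omega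

noncomputable instance : LinearOrder Gen :=
  LinearOrder.lift' (fun x => toLex (cls x, idx x)) fun x y h =>
    idx_injective (Prod.ext_iff.1 (toLex_inj.1 h)).2

lemma lt_iff {x y : Gen} : x < y ↔ cls x < cls y ∨ cls x = cls y ∧ idx x < idx y :=
  Prod.Lex.toLex_lt_toLex

/-- The parity. -/
def odd : Gen → Bool
  | G _ _ => true
  | _ => false

/-- The negative modes. -/
def neg : Gen → Prop
  | L m => m < 0
  | H m => m < 0
  | G _ k => k < 0

lemma neg_iff {x : Gen} : neg x ↔ cls x < 4 := by
  cases x <;> simp only [neg, cls] <;> split_ifs <;> omega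

/-- A basis vector. -/
noncomputable def e (x : Option Gen) : Option Gen →₀ ℂ := Finsupp.single x 1

open Classical in
/-- The brackets, with `L_0`, `H_0`, `C` shifted by `Δ`, `q`, `c`. -/
noncomputable def br (c Δ q : ℂ) : Gen → Gen → Option Gen →₀ ℂ
  | L m, L n => ((m : ℂ) - n) • e (L (m + n))
      + (if m + n = 0 then ((m : ℂ) ^ 3 - m) / 12 * c + 2 * m * Δ else 0) • e none
  | L m, H n => (-(n : ℂ)) • e (H (m + n)) + (if m + n = 0 then -(n : ℂ) * q else 0) • e none
  | H m, L n => (m : ℂ) • e (H (n + m)) + (if n + m = 0 then (m : ℂ) * q else 0) • e none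
  | H m, H n => (if m + n = 0 then (m : ℂ) / 3 * c else 0) • e none
  | L m, G ε k => ((m : ℂ) / 2 - ((k : ℂ) + 1 / 2)) • e (G ε (m + k))
  | G ε k, L m => (-((m : ℂ) / 2 - ((k : ℂ) + 1 / 2))) • e (G ε (m + k))
  | H m, G ε k => ((ε : ℤ) : ℂ) • e (G ε (m + k))
  | G ε k, H m => (-((ε : ℤ) : ℂ)) • e (G ε (m + k))
  | G ε k, G δ l => if ε = δ then 0 else
      (2 : ℂ) • e (L (k + l + 1)) + (((ε : ℤ) : ℂ) * ((k : ℂ) - l)) • e (H (k + l + 1))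
        + (if k + l + 1 = 0 then 2 * Δ + ((ε : ℤ) : ℂ) * ((k : ℂ) - l) * q
            + (((k : ℂ) + 1 / 2) ^ 2 - 1 / 4) / 3 * c else 0) • e none

/-- The brackets extended to the central element. -/
noncomputable def brO (c Δ q : ℂ) : Option Gen → Option Gen → Option Gen →₀ ℂ
  | some x, some y => br c Δ q x y
  | _, _ => 0

@[simp] lemma lc_e (f : Option Gen → Option Gen →₀ ℂ) (o : Option Gen) :
    Finsupp.linearCombination ℂ f (e o) = f o := by simp [e]

lemma br_antisymm (c Δ q : ℂ) (x y : Gen) :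
    br c Δ q y x = -(sgb (odd x) (odd y) • br c Δ q x y) := by
  cases x <;> cases y <;> simp only [br, odd, sgb, Bool.and_self, Bool.and_true, Bool.and_false,
    Bool.false_eq_true, if_false, if_true, one_smul]
  case L.L m n =>
    rw [add_comm n m]
    by_cases h : m + n = 0
    · obtain rfl : n = -m := by omega
      simp only [h, if_true]
      match_scalars <;> push_cast <;> ring
    · simp only [h, if_false]; module
  case L.H m n => split_ifs <;> module
  case H.L m n => split_ifs <;> module
  case H.H m n =>
    rw [add_comm n m]
    by_cases h : m + n = 0
    · obtain rfl : n = -m := by omega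
      simp only [h, if_true]
      match_scalars <;> push_cast <;> ring
    · simp only [h, if_false]; module
  case L.G => module
  case G.L => module
  case H.G => module
  case G.H => module
  case G.G ε k δ l =>
    by_cases h : ε = δ
    · simp [h]
    rw [if_neg h, if_neg (Ne.symm h), add_comm l k]
    have hd : δ = -ε := by
      rcases Int.units_eq_one_or ε with rfl | rfl <;> rcases Int.units_eq_one_or δ with rfl | rfl <;>
        simp_all
    subst hd
    by_cases h : k + l + 1 = 0
    · obtain rfl : l = -k - 1 := by omega
      simp only [h, if_true]
      match_scalars <;> push_cast <;> ring
    · simp only [h, if_false]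
      match_scalars <;> push_cast <;> ring

/-- The index sums of nested brackets, in every order, reduced to the two forms `s` and `s + 1`; the
`+ 1` is produced by a bracket of two fermions. -/
lemma jacobi_keys {m n p s : ℤ} (hs : s = m + n + p) :
      m + n + p = s ∧ m + (n + p) = s ∧ m + n + 1 + p = s + 1 ∧ m + (n + p + 1) = s + 1 ∧
      m + p + n = s ∧ m + (p + n) = s ∧ m + p + 1 + n = s + 1 ∧ m + (p + n + 1) = s + 1 ∧
      n + m + p = s ∧ n + (m + p) = s ∧ n + m + 1 + p = s + 1 ∧ n + (m + p + 1) = s + 1 ∧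
      n + p + m = s ∧ n + (p + m) = s ∧ n + p + 1 + m = s + 1 ∧ n + (p + m + 1) = s + 1 ∧
      p + m + n = s ∧ p + (m + n) = s ∧ p + m + 1 + n = s + 1 ∧ p + (m + n + 1) = s + 1 ∧
      p + n + m = s ∧ p + (n + m) = s ∧ p + n + 1 + m = s + 1 ∧ p + (n + m + 1) = s + 1 := by omega

/-- The integer by which a letter is indexed. -/
def ind : Gen → ℤ
  | L m => m
  | H m => m
  | G _ k => k

-- Scalars in the outer brackets require total mode 0. As `G ε k` has mode k + 1/2, this means index
-- sum 0 without fermions and -1 with two of them. Splitting into these cases and the generic one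
-- decides all outer conditions, and comparison of coefficients becomes polynomial.
set_option maxHeartbeats 4000000 in
set_option linter.unusedSimpArgs false in
set_option linter.unusedTactic false in
lemma br_jacobi_zero (c Δ q : ℂ) (x y z : Gen) (h : ind x + ind y + ind z = 0) :
    Finsupp.linearCombination ℂ (fun o => brO c Δ q o (some z)) (br c Δ q x y)
      - Finsupp.linearCombination ℂ (fun o => brO c Δ q (some x) o) (br c Δ q y z)
      + sgb (odd x) (odd y) •
        Finsupp.linearCombination ℂ (fun o => brO c Δ q (some y) o) (br c Δ q x z) = 0 := by
  have u1 : ((1 : ℤˣ) = -1) = False := by simp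
  have u2 : ((-1 : ℤˣ) = 1) = False := by simp
  rcases x with m | m | ⟨ε, m⟩ <;> rcases y with n | n | ⟨δ, n⟩ <;> rcases z with p | p | ⟨η, p⟩
  all_goals
    obtain ⟨s, hs⟩ : ∃ s, s = m + n + p := ⟨_, rfl⟩
    obtain ⟨k0, k1, k2, k3, k4, k5, k6, k7, k8, k9, k10, k11,
      k12, k13, k14, k15, k16, k17, k18, k19, k20, k21, k22, k23⟩ :=
      jacobi_keys hs
    simp only [ind, ← hs] at h
    try rcases Int.units_eq_one_or ε with rfl | rfl
  all_goals try rcases Int.units_eq_one_or δ with rfl | rfl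
  all_goals try rcases Int.units_eq_one_or η with rfl | rfl
  all_goals
    simp only [br, brO, odd, sgb, Bool.and_self, Bool.and_true, Bool.and_false, map_add, map_smul,
      lc_e, Bool.false_eq_true, if_false, if_true, one_smul, smul_zero, add_zero, map_zero,
      u1, u2, Units.val_one, Units.val_neg, Int.cast_one, Int.cast_neg, k0, k1, k2, k3, k4, k5, k6, k7, k8, k9, k10, k11,
      k12, k13, k14, k15, k16, k17, k18, k19, k20, k21, k22, k23]
  all_goals
    obtain rfl : p = -m - n := by omega
    have h1 : s + 1 ≠ 0 := by omega
    try simp only [h, h1, if_true, if_false]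
    match_scalars <;> push_cast <;> ring

set_option maxHeartbeats 4000000 in
set_option linter.unusedSimpArgs false in
set_option linter.unusedTactic false in
lemma br_jacobi_one (c Δ q : ℂ) (x y z : Gen) (h : ind x + ind y + ind z + 1 = 0) :
    Finsupp.linearCombination ℂ (fun o => brO c Δ q o (some z)) (br c Δ q x y)
      - Finsupp.linearCombination ℂ (fun o => brO c Δ q (some x) o) (br c Δ q y z)
      + sgb (odd x) (odd y) •
        Finsupp.linearCombination ℂ (fun o => brO c Δ q (some y) o) (br c Δ q x z) = 0 := by
  have u1 : ((1 : ℤˣ) = -1) = False := by simp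
  have u2 : ((-1 : ℤˣ) = 1) = False := by simp
  rcases x with m | m | ⟨ε, m⟩ <;> rcases y with n | n | ⟨δ, n⟩ <;> rcases z with p | p | ⟨η, p⟩
  all_goals
    obtain ⟨s, hs⟩ : ∃ s, s = m + n + p := ⟨_, rfl⟩
    obtain ⟨k0, k1, k2, k3, k4, k5, k6, k7, k8, k9, k10, k11,
      k12, k13, k14, k15, k16, k17, k18, k19, k20, k21, k22, k23⟩ :=
      jacobi_keys hs
    simp only [ind, ← hs] at h
    try rcases Int.units_eq_one_or ε with rfl | rfl
  all_goals try rcases Int.units_eq_one_or δ with rfl | rfl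
  all_goals try rcases Int.units_eq_one_or η with rfl | rfl
  all_goals
    simp only [br, brO, odd, sgb, Bool.and_self, Bool.and_true, Bool.and_false, map_add, map_smul,
      lc_e, Bool.false_eq_true, if_false, if_true, one_smul, smul_zero, add_zero, map_zero,
      u1, u2, Units.val_one, Units.val_neg, Int.cast_one, Int.cast_neg, k0, k1, k2, k3, k4, k5, k6, k7, k8, k9, k10, k11,
      k12, k13, k14, k15, k16, k17, k18, k19, k20, k21, k22, k23]
  all_goals
    obtain rfl : p = -m - n - 1 := by omega
    have h1 : s ≠ 0 := by omega
    try simp only [h, h1, if_true, if_false]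
    match_scalars <;> push_cast <;> ring

set_option maxHeartbeats 4000000 in
set_option linter.unusedSimpArgs false in
set_option linter.unusedTactic false in
lemma br_jacobi_ne (c Δ q : ℂ) (x y z : Gen) (h : ind x + ind y + ind z ≠ 0)
    (h' : ind x + ind y + ind z + 1 ≠ 0) :
    Finsupp.linearCombination ℂ (fun o => brO c Δ q o (some z)) (br c Δ q x y)
      - Finsupp.linearCombination ℂ (fun o => brO c Δ q (some x) o) (br c Δ q y z)
      + sgb (odd x) (odd y) •
        Finsupp.linearCombination ℂ (fun o => brO c Δ q (some y) o) (br c Δ q x z) = 0 := by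
  have u1 : ((1 : ℤˣ) = -1) = False := by simp
  have u2 : ((-1 : ℤˣ) = 1) = False := by simp
  rcases x with m | m | ⟨ε, m⟩ <;> rcases y with n | n | ⟨δ, n⟩ <;> rcases z with p | p | ⟨η, p⟩
  all_goals
    obtain ⟨s, hs⟩ : ∃ s, s = m + n + p := ⟨_, rfl⟩
    obtain ⟨k0, k1, k2, k3, k4, k5, k6, k7, k8, k9, k10, k11,
      k12, k13, k14, k15, k16, k17, k18, k19, k20, k21, k22, k23⟩ :=
      jacobi_keys hs
    simp only [ind, ← hs] at h
    try rcases Int.units_eq_one_or ε with rfl | rfl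
  all_goals try rcases Int.units_eq_one_or δ with rfl | rfl
  all_goals try rcases Int.units_eq_one_or η with rfl | rfl
  all_goals
    simp only [br, brO, odd, sgb, Bool.and_self, Bool.and_true, Bool.and_false, map_add, map_smul,
      lc_e, Bool.false_eq_true, if_false, if_true, one_smul, smul_zero, add_zero, map_zero,
      u1, u2, Units.val_one, Units.val_neg, Int.cast_one, Int.cast_neg, k0, k1, k2, k3, k4, k5, k6, k7, k8, k9, k10, k11,
      k12, k13, k14, k15, k16, k17, k18, k19, k20, k21, k22, k23]
  all_goals
    simp only [ind, ← hs] at h'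
    try simp only [h, h', if_false]
    match_scalars <;> push_cast <;> ring

lemma br_jacobi (c Δ q : ℂ) (x y z : Gen) :
    Finsupp.linearCombination ℂ (fun o => brO c Δ q o (some z)) (br c Δ q x y)
      - Finsupp.linearCombination ℂ (fun o => brO c Δ q (some x) o) (br c Δ q y z)
      + sgb (odd x) (odd y) •
        Finsupp.linearCombination ℂ (fun o => brO c Δ q (some y) o) (br c Δ q x z) = 0 := by
  by_cases h : ind x + ind y + ind z = 0
  · exact br_jacobi_zero c Δ q x y z h
  by_cases h' : ind x + ind y + ind z + 1 = 0
  · exact br_jacobi_one c Δ q x y z h'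
  · exact br_jacobi_ne c Δ q x y z h h'

end Gen

end N2

/-! ### The straightening data and the weights of the letters. -/

namespace N2

open SuperPBW

namespace Gen

/-- The letters that may occur in a bracket. -/
def Outs : Gen → Gen → Option Gen → Prop
  | L m, L n, o => o = some (L (m + n)) ∨ (o = none ∧ m + n = 0)
  | L m, H n, o => o = some (H (m + n)) ∨ (o = none ∧ m + n = 0)
  | H m, L n, o => o = some (H (n + m)) ∨ (o = none ∧ n + m = 0)
  | H m, H n, o => o = none ∧ m + n = 0
  | L m, G ε k, o => o = some (G ε (m + k))
  | G ε k, L m, o => o = some (G ε (m + k))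
  | H m, G ε k, o => o = some (G ε (m + k))
  | G ε k, H m, o => o = some (G ε (m + k))
  | G ε k, G δ l, o => ε ≠ δ ∧ (o = some (L (k + l + 1)) ∨ o = some (H (k + l + 1)) ∨
      (o = none ∧ k + l + 1 = 0))

lemma e_apply_ne {a : ℂ} {x o : Option Gen} (h : (a • e x) o ≠ 0) : o = x ∧ a ≠ 0 := by
  rw [Finsupp.smul_apply, e, Finsupp.single_apply] at h
  split_ifs at h with h1
  · exact ⟨h1.symm, by simpa using h⟩
  · simp at h

lemma add_apply_ne {f g : Option Gen →₀ ℂ} {o : Option Gen} (h : (f + g) o ≠ 0) :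
    f o ≠ 0 ∨ g o ≠ 0 := by
  by_contra h'
  push Not at h'
  exact h (by rw [Finsupp.add_apply, h'.1, h'.2, add_zero])

lemma ite_ne {p : Prop} [Decidable p] {a : ℂ} (h : (if p then a else 0) ≠ 0) : p := by
  by_contra hp
  exact h (if_neg hp)

lemma outs_of_br_ne {c Δ q : ℂ} {x y : Gen} {o : Option Gen} (h : br c Δ q x y o ≠ 0) :
    Outs x y o := by
  rcases x with m | m | ⟨ε, m⟩ <;> rcases y with n | n | ⟨δ, n⟩ <;> simp only [br, Outs] at h ⊢
  case L.L | L.H | H.L =>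
    rcases add_apply_ne h with h | h
    · exact Or.inl (e_apply_ne h).1
    · exact Or.inr ⟨(e_apply_ne h).1, ite_ne (e_apply_ne h).2⟩
  case H.H => exact ⟨(e_apply_ne h).1, ite_ne (e_apply_ne h).2⟩
  case L.G | G.L | H.G | G.H => exact (e_apply_ne h).1
  case G.G =>
    by_cases hε : ε = δ
    · exact absurd (by rw [if_pos hε]; rfl) h
    · rw [if_neg hε] at h
      refine ⟨hε, ?_⟩
      rcases add_apply_ne h with h | h
      · rcases add_apply_ne h with h | h
        · exact Or.inl (e_apply_ne h).1
        · exact Or.inr (Or.inl (e_apply_ne h).1)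
      · exact Or.inr (Or.inr ⟨(e_apply_ne h).1, ite_ne (e_apply_ne h).2⟩)

/-- A scalar requires total mode 0. For L and H both modes are then 0 and the coefficient vanishes;
two fermions of positive mode never reach total mode 0. -/
lemma br_none_of_not_neg {c Δ q : ℂ} {x y : Gen} (hx : ¬ neg x) (hy : ¬ neg y) :
    br c Δ q x y none = 0 := by
  by_contra h
  have ho := outs_of_br_ne h
  rcases x with m | m | ⟨ε, m⟩ <;> rcases y with n | n | ⟨δ, n⟩ <;>
    simp only [Outs, neg, not_lt, reduceCtorEq, false_or, true_and] at ho hx hy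
  case L.L | L.H | H.L | H.H =>
    obtain rfl : m = 0 := by omega
    obtain rfl : n = 0 := by omega
    simp [br, e] at h
  case G.G => omega

/-- The Neveu-Schwarz algebra with shifted generators, as data for straightening. -/
noncomputable def data (c Δ q : ℂ) : Data Gen where
  odd := odd
  neg := neg
  br := brO c Δ q
  br_none_left y := rfl
  antisymm x y := by
    cases x <;> cases y
    case some.some x y => exact br_antisymm c Δ q x y
    all_goals simp [brO]
  br_self x hx := by
    cases x <;> simp [odd] at hx
    simp [brO, br]
  parity x y z h := by
    cases x <;> cases y <;> simp only [brO, Finsupp.coe_zero, Pi.zero_apply, ne_eq,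
      not_true_eq_false] at h
    case some.some x y =>
      have ho := outs_of_br_ne h
      cases x <;> cases y <;> simp only [Outs] at ho
      case G.G => rcases ho.2 with rfl | rfl | ⟨rfl, -⟩ <;> rfl
      case H.H => rcases ho with ⟨rfl, -⟩; rfl
      case L.L | L.H | H.L => rcases ho with rfl | ⟨rfl, -⟩ <;> rfl
      all_goals subst ho; rfl
  jacobi := br_jacobi c Δ q
  neg_of_lt x y h hy := by
    rw [neg_iff] at hy ⊢
    rw [lt_iff] at h
    omega
  closed x y hx hy o h := by
    cases o with
    | none => exact absurd (br_none_of_not_neg hx hy) h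
    | some z =>
      refine ⟨z, rfl, ?_⟩
      have ho := outs_of_br_ne h
      cases x <;> cases y <;> simp only [Outs, reduceCtorEq, false_and, or_false,
        Option.some.injEq] at ho
      case G.G => rcases ho.2 with rfl | rfl <;> simp only [neg] at hx hy ⊢ <;> omega
      all_goals subst ho; simp only [neg] at hx hy ⊢; omega

/-- The weight of a letter. -/
def wt : Gen → ℕ
  | L m => if m = -1 then 2 else 1
  | H _ => 0
  | G _ _ => 1

/-- Brackets of two L, or of two fermions, can produce L_{-1}; its weight 2 is exactly what the sum
1 + 1 allows. -/
lemma wt_le {c Δ q : ℂ} (x y : Gen) (o : Option Gen)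
    (h : (data c Δ q).br (some x) (some y) o ≠ 0) : Data.wtw wt o.toList ≤ wt x + wt y := by
  have ho := outs_of_br_ne h
  cases x <;> cases y <;> simp only [Outs] at ho
  case G.G => rcases ho.2 with rfl | rfl | ⟨rfl, -⟩ <;> simp [Data.wtw, wt]; split_ifs <;> omega
  case H.H => rcases ho with ⟨rfl, -⟩; simp [Data.wtw]
  case L.H | H.L => rcases ho with rfl | ⟨rfl, -⟩ <;> simp [Data.wtw, wt]
  case L.L => rcases ho with rfl | ⟨rfl, -⟩ <;> simp [Data.wtw, wt]; split_ifs <;> omega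
  all_goals subst ho; simp [Data.wtw, wt]

end Gen

end N2

/-! ### The Poincaré-Birkhoff-Witt basis of the Neveu-Schwarz Verma module. -/

namespace N2

open SuperPBW Gen

section relations

lemma ns_LL (m n : ℤ) : ns (.L m) * ns (.L n) - ns (.L n) * ns (.L m)
    = ((m : ℂ) - n) • ns (.L (m + n))
      + (if m + n = 0 then ((m : ℂ) ^ 3 - m) / 12 else 0) • ns .C := by
  have h := RingQuot.mkAlgHom_rel ℂ (NSRel.LL m n)
  simp only [map_sub, map_mul, map_add, map_smul] at h
  exact h

lemma ns_HH (m n : ℤ) : ns (.H m) * ns (.H n) - ns (.H n) * ns (.H m)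
    = (if m + n = 0 then (m : ℂ) / 3 else 0) • ns .C := by
  have h := RingQuot.mkAlgHom_rel ℂ (NSRel.HH m n)
  simp only [map_sub, map_mul, map_smul] at h
  exact h

lemma ns_LH (m n : ℤ) : ns (.L m) * ns (.H n) - ns (.H n) * ns (.L m)
    = (-(n : ℂ)) • ns (.H (m + n)) := by
  have h := RingQuot.mkAlgHom_rel ℂ (NSRel.LH m n)
  simp only [map_sub, map_mul, map_smul] at h
  exact h

lemma ns_LG (m : ℤ) (ε : ℤˣ) (k : ℤ) : ns (.L m) * ns (.G ε k) - ns (.G ε k) * ns (.L m)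
    = ((m : ℂ) / 2 - ((k : ℂ) + 1 / 2)) • ns (.G ε (m + k)) := by
  have h := RingQuot.mkAlgHom_rel ℂ (NSRel.LG m ε k)
  simp only [map_sub, map_mul, map_smul] at h
  exact h

lemma ns_HG (m : ℤ) (ε : ℤˣ) (k : ℤ) : ns (.H m) * ns (.G ε k) - ns (.G ε k) * ns (.H m)
    = ((ε : ℤ) : ℂ) • ns (.G ε (m + k)) := by
  have h := RingQuot.mkAlgHom_rel ℂ (NSRel.HG m ε k)
  simp only [map_sub, map_mul, map_smul] at h
  exact h

lemma ns_GG (ε : ℤˣ) (k l : ℤ) :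
    ns (.G ε k) * ns (.G ε l) + ns (.G ε l) * ns (.G ε k) = 0 := by
  have h := RingQuot.mkAlgHom_rel ℂ (NSRel.GG ε k l)
  simp only [map_add, map_mul, map_zero] at h
  exact h

lemma ns_GG' (ε : ℤˣ) (k l : ℤ) :
    ns (.G ε k) * ns (.G (-ε) l) + ns (.G (-ε) l) * ns (.G ε k)
      = (2 : ℂ) • ns (.L (k + l + 1)) + (((ε : ℤ) : ℂ) * ((k : ℂ) - l)) • ns (.H (k + l + 1))
        + (if k + l + 1 = 0 then (((k : ℂ) + 1 / 2) ^ 2 - 1 / 4) / 3 else 0) • ns .C := by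
  have h := RingQuot.mkAlgHom_rel ℂ (NSRel.GG' ε k l)
  simp only [map_add, map_mul, map_smul] at h
  exact h

lemma ns_central (x : NSGen) : ns .C * ns x = ns x * ns .C := by
  have h := RingQuot.mkAlgHom_rel ℂ (NSRel.central x)
  simp only [map_mul] at h
  exact h

end relations

/-- An induction principle for the Neveu-Schwarz enveloping algebra. -/
lemma NSAlg.induction {P : NSAlg → Prop} (hs : ∀ r : ℂ, P (algebraMap ℂ NSAlg r))
    (hx : ∀ x, P (ns x)) (hmul : ∀ a b, P a → P b → P (a * b))
    (hadd : ∀ a b, P a → P b → P (a + b)) (a : NSAlg) : P a := by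
  obtain ⟨b, rfl⟩ := RingQuot.mkAlgHom_surjective ℂ NSRel a
  induction b using FreeAlgebra.induction with
  | grade0 r => exact (AlgHom.commutes (RingQuot.mkAlgHom ℂ NSRel) r).symm ▸ hs r
  | grade1 x => exact hx x
  | mul a b ha hb => exact (map_mul (RingQuot.mkAlgHom ℂ NSRel) a b).symm ▸ hmul _ _ ha hb
  | add a b ha hb => exact (map_add (RingQuot.mkAlgHom ℂ NSRel) a b).symm ▸ hadd _ _ ha hb

lemma ns_C_comm (a : NSAlg) : ns .C * a = a * ns .C := by
  induction a using NSAlg.induction with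
  | hs r => exact (Algebra.commutes r _).symm
  | hx x => exact ns_central x
  | hmul a b ha hb => rw [← mul_assoc, ha, mul_assoc, hb, mul_assoc]
  | hadd a b ha hb => rw [mul_add, ha, hb, add_mul]

section verma

variable (c Δ q : ℂ)

/-- The action of the enveloping algebra on the Verma module. -/
noncomputable def act : NSAlg →ₐ[ℂ] Module.End ℂ (NSVerma c Δ q) :=
  Algebra.lsmul ℂ ℂ (NSVerma c Δ q)

variable {c Δ q}

lemma act_apply (a : NSAlg) (v : NSVerma c Δ q) : act c Δ q a v = a • v := rfl

lemma NSVerma.exists_smul (v : NSVerma c Δ q) : ∃ a : NSAlg, v = a • nsHW c Δ q := by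
  obtain ⟨a, rfl⟩ := (NSIdeal c Δ q).mkQ_surjective v
  refine ⟨a, ?_⟩
  change (NSIdeal c Δ q).mkQ a = a • (NSIdeal c Δ q).mkQ 1
  rw [← map_smul, smul_eq_mul, mul_one]

lemma smul_nsHW_eq_zero {a : NSAlg} (h : a ∈ NSIdeal c Δ q) : a • nsHW c Δ q = 0 := by
  change a • (NSIdeal c Δ q).mkQ 1 = 0
  rw [← map_smul, smul_eq_mul, mul_one, Submodule.mkQ_apply, Submodule.Quotient.mk_eq_zero]
  exact h

lemma algebraMap_smul_verma (r : ℂ) (v : NSVerma c Δ q) : algebraMap ℂ NSAlg r • v = r • v :=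
  algebraMap_smul NSAlg r v

lemma smul_nsHW_eq {a : NSAlg} {r : ℂ} (h : a - algebraMap ℂ NSAlg r ∈ NSIdeal c Δ q) :
    a • nsHW c Δ q = r • nsHW c Δ q := by
  have := smul_nsHW_eq_zero h
  rwa [sub_smul, sub_eq_zero, algebraMap_smul_verma] at this

lemma act_C : act c Δ q (ns .C) = c • 1 := by
  refine LinearMap.ext fun v => ?_
  obtain ⟨a, rfl⟩ := v.exists_smul
  rw [act_apply, smul_smul, ns_C_comm, ← smul_smul,
    smul_nsHW_eq (r := c) (Submodule.subset_span (by simp)), smul_comm]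
  rfl

variable (c Δ q) in
/-- The letters acting on the Verma module. -/
noncomputable def X : Gen → Module.End ℂ (NSVerma c Δ q)
  | .L m => act c Δ q (ns (.L m)) - (if m = 0 then Δ else 0) • 1
  | .H m => act c Δ q (ns (.H m)) - (if m = 0 then q else 0) • 1
  | .G ε k => act c Δ q (ns (.G ε k))

lemma sub_smul_mul_sub_smul {A : Type} [Ring A] [Algebra ℂ A] (a b : A) (r s : ℂ) :
    (a - r • 1) * (b - s • 1) = a * b - s • a - r • b + (r * s) • 1 := by
  simp only [sub_mul, mul_sub, smul_mul_assoc, mul_smul_comm, one_mul, mul_one]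
  module

lemma sg_data {x y : Gen} : (data c Δ q).sg x y = sgb (Gen.odd x) (Gen.odd y) := rfl

lemma br_data (x y : Gen) : (data c Δ q).br (some x) (some y) = Gen.br c Δ q x y := rfl

lemma ne_iff_eq_neg {ε δ : ℤˣ} : ε ≠ δ ↔ δ = -ε := by
  rcases Int.units_eq_one_or ε with rfl | rfl <;> rcases Int.units_eq_one_or δ with rfl | rfl <;>
    simp

variable (c Δ q) in
/-- The letters and the central element acting on the Verma module. -/
noncomputable def XO (o : Option Gen) : Module.End ℂ (NSVerma c Δ q) := o.elim 1 (X c Δ q)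

lemma lc_XO (o : Option Gen) : Finsupp.linearCombination ℂ (XO c Δ q) (e o) = XO c Δ q o := by
  simp [e]

lemma XO_some (x : Gen) : XO c Δ q (some x) = X c Δ q x := rfl

lemma XO_none : XO c Δ q none = 1 := rfl

/-- The scalars in `Gen.br` containing Δ and q compensate the subtraction made in `X`, and c
replaces the central element. This is the input for writing words of the Verma module in normal
form. -/
lemma X_rel (x y : Gen) : X c Δ q x * X c Δ q y
    = (data c Δ q).sg x y • (X c Δ q y * X c Δ q x)
      + Finsupp.linearCombination ℂ (XO c Δ q)
        ((data c Δ q).br (some x) (some y)) := by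
  rw [br_data, sg_data]
  rcases x with m | m | ⟨ε, m⟩ <;> rcases y with n | n | ⟨δ, n⟩
  case L.L =>
    have h := congrArg (act c Δ q) (ns_LL m n)
    simp only [map_sub, map_mul, map_add, map_smul, act_C] at h
    simp only [Gen.br, map_add, map_smul, lc_XO, XO_some, XO_none, X, sub_smul_mul_sub_smul, odd, sgb,
      Bool.and_self, Bool.false_eq_true, if_false]
    by_cases h0 : m + n = 0
    · obtain rfl : n = -m := by omega
      simp only [add_neg_cancel, if_true] at h ⊢
      push_cast at h ⊢
      linear_combination (norm := module) h
    · simp only [h0, if_false] at h ⊢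
      linear_combination (norm := module) h
  case L.H =>
    have h := congrArg (act c Δ q) (ns_LH m n)
    simp only [map_sub, map_mul, map_smul] at h
    simp only [Gen.br, map_add, map_smul, lc_XO, XO_some, XO_none, X, sub_smul_mul_sub_smul, odd, sgb,
      Bool.and_self, Bool.false_eq_true, if_false]
    split_ifs <;> linear_combination (norm := module) h
  case H.L =>
    have h := congrArg (act c Δ q) (ns_LH n m)
    simp only [map_sub, map_mul, map_smul] at h
    simp only [Gen.br, map_add, map_smul, lc_XO, XO_some, XO_none, X, sub_smul_mul_sub_smul, odd, sgb,
      Bool.and_self, Bool.false_eq_true, if_false]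
    split_ifs <;> linear_combination (norm := module) -h
  case H.H =>
    have h := congrArg (act c Δ q) (ns_HH m n)
    simp only [map_sub, map_mul, map_smul, act_C] at h
    simp only [Gen.br, map_smul, lc_XO, XO_none, X, sub_smul_mul_sub_smul, odd, sgb,
      Bool.and_self, Bool.false_eq_true, if_false]
    split_ifs at h ⊢ <;> linear_combination (norm := module) h
  case L.G =>
    have h := congrArg (act c Δ q) (ns_LG m δ n)
    simp only [map_sub, map_mul, map_smul] at h
    simp only [Gen.br, map_smul, lc_XO, XO_some, X, sub_mul, mul_sub, smul_mul_assoc,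
      mul_smul_comm, one_mul, mul_one, odd, sgb, Bool.false_and, Bool.false_eq_true, if_false]
    linear_combination (norm := module) h
  case G.L =>
    have h := congrArg (act c Δ q) (ns_LG n ε m)
    simp only [map_sub, map_mul, map_smul] at h
    simp only [Gen.br, map_smul, lc_XO, XO_some, X, sub_mul, mul_sub, smul_mul_assoc,
      mul_smul_comm, one_mul, mul_one, odd, sgb, Bool.and_false, Bool.false_eq_true, if_false]
    linear_combination (norm := module) -h
  case H.G =>
    have h := congrArg (act c Δ q) (ns_HG m δ n)
    simp only [map_sub, map_mul, map_smul] at h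
    simp only [Gen.br, map_smul, lc_XO, XO_some, X, sub_mul, mul_sub, smul_mul_assoc,
      mul_smul_comm, one_mul, mul_one, odd, sgb, Bool.false_and, Bool.false_eq_true, if_false]
    linear_combination (norm := module) h
  case G.H =>
    have h := congrArg (act c Δ q) (ns_HG n ε m)
    simp only [map_sub, map_mul, map_smul] at h
    simp only [Gen.br, map_smul, lc_XO, XO_some, X, sub_mul, mul_sub, smul_mul_assoc,
      mul_smul_comm, one_mul, mul_one, odd, sgb, Bool.and_false, Bool.false_eq_true, if_false]
    linear_combination (norm := module) -h
  case G.G =>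
    by_cases hε : ε = δ
    · subst hε
      have h := congrArg (act c Δ q) (ns_GG ε m n)
      simp only [map_add, map_mul, map_zero] at h
      simp only [Gen.br, X, odd, sgb, Bool.and_self, if_true, map_zero]
      linear_combination (norm := module) h
    · have hd := ne_iff_eq_neg.1 hε
      subst hd
      have h := congrArg (act c Δ q) (ns_GG' ε m n)
      simp only [map_add, map_mul, map_smul, act_C] at h
      simp only [Gen.br, if_neg hε, map_add, map_smul, lc_XO, XO_some, XO_none, X, odd, sgb,
        Bool.and_self, if_true]
      split_ifs at h ⊢ <;> linear_combination (norm := module) h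

lemma X_vac {x : Gen} (hx : ¬ neg x) : X c Δ q x (nsHW c Δ q) = 0 := by
  rcases x with m | m | ⟨ε, m⟩ <;> simp only [neg, not_lt] at hx
  · rcases hx.eq_or_lt with rfl | h
    · have := smul_nsHW_eq (c := c) (Δ := Δ) (q := q) (a := ns (.L 0)) (r := Δ)
        (Submodule.subset_span (by simp))
      simp [X, act_apply, this]
    · simp only [X, h.ne', if_false, zero_smul, sub_zero, act_apply]
      exact smul_nsHW_eq_zero (Submodule.subset_span (Or.inl (Or.inl ⟨m, h, Or.inl rfl⟩)))
  · rcases hx.eq_or_lt with rfl | h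
    · have := smul_nsHW_eq (c := c) (Δ := Δ) (q := q) (a := ns (.H 0)) (r := q)
        (Submodule.subset_span (by simp))
      simp [X, act_apply, this]
    · simp only [X, h.ne', if_false, zero_smul, sub_zero, act_apply]
      exact smul_nsHW_eq_zero (Submodule.subset_span (Or.inl (Or.inl ⟨m, h, Or.inr rfl⟩)))
  · exact smul_nsHW_eq_zero (Submodule.subset_span (Or.inl (Or.inr ⟨ε, m, hx, rfl⟩)))

section model

variable (c Δ q) in
/-- The generators acting on the space of normal words. -/
noncomputable def modelGen : NSGen → Module.End ℂ (data c Δ q).W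
  | .L m => (data c Δ q).op (.L m) + (if m = 0 then Δ else 0) • 1
  | .H m => (data c Δ q).op (.H m) + (if m = 0 then q else 0) • 1
  | .G ε k => (data c Δ q).op (.G ε k)
  | .C => c • 1

lemma add_smul_mul_add_smul {A : Type} [Ring A] [Algebra ℂ A] (a b : A) (r s : ℂ) :
    (a + r • 1) * (b + s • 1) = a * b + s • a + r • b + (r * s) • 1 := by
  simp only [add_mul, mul_add, smul_mul_assoc, mul_smul_comm, one_mul, mul_one]
  module

/-- The converse shift: adding Δ and q back turns `op_rel` into the defining relations. The result
is a highest weight module in which the normal words are independent by construction. -/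
lemma modelGen_rel {a b : FreeAlgebra ℂ NSGen} (h : NSRel a b) :
    FreeAlgebra.lift ℂ (modelGen c Δ q) a = FreeAlgebra.lift ℂ (modelGen c Δ q) b := by
  have key : ∀ o, Finsupp.linearCombination ℂ (data c Δ q).opO (e o) = (data c Δ q).opO o :=
    fun o => by simp [e]
  cases h with
  | LL m n =>
    have h := Data.op_rel (D := data c Δ q) (.L m) (.L n)
    simp only [br_data, sg_data, Gen.br, map_add, map_smul, key, Data.opO, Option.elim, odd, sgb,
      Bool.and_self, Bool.false_eq_true, if_false] at h
    simp only [map_sub, map_add, map_mul, map_smul, FreeAlgebra.lift_ι_apply, modelGen,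
      add_smul_mul_add_smul]
    by_cases h0 : m + n = 0
    · obtain rfl : n = -m := by omega
      simp only [add_neg_cancel, if_true] at h ⊢
      push_cast at h ⊢
      linear_combination (norm := module) h
    · simp only [h0, if_false] at h ⊢
      linear_combination (norm := module) h
  | HH m n =>
    have h := Data.op_rel (D := data c Δ q) (.H m) (.H n)
    simp only [br_data, sg_data, Gen.br, map_smul, key, Data.opO, Option.elim, odd, sgb,
      Bool.and_self, Bool.false_eq_true, if_false] at h
    simp only [map_sub, map_mul, map_smul, FreeAlgebra.lift_ι_apply, modelGen,
      add_smul_mul_add_smul]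
    split_ifs at h ⊢ <;> linear_combination (norm := module) h
  | LH m n =>
    have h := Data.op_rel (D := data c Δ q) (.L m) (.H n)
    simp only [br_data, sg_data, Gen.br, map_add, map_smul, key, Data.opO, Option.elim, odd, sgb,
      Bool.and_self, Bool.false_eq_true, if_false] at h
    simp only [map_sub, map_mul, map_smul, FreeAlgebra.lift_ι_apply, modelGen,
      add_smul_mul_add_smul]
    split_ifs at h ⊢ <;> linear_combination (norm := module) h
  | LG m ε k =>
    have h := Data.op_rel (D := data c Δ q) (.L m) (.G ε k)
    simp only [br_data, sg_data, Gen.br, map_smul, key, Data.opO, Option.elim, odd, sgb,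
      Bool.false_and, Bool.false_eq_true, if_false] at h
    simp only [map_sub, map_mul, map_smul, FreeAlgebra.lift_ι_apply, modelGen, add_mul, mul_add,
      smul_mul_assoc, mul_smul_comm, one_mul, mul_one]
    linear_combination (norm := module) h
  | HG m ε k =>
    have h := Data.op_rel (D := data c Δ q) (.H m) (.G ε k)
    simp only [br_data, sg_data, Gen.br, map_smul, key, Data.opO, Option.elim, odd, sgb,
      Bool.false_and, Bool.false_eq_true, if_false] at h
    simp only [map_sub, map_mul, map_smul, FreeAlgebra.lift_ι_apply, modelGen, add_mul, mul_add,
      smul_mul_assoc, mul_smul_comm, one_mul, mul_one]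
    linear_combination (norm := module) h
  | GG ε k l =>
    have h := Data.op_rel (D := data c Δ q) (.G ε k) (.G ε l)
    simp only [br_data, sg_data, Gen.br, if_true, map_zero, odd, sgb, Bool.and_self] at h
    simp only [map_add, map_mul, map_zero, FreeAlgebra.lift_ι_apply, modelGen]
    linear_combination (norm := module) h
  | GG' ε k l =>
    have hε : ε ≠ -ε := ne_iff_eq_neg.2 rfl
    have h := Data.op_rel (D := data c Δ q) (.G ε k) (.G (-ε) l)
    simp only [br_data, sg_data, Gen.br, if_neg hε, map_add, map_smul, key, Data.opO, Option.elim,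
      odd, sgb, Bool.and_self, if_true] at h
    simp only [map_add, map_mul, map_smul, FreeAlgebra.lift_ι_apply, modelGen]
    split_ifs at h ⊢ <;> linear_combination (norm := module) h
  | central x =>
    simp only [map_mul, FreeAlgebra.lift_ι_apply, modelGen]
    rw [smul_mul_assoc, mul_smul_comm, one_mul, mul_one]

variable (c Δ q) in
/-- The enveloping algebra acting on the space of normal words. -/
noncomputable def model : NSAlg →ₐ[ℂ] Module.End ℂ (data c Δ q).W :=
  RingQuot.liftAlgHom ℂ ⟨FreeAlgebra.lift ℂ (modelGen c Δ q), fun _ _ h => modelGen_rel h⟩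

lemma model_ns (x : NSGen) : model c Δ q (ns x) = modelGen c Δ q x := by
  rw [model, ns]
  exact (RingQuot.liftAlgHom_mkAlgHom_apply ℂ _ _ _).trans (FreeAlgebra.lift_ι_apply _ _)

lemma model_ideal {a : NSAlg} (h : a ∈ NSIdeal c Δ q) :
    model c Δ q a ((data c Δ q).nfW []) = 0 := by
  have hv : ∀ x : Gen, ¬ neg x → (data c Δ q).op x ((data c Δ q).nfW []) = 0 := fun x hx =>
    Data.op_vac (D := data c Δ q) hx
  induction h using Submodule.span_induction with
  | mem a h =>
    rcases h with (⟨m, hm, rfl | rfl⟩ | ⟨ε, k, hk, rfl⟩) | h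
    · rw [model_ns, modelGen, if_neg hm.ne', zero_smul, add_zero, hv _ (by simp [neg, hm.le])]
    · rw [model_ns, modelGen, if_neg hm.ne', zero_smul, add_zero, hv _ (by simp [neg, hm.le])]
    · rw [model_ns, modelGen, hv _ (by simp [neg, hk])]
    · rcases h with rfl | rfl | rfl
      · rw [map_sub, model_ns, modelGen, AlgHom.commutes, if_pos rfl, Algebra.algebraMap_eq_smul_one,
          add_sub_cancel_right, hv _ (by simp [neg])]
      · rw [map_sub, model_ns, modelGen, AlgHom.commutes, if_pos rfl, Algebra.algebraMap_eq_smul_one,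
          add_sub_cancel_right, hv _ (by simp [neg])]
      · rw [map_sub, model_ns, modelGen, AlgHom.commutes, Algebra.algebraMap_eq_smul_one, sub_self]
        rfl
  | zero => rw [map_zero]; rfl
  | add a b _ _ ha hb => rw [map_add, LinearMap.add_apply, ha, hb, add_zero]
  | smul a b _ hb => rw [smul_eq_mul, map_mul, Module.End.mul_apply, hb, map_zero]

variable (c Δ q) in
/-- The comparison of the Verma module with the space of normal words. -/
noncomputable def toW : NSVerma c Δ q →ₗ[ℂ] (data c Δ q).W :=
  (Submodule.liftQ ((NSIdeal c Δ q).restrictScalars ℂ)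
    ((LinearMap.applyₗ ((data c Δ q).nfW [])).comp (model c Δ q).toLinearMap)
    (fun _ h => LinearMap.mem_ker.2 (model_ideal h))).comp
    (Submodule.Quotient.restrictScalarsEquiv ℂ (NSIdeal c Δ q)).symm.toLinearMap

lemma toW_smul_nsHW (a : NSAlg) :
    toW c Δ q (a • nsHW c Δ q) = model c Δ q a ((data c Δ q).nfW []) := by
  change toW c Δ q (a • (NSIdeal c Δ q).mkQ 1) = _
  rw [← map_smul, smul_eq_mul, mul_one]
  rfl

lemma toW_smul (a : NSAlg) (v : NSVerma c Δ q) :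
    toW c Δ q (a • v) = model c Δ q a (toW c Δ q v) := by
  obtain ⟨b, rfl⟩ := v.exists_smul
  rw [smul_smul, toW_smul_nsHW, toW_smul_nsHW, map_mul, Module.End.mul_apply]

lemma toW_X (x : Gen) (v : NSVerma c Δ q) :
    toW c Δ q (X c Δ q x v) = (data c Δ q).op x (toW c Δ q v) := by
  cases x <;>
    simp only [X, LinearMap.sub_apply, LinearMap.smul_apply, Module.End.one_apply, map_sub,
      map_smul, act_apply, toW_smul, model_ns, modelGen, LinearMap.add_apply,
      add_sub_cancel_right]

/-- In particular normal words go to distinct basis elements, which is the source of their linear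
independence in the Verma module. -/
lemma toW_vec (l : List Gen) :
    toW c Δ q (vec (X c Δ q) (nsHW c Δ q) l) = (data c Δ q).nfW l := by
  induction l with
  | nil =>
    have := toW_smul_nsHW (c := c) (Δ := Δ) (q := q) 1
    rw [one_smul, map_one] at this
    exact this
  | cons x l ih => rw [vec_cons, toW_X, ih, Data.op_nfW]

end model

/-- Sorted words in the negative letters without repeated odd letters. -/
def IsNormal (l : List Gen) : Prop :=
  (∀ x ∈ l, neg x) ∧ l.Pairwise fun x y => ¬ (y < x ∨ x = y ∧ odd x = true)

/-- The index set of the basis of the Verma module. -/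
abbrev NW : Type := {l : List Gen // IsNormal l}

lemma IsNormal.data {l : List Gen} (h : IsNormal l) : (data c Δ q).Normal l := h

variable (c Δ q) in
/-- A word applied to the highest weight vector. -/
noncomputable def word (l : List Gen) : NSVerma c Δ q := vec (X c Δ q) (nsHW c Δ q) l

lemma word_mem_span_normal (l : List Gen) :
    word c Δ q l ∈ Submodule.span ℂ
      {v | ∃ w : NW, Data.wtw wt w.1 ≤ Data.wtw wt l ∧ v = word c Δ q w.1} := by
  rw [word, Data.vec_eq_nf (D := data c Δ q) (X c Δ q) (nsHW c Δ q) X_rel (fun x => X_vac) l,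
    Finsupp.linearCombination_apply]
  refine Submodule.sum_mem _ fun w hw => Submodule.smul_mem _ _ (Submodule.subset_span ?_)
  have hw' := Finsupp.mem_support_iff.1 hw
  have hn : (data c Δ q).Normal w := by
    by_contra hn
    exact hw' (Data.nf_apply_eq_zero l w hn)
  exact ⟨⟨w, hn⟩, Data.nf_weight wt wt_le l w hw', rfl⟩

lemma linearIndependent_word : LinearIndependent ℂ fun w : NW => word c Δ q w.1 := by
  refine LinearIndependent.of_comp ((data c Δ q).incl.comp (toW c Δ q)) ?_
  have : (((data c Δ q).incl.comp (toW c Δ q)) ∘ fun w : NW => word c Δ q w.1)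
      = fun w : NW => Finsupp.single w.1 (1 : ℂ) := by
    funext w
    simp only [Function.comp_apply, LinearMap.comp_apply, word, toW_vec, Data.incl_nfW,
      Data.nf_of_normal w.2.data]
  rw [this]
  exact (Finsupp.linearIndependent_single_one ℂ (List Gen)).comp _ Subtype.val_injective

/-- The span is stable under every letter, since a letter prefixed to a word gives a word and every
word straightens; it contains the highest weight vector, which generates. -/
lemma span_word : ⊤ ≤ Submodule.span ℂ (Set.range fun w : NW => word c Δ q w.1) := by
  have hall : ∀ l, word c Δ q l ∈ Submodule.span ℂ (Set.range fun w : NW => word c Δ q w.1) :=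
    fun l => Submodule.span_mono (by rintro v ⟨w, -, rfl⟩; exact ⟨w, rfl⟩) (word_mem_span_normal l)
  have hX : ∀ x v, v ∈ Submodule.span ℂ (Set.range fun w : NW => word c Δ q w.1) →
      X c Δ q x v ∈ Submodule.span ℂ (Set.range fun w : NW => word c Δ q w.1) := by
    intro x v hv
    induction hv using Submodule.span_induction with
    | mem v h => obtain ⟨w, rfl⟩ := h; exact hall (x :: w.1)
    | zero => rw [map_zero]; exact Submodule.zero_mem _
    | add a b _ _ ha hb => rw [map_add]; exact Submodule.add_mem _ ha hb
    | smul r a _ ha => rw [map_smul]; exact Submodule.smul_mem _ _ ha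
  rintro v -
  obtain ⟨a, rfl⟩ := v.exists_smul
  have hn : ∀ (a : NSAlg) v, v ∈ Submodule.span ℂ (Set.range fun w : NW => word c Δ q w.1) →
      a • v ∈ Submodule.span ℂ (Set.range fun w : NW => word c Δ q w.1) := by
    intro a
    induction a using NSAlg.induction with
    | hs r => intro v hv; rw [algebraMap_smul_verma]; exact Submodule.smul_mem _ _ hv
    | hx x =>
      intro v hv
      cases x with
      | L m =>
        have h := hX (.L m) v hv
        simp only [X, LinearMap.sub_apply, LinearMap.smul_apply, Module.End.one_apply,
          act_apply] at h
        exact (Submodule.sub_mem_iff_left _ (Submodule.smul_mem _ _ hv)).1 h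
      | H m =>
        have h := hX (.H m) v hv
        simp only [X, LinearMap.sub_apply, LinearMap.smul_apply, Module.End.one_apply,
          act_apply] at h
        exact (Submodule.sub_mem_iff_left _ (Submodule.smul_mem _ _ hv)).1 h
      | G ε k => exact hX (.G ε k) v hv
      | C => rw [← act_apply, act_C]; exact Submodule.smul_mem _ _ hv
    | hmul a b ha hb => intro v hv; rw [mul_smul]; exact ha _ (hb v hv)
    | hadd a b ha hb => intro v hv; rw [add_smul]; exact Submodule.add_mem _ (ha v hv) (hb v hv)
  exact hn a _ (hall [])

variable (c Δ q) in
/-- The Poincaré-Birkhoff-Witt basis of the Verma module. -/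
noncomputable def pbw : Module.Basis NW ℂ (NSVerma c Δ q) :=
  Module.Basis.mk linearIndependent_word span_word

lemma pbw_apply (w : NW) : pbw c Δ q w = word c Δ q w.1 := Module.Basis.mk_apply _ _ w

end verma

end N2

/-! ### Filtrations by weights of basis vectors, and leading parts of operators. -/

namespace Filtered

section

variable {ι V : Type} [AddCommGroup V] [Module ℂ V] (B : Module.Basis ι ℂ V) (ω : ι → ℕ)

/-- The span of the basis vectors of weight less than `n`. -/
def below (n : ℕ) : Submodule ℂ V where
  carrier := {v | ∀ i, B.repr v i ≠ 0 → ω i < n}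
  zero_mem' i h := absurd (by simp) h
  add_mem' {a b} ha hb i h := by
    by_cases h1 : B.repr a i = 0
    · exact hb i fun h2 => h (by rw [map_add, Finsupp.add_apply, h1, h2, add_zero])
    · exact ha i h1
  smul_mem' r a ha i h := ha i fun h1 => h (by rw [map_smul, Finsupp.smul_apply, h1, smul_zero])

/-- The component of weight `n`. -/
noncomputable def comp (n : ℕ) : V →ₗ[ℂ] V := B.constr ℂ fun i => if ω i = n then B i else 0

/-- The operators that raise weights by at most `d`. -/
def Fil (d : ℕ) (f : Module.End ℂ V) : Prop := ∀ n, ∀ v ∈ below B ω n, f v ∈ below B ω (n + d)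

/-- The part of an operator that raises weights by exactly `d`. -/
noncomputable def top (d : ℕ) (f : Module.End ℂ V) : Module.End ℂ V :=
  B.constr ℂ fun i => comp B ω (ω i + d) (f (B i))

variable {B ω}

lemma below_mono {m n : ℕ} (h : m ≤ n) : below B ω m ≤ below B ω n :=
  fun _ hv i hi => (hv i hi).trans_le h

lemma basis_mem_below {i : ι} {n : ℕ} (h : ω i < n) : B i ∈ below B ω n := by
  intro j hj
  by_cases h1 : i = j
  · exact h1 ▸ h
  · exact absurd (by rw [B.repr_self, Finsupp.single_eq_of_ne (Ne.symm h1)]) hj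

lemma comp_basis (n : ℕ) (i : ι) : comp B ω n (B i) = if ω i = n then B i else 0 :=
  B.constr_basis ℂ _ i

lemma top_basis (d : ℕ) (f : Module.End ℂ V) (i : ι) :
    top B ω d f (B i) = comp B ω (ω i + d) (f (B i)) :=
  B.constr_basis ℂ _ i

lemma repr_comp (n : ℕ) (v : V) (i : ι) :
    B.repr (comp B ω n v) i = if ω i = n then B.repr v i else 0 := by
  have : (Finsupp.lapply i ∘ₗ B.repr.toLinearMap) ∘ₗ comp B ω n
      = (if ω i = n then (1 : ℂ) else 0) • (Finsupp.lapply i ∘ₗ B.repr.toLinearMap) := by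
    refine B.ext fun j => ?_
    simp only [LinearMap.comp_apply, comp_basis, LinearMap.smul_apply, Finsupp.lapply_apply,
      LinearEquiv.coe_coe, smul_eq_mul]
    by_cases h : j = i
    · subst h; split_ifs <;> simp
    · split_ifs <;> simp [h]
  have h := LinearMap.congr_fun this v
  simp only [LinearMap.comp_apply, LinearMap.smul_apply, Finsupp.lapply_apply,
      LinearEquiv.coe_coe, smul_eq_mul, ite_mul, one_mul, zero_mul] at h
  exact h

lemma comp_eq_zero {m n : ℕ} (h : m ≤ n) {v : V} (hv : v ∈ below B ω m) : comp B ω n v = 0 := by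
  refine B.ext_elem fun i => ?_
  rw [repr_comp, map_zero, Finsupp.zero_apply]
  split_ifs with h1
  · by_contra h2
    have := hv i h2
    omega
  · rfl

lemma sub_comp_mem {n : ℕ} {v : V} (hv : v ∈ below B ω (n + 1)) :
    v - comp B ω n v ∈ below B ω n := by
  intro i hi
  rw [map_sub, Finsupp.sub_apply, repr_comp] at hi
  split_ifs at hi with h
  · simp at hi
  · have := hv i (by simpa using hi)
    omega

lemma top_comp_self (d n : ℕ) (f : Module.End ℂ V) (v : V) :
    top B ω d f (comp B ω n v) = comp B ω (n + d) (f (comp B ω n v)) := by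
  have : top B ω d f ∘ₗ comp B ω n = (comp B ω (n + d) ∘ₗ f) ∘ₗ comp B ω n := by
    refine B.ext fun i => ?_
    simp only [LinearMap.comp_apply, comp_basis]
    split_ifs with h
    · rw [top_basis, h]
    · simp
  exact LinearMap.congr_fun this v

/-- What lies below weight `n` is sent below `n + d`, so it does not reach the component of weight
`n + d`. -/
lemma comp_apply_of_fil {d n : ℕ} {f : Module.End ℂ V} (hf : Fil B ω d f) {v : V}
    (hv : v ∈ below B ω (n + 1)) :
    comp B ω (n + d) (f v) = top B ω d f (comp B ω n v) := by
  have h := comp_eq_zero le_rfl (hf n _ (sub_comp_mem hv))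
  rw [map_sub, map_sub, sub_eq_zero] at h
  rw [h, top_comp_self]

lemma fil_of_basis {d : ℕ} {f : Module.End ℂ V}
    (h : ∀ i, f (B i) ∈ below B ω (ω i + d + 1)) : Fil B ω d f := by
  intro n v hv
  rw [← B.linearCombination_repr v, Finsupp.linearCombination_apply, Finsupp.sum, map_sum]
  refine Submodule.sum_mem _ fun i hi => ?_
  rw [map_smul]
  have := hv i (Finsupp.mem_support_iff.1 hi)
  exact Submodule.smul_mem _ _ (below_mono (by omega) (h i))

lemma Fil.mul {d e : ℕ} {f g : Module.End ℂ V} (hf : Fil B ω d f) (hg : Fil B ω e g) :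
    Fil B ω (d + e) (f * g) := by
  intro n v hv
  have := hf _ _ (hg n v hv)
  rwa [add_assoc, add_comm e d] at this

lemma fil_one : Fil B ω 0 1 := fun _ _ hv => hv

/-- Multiplicativity of leading parts: relations between operators become relations between leading
parts in which only the terms of full weight survive. -/
lemma top_mul {d e : ℕ} {f g : Module.End ℂ V} (hf : Fil B ω d f) (hg : Fil B ω e g) :
    top B ω (d + e) (f * g) = top B ω d f * top B ω e g := by
  refine B.ext fun i => ?_
  have h : B i ∈ below B ω (ω i + 1) := basis_mem_below (by omega)
  have h1 : g (B i) ∈ below B ω (ω i + e + 1) := by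
    have := hg _ _ h
    rwa [add_right_comm] at this
  rw [top_basis, Module.End.mul_apply, Module.End.mul_apply, top_basis, ← comp_apply_of_fil hf h1]
  rw [add_assoc, add_comm e d]

lemma top_add (d : ℕ) (f g : Module.End ℂ V) :
    top B ω d (f + g) = top B ω d f + top B ω d g :=
  B.ext fun i => by simp [top_basis]

lemma top_smul (d : ℕ) (r : ℂ) (f : Module.End ℂ V) :
    top B ω d (r • f) = r • top B ω d f :=
  B.ext fun i => by simp [top_basis]

lemma top_one : top B ω 0 (1 : Module.End ℂ V) = 1 :=
  B.ext fun i => by simp [top_basis, comp_basis]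

lemma top_eq_zero {d e : ℕ} (h : d < e) {f : Module.End ℂ V} (hf : Fil B ω d f) :
    top B ω e f = 0 := by
  refine B.ext fun i => ?_
  rw [top_basis, LinearMap.zero_apply]
  exact comp_eq_zero (by omega) (hf (ω i + 1) _ (basis_mem_below (by omega)))

lemma top_apply_eq_zero {d n : ℕ} {f : Module.End ℂ V} (hf : Fil B ω d f) {v : V}
    (hv : v ∈ below B ω (n + 1)) (h : f v = 0) : top B ω d f (comp B ω n v) = 0 := by
  rw [← comp_apply_of_fil hf hv, h, map_zero]

/-- Every nonzero vector has a nonzero leading component. -/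
lemma exists_leading {v : V} (hv : v ≠ 0) :
    ∃ n, v ∈ below B ω (n + 1) ∧ comp B ω n v ≠ 0 := by
  have hne : (B.repr v).support.Nonempty := by
    rw [Finsupp.support_nonempty_iff]
    simpa using hv
  obtain ⟨i, hi, hmax⟩ := Finset.exists_max_image _ ω hne
  refine ⟨ω i, fun j hj => Nat.lt_succ_of_le (hmax j (Finsupp.mem_support_iff.2 hj)), fun h => ?_⟩
  have := repr_comp (B := B) (ω := ω) (ω i) v i
  rw [h, if_pos rfl, map_zero, Finsupp.zero_apply] at this
  exact Finsupp.mem_support_iff.1 hi this.symm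

end

end Filtered

/-! ### The relations between the leading parts of the letters. -/

namespace N2

open SuperPBW Gen Filtered

variable {c Δ q : ℂ}

/-- The weight of a normal word. -/
def NW.weight (w : NW) : ℕ := Data.wtw wt w.1

lemma word_mem_below (l : List Gen) :
    word c Δ q l ∈ below (pbw c Δ q) NW.weight (Data.wtw wt l + 1) := by
  refine Submodule.span_le.2 ?_ (word_mem_span_normal l)
  rintro v ⟨w, hw, rfl⟩
  rw [← pbw_apply]
  exact basis_mem_below (Nat.lt_succ_of_le hw)

lemma fil_X (x : Gen) : Fil (pbw c Δ q) NW.weight (wt x) (X c Δ q x) := by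
  refine fil_of_basis fun w => ?_
  rw [pbw_apply]
  have h := word_mem_below (c := c) (Δ := Δ) (q := q) (x :: w.1)
  have e : Data.wtw wt (x :: w.1) = NW.weight w + wt x := by
    simp [Data.wtw, NW.weight, add_comm]
  rw [e] at h
  exact h

variable (c Δ q) in
/-- The leading part of a letter. -/
noncomputable def hat (x : Gen) : Module.End ℂ (NSVerma c Δ q) :=
  top (pbw c Δ q) NW.weight (wt x) (X c Δ q x)

variable (c Δ q) in
/-- The leading part of a letter or of the central element in a given weight. -/
noncomputable def hatO (d : ℕ) (o : Option Gen) : Module.End ℂ (NSVerma c Δ q) :=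
  top (pbw c Δ q) NW.weight d (XO c Δ q o)

lemma hatO_some_of_lt {x : Gen} {d : ℕ} (h : wt x < d) : hatO c Δ q d (some x) = 0 :=
  top_eq_zero h (fil_X x)

lemma hatO_none_zero : hatO c Δ q 0 none = 1 := top_one

lemma hatO_none_of_pos {d : ℕ} (h : 0 < d) : hatO c Δ q d none = 0 := top_eq_zero h fil_one

variable (c Δ q) in
/-- The leading part as a linear map. -/
noncomputable def topL (d : ℕ) : Module.End ℂ (NSVerma c Δ q) →ₗ[ℂ] Module.End ℂ (NSVerma c Δ q) where
  toFun := top (pbw c Δ q) NW.weight d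
  map_add' := top_add d
  map_smul' := top_smul d

/-- The component of `X_rel` in weight `wt x + wt y`. Bracket terms of smaller weight drop out
through `hatO`. -/
lemma hat_rel (x y : Gen) : hat c Δ q x * hat c Δ q y
    = sgb (odd x) (odd y) • (hat c Δ q y * hat c Δ q x)
      + Finsupp.linearCombination ℂ (hatO c Δ q (wt x + wt y)) (br c Δ q x y) := by
  have h := congrArg (topL c Δ q (wt x + wt y)) (X_rel (c := c) (Δ := Δ) (q := q) x y)
  rw [map_add, map_smul, Finsupp.apply_linearCombination] at h
  have h1 : topL c Δ q (wt x + wt y) (X c Δ q x * X c Δ q y) = hat c Δ q x * hat c Δ q y :=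
    top_mul (fil_X x) (fil_X y)
  have h2 : topL c Δ q (wt x + wt y) (X c Δ q y * X c Δ q x) = hat c Δ q y * hat c Δ q x := by
    rw [add_comm]
    exact top_mul (fil_X y) (fil_X x)
  rw [h1, h2] at h
  exact h

variable (c Δ q) in
/-- The leading part of `L_{-1}`. -/
noncomputable def tt : Module.End ℂ (NSVerma c Δ q) := hat c Δ q (.L (-1))

lemma lc_hatO (d : ℕ) (o : Option Gen) :
    Finsupp.linearCombination ℂ (hatO c Δ q d) (e o) = hatO c Δ q d o := by
  simp [e]

lemma wt_L {m : ℤ} (hm : m ≠ -1) : wt (.L m) = 1 := if_neg hm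

lemma wt_tt : wt (.L (-1)) = 2 := by simp [wt]

lemma wt_H (m : ℤ) : wt (.H m) = 0 := rfl

lemma wt_G (ε : ℤˣ) (k : ℤ) : wt (.G ε k) = 1 := rfl

/-- The bracket has full weight 2 only if it hits L_{-1}; every other L, as well as the scalar,
disappears. -/
lemma hat_LL {m n : ℤ} (hm : m ≠ -1) (hn : n ≠ -1) : hat c Δ q (.L m) * hat c Δ q (.L n)
    = hat c Δ q (.L n) * hat c Δ q (.L m)
      + (if m + n = -1 then (m : ℂ) - n else 0) • tt c Δ q := by
  rw [hat_rel]
  simp only [br, map_add, map_smul, lc_hatO, odd, sgb, Bool.and_self, Bool.false_eq_true, if_false,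
    one_smul, wt_L hm, wt_L hn, hatO_none_of_pos two_pos, one_add_one_eq_two, smul_zero, add_zero]
  split_ifs with h
  · rw [h]; rfl
  · rw [hatO_some_of_lt (by rw [wt_L h]; omega), smul_zero, zero_smul]

lemma hat_LH {m : ℤ} (hm : m ≠ -1) (n : ℤ) : hat c Δ q (.L m) * hat c Δ q (.H n)
    = hat c Δ q (.H n) * hat c Δ q (.L m) := by
  rw [hat_rel]
  simp only [br, map_add, map_smul, lc_hatO, odd, sgb, Bool.and_self, Bool.false_eq_true, if_false,
    one_smul, wt_L hm, wt_H, hatO_none_of_pos one_pos, add_zero, smul_zero,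
    hatO_some_of_lt (x := .H (m + n)) (d := 1) one_pos]

lemma hat_LG {m : ℤ} (hm : m ≠ -1) (ε : ℤˣ) (k : ℤ) : hat c Δ q (.L m) * hat c Δ q (.G ε k)
    = hat c Δ q (.G ε k) * hat c Δ q (.L m) := by
  rw [hat_rel]
  simp only [br, map_smul, lc_hatO, odd, sgb, Bool.false_and, Bool.false_eq_true, if_false,
    one_smul, wt_L hm, wt_G, add_zero, smul_zero, one_add_one_eq_two,
    hatO_some_of_lt (x := .G ε (m + k)) (d := 2) one_lt_two]

/-- Every bracket with L_{-1} loses weight, so its leading part is central. -/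
lemma tt_comm (x : Gen) : tt c Δ q * hat c Δ q x = hat c Δ q x * tt c Δ q := by
  rw [tt, hat_rel]
  rcases x with m | m | ⟨ε, m⟩
  · have h1 : wt (.L (-1 + m)) < wt (.L (-1)) + wt (.L m) := by
      simp only [wt]; split_ifs <;> omega
    have h2 : 0 < wt (.L (-1)) + wt (.L m) := by rw [wt_tt]; omega
    simp only [br, map_add, map_smul, lc_hatO, odd, sgb, Bool.and_self, Bool.false_eq_true,
      if_false, one_smul, hatO_none_of_pos h2, hatO_some_of_lt h1, smul_zero, add_zero]
  · simp only [br, map_add, map_smul, lc_hatO, odd, sgb, Bool.and_self, Bool.false_eq_true,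
      if_false, one_smul, wt_tt, wt_H, hatO_none_of_pos two_pos, add_zero, smul_zero,
      hatO_some_of_lt (x := .H (-1 + m)) (d := 2) two_pos]
  · have h1 : wt (.G ε (-1 + m)) < 2 + 1 := by rw [wt_G]; omega
    simp only [br, map_smul, lc_hatO, odd, sgb, Bool.false_and, Bool.false_eq_true, if_false,
      one_smul, wt_tt, wt_G, add_zero, smul_zero, hatO_some_of_lt h1]

/-- All weights are 0, so the scalar survives. This is the only place where the central charge
enters the graded relations. -/
lemma hat_HH (m n : ℤ) : hat c Δ q (.H m) * hat c Δ q (.H n)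
    = hat c Δ q (.H n) * hat c Δ q (.H m) + (if m + n = 0 then (m : ℂ) / 3 * c else 0) • 1 := by
  rw [hat_rel]
  simp only [br, map_smul, lc_hatO, odd, sgb, Bool.and_self, Bool.false_eq_true, if_false,
    one_smul, wt_H, add_zero, hatO_none_zero]

lemma hat_HG (m : ℤ) (ε : ℤˣ) (k : ℤ) : hat c Δ q (.H m) * hat c Δ q (.G ε k)
    = hat c Δ q (.G ε k) * hat c Δ q (.H m) + ((ε : ℤ) : ℂ) • hat c Δ q (.G ε (m + k)) := by
  rw [hat_rel]
  simp only [br, map_smul, lc_hatO, odd, sgb, Bool.false_and, Bool.false_eq_true, if_false,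
    one_smul, wt_H, wt_G, zero_add]
  rfl

lemma hat_GG (ε : ℤˣ) (k l : ℤ) : hat c Δ q (.G ε k) * hat c Δ q (.G ε l)
    = -(hat c Δ q (.G ε l) * hat c Δ q (.G ε k)) := by
  rw [hat_rel]
  simp only [br, if_true, map_zero, odd, sgb, Bool.and_self, neg_smul, one_smul, add_zero]

/-- Only L_{-1} has full weight, so the fermions pair for r + s = -1 and not for r + s = 0. In
particular G^±_{-1/2} pair with each other and with no positive mode. -/
lemma hat_GG' (ε : ℤˣ) (k l : ℤ) : hat c Δ q (.G ε k) * hat c Δ q (.G (-ε) l)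
    = -(hat c Δ q (.G (-ε) l) * hat c Δ q (.G ε k))
      + (if k + l + 2 = 0 then (2 : ℂ) else 0) • tt c Δ q := by
  have hε : ε ≠ -ε := ne_iff_eq_neg.2 rfl
  rw [hat_rel]
  simp only [br, if_neg hε, map_add, map_smul, lc_hatO, odd, sgb, Bool.and_self, if_true, neg_smul,
    one_smul, wt_G, one_add_one_eq_two, hatO_none_of_pos two_pos, smul_zero, add_zero,
    hatO_some_of_lt (x := .H (k + l + 1)) (d := 2) two_pos]
  split_ifs with h
  · obtain h' : k + l + 1 = -1 := by omega
    rw [h']; rfl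
  · rw [hatO_some_of_lt (by rw [wt_L (by omega)]; omega), smul_zero, zero_smul]

lemma isNormal_nil : IsNormal [] := ⟨by simp, List.Pairwise.nil⟩

lemma hat_vac {x : Gen} (hx : ¬ neg x) : hat c Δ q x (nsHW c Δ q) = 0 := by
  have h : nsHW c Δ q = pbw c Δ q ⟨[], isNormal_nil⟩ := (pbw_apply ⟨[], isNormal_nil⟩).symm
  rw [hat, h, top_basis, ← h, X_vac hx, map_zero]

lemma IsNormal.tail {x : Gen} {l : List Gen}
    (h : IsNormal (x :: l)) :
    IsNormal l :=
  ⟨fun y hy => h.1 y (List.mem_cons_of_mem x hy), (List.pairwise_cons.1 h.2).2⟩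

/-- When the longer word is normal it is itself a basis vector of the full weight, so no lower terms
are discarded. -/
lemma hat_word {x : Gen} {l : List Gen}
    (h : IsNormal (x :: l)) :
    hat c Δ q x (word c Δ q l) = word c Δ q (x :: l) := by
  have h1 := pbw_apply (c := c) (Δ := Δ) (q := q) ⟨l, h.tail⟩
  have h2 := pbw_apply (c := c) (Δ := Δ) (q := q) ⟨x :: l, h⟩
  rw [hat, ← h1, top_basis, h1]
  change comp _ _ _ (word c Δ q (x :: l)) = _
  rw [← h2, comp_basis, if_pos]
  simp [NW.weight, Data.wtw, add_comm]

lemma vec_hat (w : NW) : vec (hat c Δ q) (nsHW c Δ q) w.1 = pbw c Δ q w := by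
  obtain ⟨l, hl⟩ := w
  rw [pbw_apply]
  induction l with
  | nil => rfl
  | cons x l ih => rw [vec_cons, ih (hl.tail), hat_word hl]

end N2

/-! ### Operators counting letters, and the common kernel of the positive leading parts. -/

namespace N2

open SuperPBW Gen Filtered Filter

variable {c Δ q : ℂ}

lemma commute_tt (x : Gen) : Commute (tt c Δ q) (hat c Δ q x) := tt_comm x

lemma commute_hat_LG {m : ℤ} (hm : m ≠ -1) (ε : ℤˣ) (k : ℤ) :
    Commute (hat c Δ q (.L m)) (hat c Δ q (.G ε k)) := hat_LG hm ε k

lemma commute_hat_LH {m : ℤ} (hm : m ≠ -1) (n : ℤ) :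
    Commute (hat c Δ q (.L m)) (hat c Δ q (.H n)) := hat_LH hm n

variable (c Δ q) in
/-- A word in the leading parts of the letters applied to the highest weight vector. -/
noncomputable def hword (l : List Gen) : NSVerma c Δ q := vec (hat c Δ q) (nsHW c Δ q) l

lemma hword_cons (x : Gen) (l : List Gen) :
    hword c Δ q (x :: l) = hat c Δ q x (hword c Δ q l) := rfl

lemma isNormal_tt_cons {l : List Gen} (h : IsNormal l) : IsNormal (.L (-1) :: l) := by
  refine ⟨?_, List.pairwise_cons.2 ⟨fun y hy => ?_, h.2⟩⟩
  · rintro x hx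
    rcases List.mem_cons.1 hx with rfl | hx
    · simp [neg]
    · exact h.1 x hx
  · rintro (h1 | ⟨-, h1⟩)
    · rw [lt_iff] at h1
      have h0 : cls (.L (-1)) = 0 := by simp [cls]
      rw [h0] at h1
      rcases h1 with h1 | ⟨h1, h2⟩
      · omega
      · cases y with
        | L m =>
          simp only [cls] at h1
          split_ifs at h1 with h3
          subst h3
          exact lt_irrefl _ h2
        | H m => simp only [cls] at h1; split_ifs at h1
        | G ε m => simp only [cls] at h1; split_ifs at h1
    · simp [odd] at h1

lemma tt_pbw (w : NW) :
    tt c Δ q (pbw c Δ q w) = pbw c Δ q ⟨.L (-1) :: w.1, isNormal_tt_cons w.2⟩ := by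
  rw [pbw_apply, pbw_apply, tt, hat_word (isNormal_tt_cons w.2)]

lemma repr_tt (v : NSVerma c Δ q) (w : NW) :
    (pbw c Δ q).repr (tt c Δ q v) ⟨.L (-1) :: w.1, isNormal_tt_cons w.2⟩
      = (pbw c Δ q).repr v w := by
  classical
  have : (Finsupp.lapply (⟨.L (-1) :: w.1, isNormal_tt_cons w.2⟩ : NW) ∘ₗ
      (pbw c Δ q).repr.toLinearMap) ∘ₗ tt c Δ q
      = Finsupp.lapply w ∘ₗ (pbw c Δ q).repr.toLinearMap := by
    refine (pbw c Δ q).ext fun u => ?_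
    simp only [LinearMap.comp_apply, tt_pbw, LinearEquiv.coe_coe, Module.Basis.repr_self,
      Finsupp.lapply_apply, Finsupp.single_apply, Subtype.ext_iff, List.cons.injEq, true_and]
  exact LinearMap.congr_fun this v

/-- On the basis it prefixes the least letter, an injective map of normal words. -/
lemma tt_injective : Function.Injective (tt c Δ q) := by
  rw [injective_iff_map_eq_zero]
  intro v hv
  refine (pbw c Δ q).ext_elem fun w => ?_
  rw [← repr_tt, hv, map_zero]
  rfl

/-- The inductive step for operators that count a letter in words. -/
lemma count_step {E : ℕ → Module.End ℂ (NSVerma c Δ q)} {x y : Gen} {κ : ℂ} {l : List Gen}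
    (hx : ∀ᶠ N in atTop, E N (hword c Δ q (x :: l)) = hat c Δ q x (E N (hword c Δ q l))
      + (if x = y then κ else 0) • tt c Δ q (hword c Δ q (x :: l)))
    (ih : ∀ᶠ N in atTop, E N (hword c Δ q l)
      = (κ * (l.count y : ℂ)) • tt c Δ q (hword c Δ q l)) :
    ∀ᶠ N in atTop, E N (hword c Δ q (x :: l))
      = (κ * ((x :: l).count y : ℂ)) • tt c Δ q (hword c Δ q (x :: l)) := by
  filter_upwards [hx, ih] with N h1 h2
  have h3 := LinearMap.congr_fun (tt_comm (c := c) (Δ := Δ) (q := q) x) (hword c Δ q l)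
  rw [Module.End.mul_apply, Module.End.mul_apply] at h3
  rw [h1, h2, map_smul, ← h3, ← hword_cons, ← add_smul, List.count_cons]
  congr 1
  by_cases h : x = y
  · simp only [h, if_true, beq_self_eq_true]; push_cast; ring
  · simp [h]

/-- A vector killed by operators that count a letter only involves words without that letter. -/
lemma count_eq_zero {E : ℕ → Module.End ℂ (NSVerma c Δ q)} {y : Gen} {κ : ℂ} (hκ : κ ≠ 0)
    {s : NSVerma c Δ q} (hs : ∀ᶠ N in atTop, E N s = 0)
    (h : ∀ w ∈ ((pbw c Δ q).repr s).support, ∀ᶠ N in atTop, E N (hword c Δ q w.1)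
      = (κ * (w.1.count y : ℂ)) • tt c Δ q (hword c Δ q w.1)) :
    ∀ w ∈ ((pbw c Δ q).repr s).support, y ∉ w.1 := by
  classical
  -- The support is finite, so one cutoff serves all its words.
  obtain ⟨N, h0, hN⟩ := (hs.and ((Filter.eventually_all_finset _).2 h)).exists
  intro w hw
  have h1 : tt c Δ q (∑ u ∈ ((pbw c Δ q).repr s).support,
      ((pbw c Δ q).repr s u * (κ * (u.1.count y : ℂ))) • pbw c Δ q u) = tt c Δ q 0 := by
    rw [map_zero, ← h0]
    nth_rewrite 3 [← (pbw c Δ q).linearCombination_repr s]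
    rw [Finsupp.linearCombination_apply, Finsupp.sum, map_sum, map_sum]
    refine Finset.sum_congr rfl fun u hu => ?_
    have := hN u hu
    rw [hword, vec_hat] at this
    rw [map_smul, map_smul, this, smul_smul]
  -- As `tt` is injective, t can be cancelled; then the coordinate at `w`, multiplied by κ and by
  -- the number of letters `y`, must vanish.
  have h2 := congrArg (fun v => (pbw c Δ q).repr v w) (tt_injective h1)
  simp only [map_sum, map_smul, Module.Basis.repr_self, map_zero, Finsupp.zero_apply,
    Finsupp.finsetSum_apply, Finsupp.smul_apply, smul_eq_mul] at h2
  rw [Finset.sum_eq_single w] at h2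
  · rw [Finsupp.single_eq_same, mul_one] at h2
    have h3 := (mul_eq_zero.1 h2).resolve_left (Finsupp.mem_support_iff.1 hw)
    have h4 := (mul_eq_zero.1 h3).resolve_left hκ
    exact List.count_eq_zero.1 (by exact_mod_cast h4)
  · intro u _ hu
    rw [Finsupp.single_eq_of_ne (Ne.symm hu), mul_zero]
  · intro h; exact absurd hw h

section L

/-- Among the negative letters only L_{-k-1} fails to commute with this product, through [L_k,
L_{-k-1}] = (2k+1) t; L_{-1} itself is central. -/
lemma L_step {k : ℤ} (hk : 1 ≤ k) {x : Gen} (hx : neg x) :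
    hat c Δ q (.L (-k - 1)) * hat c Δ q (.L k) * hat c Δ q x
      = hat c Δ q x * (hat c Δ q (.L (-k - 1)) * hat c Δ q (.L k))
        + (if x = .L (-k - 1) then (2 * k + 1 : ℂ) else 0) • (tt c Δ q * hat c Δ q x) := by
  have h1 : k ≠ -1 := by omega
  have h2 : -k - 1 ≠ -1 := by omega
  rcases x with n | n | ⟨ε, n⟩
  · by_cases hn : n = -1
    · subst hn
      have h3 : ¬ (-1 = -k - 1) := by omega
      simp only [Gen.L.injEq, h3, if_false, zero_smul, add_zero]
      exact (((commute_tt _).mul_right (commute_tt _)).eq).symm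
    · simp only [neg] at hx
      rw [mul_assoc, hat_LL h1 hn, mul_add, ← mul_assoc, hat_LL h2 hn,
        if_neg (show ¬ (-k - 1 + n = -1) by omega), zero_smul, add_zero, mul_assoc, mul_smul_comm,
        ← tt_comm]
      by_cases h : n = -k - 1
      · subst h
        rw [if_pos (by omega), if_pos rfl]
        push_cast
        congr 2
        ring
      · rw [if_neg (by omega), if_neg (by simpa using h), zero_smul, zero_smul]
  · rw [if_neg (by simp), zero_smul, add_zero]
    rw [mul_assoc, hat_LH h1, ← mul_assoc, hat_LH h2, mul_assoc]
  · rw [if_neg (by simp), zero_smul, add_zero]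
    rw [mul_assoc, hat_LG h1, ← mul_assoc, hat_LG h2, mul_assoc]

lemma L_count {k : ℤ} (hk : 1 ≤ k) {l : List Gen} (hl : ∀ x ∈ l, neg x) :
    ∀ᶠ _N : ℕ in atTop, (hat c Δ q (.L (-k - 1)) * hat c Δ q (.L k)) (hword c Δ q l)
      = ((2 * k + 1 : ℂ) * (l.count (.L (-k - 1)) : ℂ)) • tt c Δ q (hword c Δ q l) := by
  induction l with
  | nil =>
    have h : hat c Δ q (.L k) (hword c Δ q []) = 0 := hat_vac (by simp only [neg]; omega)
    simp [h]
  | cons x l ih =>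
    refine count_step (Eventually.of_forall fun _ => ?_)
      (ih fun y hy => hl y (List.mem_cons_of_mem x hy))
    have h := LinearMap.congr_fun (L_step (c := c) (Δ := Δ) (q := q) hk
      (hl x List.mem_cons_self)) (hword c Δ q l)
    exact h

end L

section G

lemma eq_or_eq_neg (ε δ : ℤˣ) : δ = ε ∨ δ = -ε := by
  by_cases h : ε = δ
  · exact Or.inl h.symm
  · exact Or.inr (ne_iff_eq_neg.1 h)

lemma hat_GG_neg (ε : ℤˣ) (k l : ℤ) : hat c Δ q (.G (-ε) k) * hat c Δ q (.G ε l)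
    = -(hat c Δ q (.G ε l) * hat c Δ q (.G (-ε) k))
      + (if k + l + 2 = 0 then (2 : ℂ) else 0) • tt c Δ q := by
  have h := hat_GG' (c := c) (Δ := Δ) (q := q) (-ε) k l
  rwa [neg_neg] at h

/-- The indices k - 1 and -k - 1 add up to -2, so these two fermions are conjugate. The letters H
are excluded because their brackets with fermions survive. -/
lemma G_step (ε : ℤˣ) {k : ℤ} (hk : 1 ≤ k) {x : Gen} (hx : neg x)
    (hx' : x = .L (-1) ∨ ∃ δ l, x = .G δ l) :
    hat c Δ q (.G (-ε) (-k - 1)) * hat c Δ q (.G ε (k - 1)) * hat c Δ q x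
      = hat c Δ q x * (hat c Δ q (.G (-ε) (-k - 1)) * hat c Δ q (.G ε (k - 1)))
        + (if x = .G (-ε) (-k - 1) then (2 : ℂ) else 0) • (tt c Δ q * hat c Δ q x) := by
  rcases hx' with rfl | ⟨δ, l, rfl⟩
  · rw [if_neg (by simp), zero_smul, add_zero]
    exact (((commute_tt _).mul_right (commute_tt _)).eq).symm
  · simp only [neg] at hx
    rcases eq_or_eq_neg ε δ with rfl | rfl
    · have h : (.G δ l : Gen) ≠ .G (-δ) (-k - 1) := by
        intro h
        rw [Gen.G.injEq] at h
        exact ne_iff_eq_neg.2 rfl h.1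
      rw [if_neg h, zero_smul, add_zero, mul_assoc, hat_GG, mul_neg, ← mul_assoc, hat_GG_neg,
        if_neg (by omega), zero_smul, add_zero, neg_mul, neg_neg, mul_assoc]
    · rw [mul_assoc, hat_GG', mul_add, mul_neg, ← mul_assoc, hat_GG (-ε), neg_mul, neg_neg,
        mul_assoc, mul_smul_comm, ← tt_comm]
      by_cases h : l = -k - 1
      · subst h
        rw [if_pos (by omega), if_pos rfl]
      · rw [if_neg (by omega), if_neg (by simpa using h), zero_smul, zero_smul]

lemma G_count (ε : ℤˣ) {k : ℤ} (hk : 1 ≤ k) {l : List Gen} (hl : ∀ x ∈ l, neg x)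
    (hl' : ∀ x ∈ l, x = .L (-1) ∨ ∃ δ l, x = .G δ l) :
    ∀ᶠ _N : ℕ in atTop,
      (hat c Δ q (.G (-ε) (-k - 1)) * hat c Δ q (.G ε (k - 1))) (hword c Δ q l)
      = ((2 : ℂ) * (l.count (.G (-ε) (-k - 1)) : ℂ)) • tt c Δ q (hword c Δ q l) := by
  induction l with
  | nil =>
    have h : hat c Δ q (.G ε (k - 1)) (hword c Δ q []) = 0 := hat_vac (by simp only [neg]; omega)
    simp [h]
  | cons x l ih =>
    refine count_step (Eventually.of_forall fun _ => ?_)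
      (ih (fun y hy => hl y (List.mem_cons_of_mem x hy))
        fun y hy => hl' y (List.mem_cons_of_mem x hy))
    have h := LinearMap.congr_fun (G_step (c := c) (Δ := Δ) (q := q) ε hk
      (hl x List.mem_cons_self) (hl' x List.mem_cons_self)) (hword c Δ q l)
    exact h

end G

section H

variable (c Δ q) in
/-- The modes of a free field built from the leading parts of `H` and of the fermions, with a
cutoff. -/
noncomputable def Z (N : ℕ) (k : ℤ) : Module.End ℂ (NSVerma c Δ q) :=
  (2 : ℂ) • (tt c Δ q * hat c Δ q (.H k))
    - ∑ i ∈ Finset.range (2 * N),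
        hat c Δ q (.G 1 ((i : ℤ) - N)) * hat c Δ q (.G (-1) (k - 2 - ((i : ℤ) - N)))

/-- The indices in each summand add up to k - 2 ≥ -1. Hence one of the two fermions has index at
least 0, and the two anticommute, so that one can be moved to the right. -/
lemma Z_apply_eq_zero {N : ℕ} {k : ℤ} (hk : 1 ≤ k) {s : NSVerma c Δ q}
    (hH : hat c Δ q (.H k) s = 0) (hG : ∀ ε l, 0 ≤ l → hat c Δ q (.G ε l) s = 0) :
    Z c Δ q N k s = 0 := by
  rw [Z, LinearMap.sub_apply, LinearMap.smul_apply, Module.End.mul_apply, hH, map_zero, smul_zero,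
    zero_sub, neg_eq_zero, LinearMap.sum_apply]
  refine Finset.sum_eq_zero fun i _ => ?_
  rcases lt_or_ge ((i : ℤ) - N) 0 with h | h
  · rw [Module.End.mul_apply, hG (-1) _ (by omega), map_zero]
  · rw [hat_GG' 1, if_neg (by omega), zero_smul, add_zero, LinearMap.neg_apply,
      Module.End.mul_apply, hG 1 _ h, map_zero, neg_zero]

lemma commute_tt_Z (N : ℕ) (k : ℤ) : Commute (tt c Δ q) (Z c Δ q N k) :=
  (((Commute.refl _).mul_right (commute_tt _)).smul_right _).sub_right
    (Commute.sum_right _ _ _ fun _ _ => (commute_tt _).mul_right (commute_tt _))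

lemma commute_L_Z {m : ℤ} (hm : m ≠ -1) (N : ℕ) (k : ℤ) :
    Commute (hat c Δ q (.L m)) (Z c Δ q N k) :=
by
  have h1 : Commute (hat c Δ q (.L m)) (tt c Δ q * hat c Δ q (.H k)) :=
    (commute_tt _).symm.mul_right (commute_hat_LH hm k)
  have h2 : ∀ a b, Commute (hat c Δ q (.L m)) (hat c Δ q (.G 1 a) * hat c Δ q (.G (-1) b)) :=
    fun a b => (commute_hat_LG hm 1 a).mul_right (commute_hat_LG hm (-1) b)
  exact (h1.smul_right _).sub_right (Commute.sum_right _ _ _ fun _ _ => h2 _ _)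

lemma sum_range_ite {A : Type} [AddCommGroup A] (g : ℤ → A) {N : ℕ} {d : ℤ} (h1 : -N ≤ d)
    (h2 : d < N) :
    ∑ i ∈ Finset.range (2 * N), (if (i : ℤ) - N = d then g ((i : ℤ) - N) else 0) = g d := by
  rw [Finset.sum_eq_single (d + N).toNat]
  · have : (((d + N).toNat : ℕ) : ℤ) - N = d := by omega
    rw [this, if_pos rfl]
  · intro i _ hi
    rw [if_neg]
    omega
  · intro h
    rw [Finset.mem_range] at h
    omega

/-- The bracket of 2 t H_k with G^ε_l is a multiple of t G^ε_{k+l}. It is cancelled by the single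
summand that contracts with G^ε_l, at summation index k + l for ε = 1 and -l - 2 for ε = -1; the
hypotheses on `N` keep this index inside the cutoff. -/
lemma commute_G_Z {N : ℕ} {k l : ℤ} (hN : |k + l| < N) (hN' : |l + 2| < N) (ε : ℤˣ) :
    Commute (hat c Δ q (.G ε l)) (Z c Δ q N k) := by
  rw [abs_lt] at hN hN'
  have hH : hat c Δ q (.G ε l) * (tt c Δ q * hat c Δ q (.H k))
      = tt c Δ q * hat c Δ q (.H k) * hat c Δ q (.G ε l)
        - ((ε : ℤ) : ℂ) • (tt c Δ q * hat c Δ q (.G ε (k + l))) := by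
    rw [← mul_assoc, ← tt_comm, mul_assoc, mul_assoc, hat_HG, mul_add, mul_smul_comm,
      add_sub_cancel_right]
  rw [commute_iff_eq, Z, mul_sub, sub_mul, mul_smul_comm, hH, smul_sub, smul_mul_assoc,
    Finset.mul_sum, Finset.sum_mul, sub_sub]
  congr 1
  rcases Int.units_eq_one_or ε with rfl | rfl
  · have h : ∀ i : ℕ, hat c Δ q (.G 1 l) * (hat c Δ q (.G 1 ((i : ℤ) - N))
          * hat c Δ q (.G (-1) (k - 2 - ((i : ℤ) - N))))
        = hat c Δ q (.G 1 ((i : ℤ) - N)) * hat c Δ q (.G (-1) (k - 2 - ((i : ℤ) - N)))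
            * hat c Δ q (.G 1 l)
          - (if (i : ℤ) - N = k + l then
              (2 : ℂ) • (tt c Δ q * hat c Δ q (.G 1 ((i : ℤ) - N))) else 0) := by
      intro i
      rw [← mul_assoc, hat_GG 1 l, neg_mul, mul_assoc, hat_GG' 1 l, mul_assoc, mul_add, mul_neg,
        neg_add, neg_neg, ← sub_eq_add_neg, mul_smul_comm, ← tt_comm]
      congr 1
      by_cases hi : (i : ℤ) - N = k + l
      · rw [if_pos (by omega), if_pos hi]
      · rw [if_neg (by omega), if_neg hi, zero_smul]
    rw [Finset.sum_congr rfl fun i _ => h i, Finset.sum_sub_distrib, sum_range_ite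
      (fun a => (2 : ℂ) • (tt c Δ q * hat c Δ q (.G 1 a))) (by omega) (by omega)]
    simp
  · have h : ∀ i : ℕ, hat c Δ q (.G (-1) l) * (hat c Δ q (.G 1 ((i : ℤ) - N))
          * hat c Δ q (.G (-1) (k - 2 - ((i : ℤ) - N))))
        = hat c Δ q (.G 1 ((i : ℤ) - N)) * hat c Δ q (.G (-1) (k - 2 - ((i : ℤ) - N)))
            * hat c Δ q (.G (-1) l)
          + (if (i : ℤ) - N = -l - 2 then
              (2 : ℂ) • (tt c Δ q * hat c Δ q (.G (-1) (k - 2 - ((i : ℤ) - N)))) else 0) := by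
      intro i
      rw [← mul_assoc, hat_GG_neg 1 l, add_mul, neg_mul, mul_assoc _ (hat c Δ q (.G (-1) l)),
        hat_GG (-1) l, mul_neg, neg_neg, mul_assoc, smul_mul_assoc]
      congr 1
      by_cases hi : (i : ℤ) - N = -l - 2
      · rw [if_pos (by omega), if_pos hi]
      · rw [if_neg (by omega), if_neg hi, zero_smul]
    rw [Finset.sum_congr rfl fun i _ => h i, Finset.sum_add_distrib, sum_range_ite
      (fun a => (2 : ℂ) • (tt c Δ q * hat c Δ q (.G (-1) (k - 2 - a)))) (by omega) (by omega)]
    have : k - 2 - (-l - 2) = k + l := by ring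
    rw [this]
    push_cast
    module

/-- On a given word all high fermion modes vanish, so the truncated sum in `Z` can be controlled at
both ends of its range. -/
lemma exists_G_eq_zero {l : List Gen} (hl : ∀ x ∈ l, neg x) :
    ∃ A : ℤ, ∀ ε a, A ≤ a → hat c Δ q (.G ε a) (hword c Δ q l) = 0 := by
  induction l with
  | nil => exact ⟨0, fun ε a ha => hat_vac (by simpa only [neg, not_lt] using ha)⟩
  | cons x l ih =>
    obtain ⟨A, hA⟩ := ih fun y hy => hl y (List.mem_cons_of_mem x hy)
    -- The summand |ind x| absorbs the index shift caused by an H, and 3 keeps a fermion from being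
    -- conjugate to the letter passed.
    refine ⟨|A| + |ind x| + 3, fun ε a ha => ?_⟩
    have h4 := le_abs_self A
    have h5 := abs_nonneg A
    have h1 := neg_abs_le (ind x)
    have h2 := abs_nonneg (ind x)
    rw [hword_cons, ← Module.End.mul_apply]
    rcases x with n | n | ⟨δ, n⟩
    · by_cases hn : n = -1
      · subst hn
        have h3 := tt_comm (c := c) (Δ := Δ) (q := q) (.G ε a)
        rw [tt] at h3
        rw [← h3, Module.End.mul_apply, hA _ _ (by omega), map_zero]
      · rw [← hat_LG hn, Module.End.mul_apply, hA _ _ (by omega), map_zero]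
    · simp only [ind] at h1 h2 ha
      have h3 := hat_HG (c := c) (Δ := Δ) (q := q) n ε a
      rw [← sub_eq_iff_eq_add] at h3
      rw [← h3, LinearMap.sub_apply, LinearMap.smul_apply, hA _ _ (by omega),
        Module.End.mul_apply, hA _ _ (by omega), map_zero, smul_zero, sub_zero]
    · simp only [ind] at h1 h2 ha
      rcases eq_or_eq_neg ε δ with rfl | rfl
      · rw [hat_GG, LinearMap.neg_apply, Module.End.mul_apply, hA _ _ (by omega), map_zero,
          neg_zero]
      · rw [hat_GG', if_neg (by omega), zero_smul, add_zero, LinearMap.neg_apply,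
          Module.End.mul_apply, hA _ _ (by omega), map_zero, neg_zero]

/-- Shifting by `j` a function that is 0 far to the left and `g` far to the right leaves `j`
boundary terms equal to `g`. -/
lemma sum_telescope {V : Type} [AddCommGroup V] {f : ℤ → V} {g : V} {A : ℤ}
    (h1 : ∀ a, A ≤ a → f a = g) (h2 : ∀ a, a ≤ -A → f a = 0) {N j : ℕ} (hN : A + j + 1 ≤ N) :
    ∑ i ∈ Finset.range (2 * N), (f ((i : ℤ) - N) - f ((i : ℤ) - N - j)) = j • g := by
  have h : ∀ i : ℕ, f ((i : ℤ) - N) - f ((i : ℤ) - N - j)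
      = (∑ m ∈ Finset.range j, f (((i + 1 : ℕ) : ℤ) - N - 1 - m))
        - ∑ m ∈ Finset.range j, f ((i : ℤ) - N - 1 - m) := by
    intro i
    have := Finset.sum_range_sub' (fun m : ℕ => f ((i : ℤ) - N - m)) j
    simp only [Nat.cast_zero, sub_zero] at this
    rw [← this, ← Finset.sum_sub_distrib]
    refine Finset.sum_congr rfl fun m _ => ?_
    congr 2
    · push_cast; ring
    · push_cast; ring
  rw [Finset.sum_congr rfl fun i _ => h i,
    Finset.sum_range_sub (fun i : ℕ => ∑ m ∈ Finset.range j, f ((i : ℤ) - N - 1 - m))]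
  rw [Finset.sum_congr rfl (g := fun _ => g), Finset.sum_const, Finset.card_range,
    Finset.sum_eq_zero, sub_zero]
  · intro m hm
    rw [Finset.mem_range] at hm
    exact h2 _ (by push_cast; omega)
  · intro m hm
    rw [Finset.mem_range] at hm
    exact h1 _ (by push_cast; omega)

/-- The linear part contributes 2k (c/3) t for k = j. Commuting H_{-j} through the quadratic part
shifts its summands, and the difference telescopes. The summand vanishes for very negative index,
but for k = j it equals 2t for large index after the fermions are anticommuted. This boundary term
-2kt turns c/3 into c/3 - 1. -/
lemma Z_H {k : ℤ} {j : ℕ} {l : List Gen} (hl : ∀ x ∈ l, neg x) :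
    ∀ᶠ N in atTop, Z c Δ q N k (hat c Δ q (.H (-j)) (hword c Δ q l))
      = hat c Δ q (.H (-j)) (Z c Δ q N k (hword c Δ q l))
        + (if k = j then 2 * (k : ℂ) * (c / 3 - 1) else 0) • tt c Δ q (hword c Δ q l) := by
  obtain ⟨A, hA⟩ := exists_G_eq_zero (c := c) (Δ := Δ) (q := q) hl
  obtain ⟨B, hB⟩ : ∃ B : ℕ, |A| + |k| + j + 3 ≤ B :=
    ⟨(|A| + |k| + j + 3).toNat, by omega⟩
  filter_upwards [Filter.eventually_ge_atTop (B + j + 1)] with N hN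
  set u := hword c Δ q l
  set f : ℤ → NSVerma c Δ q := fun a =>
    (hat c Δ q (.G 1 a) * hat c Δ q (.G (-1) (k - j - 2 - a))) u with hf
  have a1 := le_abs_self A
  have a2 := neg_abs_le A
  have a3 := le_abs_self k
  have a4 := neg_abs_le k
  have h1 : ∀ a, (B : ℤ) ≤ a → f a = (if k = j then (2 : ℂ) else 0) • tt c Δ q u := by
    intro a ha
    simp only [hf]
    rw [hat_GG' 1, LinearMap.add_apply, LinearMap.neg_apply, Module.End.mul_apply,
      hA 1 a (by omega), map_zero, neg_zero, zero_add, LinearMap.smul_apply]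
    congr 1
    by_cases h : k = j
    · rw [if_pos h, if_pos (by omega)]
    · rw [if_neg h, if_neg (by omega)]
  have h2 : ∀ a, a ≤ -(B : ℤ) → f a = 0 := by
    intro a ha
    simp only [hf]
    rw [Module.End.mul_apply, hA (-1) _ (by omega), map_zero]
  have h3 := sum_telescope h1 h2 (N := N) (j := j) (by omega)
  have h4 : ∀ a : ℤ, (hat c Δ q (.G 1 a) * hat c Δ q (.G (-1) (k - 2 - a)))
        (hat c Δ q (.H (-j)) u)
      = hat c Δ q (.H (-j)) ((hat c Δ q (.G 1 a) * hat c Δ q (.G (-1) (k - 2 - a))) u)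
        + (f a - f (a - j)) := by
    intro a
    have e1 := hat_HG (c := c) (Δ := Δ) (q := q) (-j) 1 a
    have e2 := hat_HG (c := c) (Δ := Δ) (q := q) (-j) (-1) (k - 2 - a)
    rw [← sub_eq_iff_eq_add] at e1 e2
    have i1 : -(j : ℤ) + a = a - j := by ring
    have i2 : -(j : ℤ) + (k - 2 - a) = k - j - 2 - a := by ring
    have i3 : k - j - 2 - (a - j) = k - 2 - a := by ring
    rw [i1] at e1
    rw [i2] at e2
    have e : hat c Δ q (.G 1 a) * hat c Δ q (.G (-1) (k - 2 - a)) * hat c Δ q (.H (-j))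
        = hat c Δ q (.H (-j)) * (hat c Δ q (.G 1 a) * hat c Δ q (.G (-1) (k - 2 - a)))
          + (hat c Δ q (.G 1 a) * hat c Δ q (.G (-1) (k - j - 2 - a))
            - hat c Δ q (.G 1 (a - j)) * hat c Δ q (.G (-1) (k - 2 - a))) := by
      rw [mul_assoc, ← e2, mul_sub, ← mul_assoc, ← e1, sub_mul, mul_smul_comm, smul_mul_assoc]
      simp only [Units.val_one, Units.val_neg, Int.cast_one, Int.cast_neg, one_smul, neg_smul,
        sub_neg_eq_add, mul_assoc]
      abel
    have := LinearMap.congr_fun e u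
    simp only [hf, i3]
    exact this
  have h5 : (tt c Δ q * hat c Δ q (.H k)) (hat c Δ q (.H (-j)) u)
      = hat c Δ q (.H (-j)) ((tt c Δ q * hat c Δ q (.H k)) u)
        + (if k = j then (k : ℂ) / 3 * c else 0) • tt c Δ q u := by
    have e : tt c Δ q * hat c Δ q (.H k) * hat c Δ q (.H (-j))
        = hat c Δ q (.H (-j)) * (tt c Δ q * hat c Δ q (.H k))
          + (if k = j then (k : ℂ) / 3 * c else 0) • tt c Δ q := by
      rw [mul_assoc, hat_HH, mul_add, ← mul_assoc, tt_comm, mul_assoc, mul_smul_comm, mul_one]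
      congr 2
      by_cases h : k = j
      · rw [if_pos h, if_pos (by omega)]
      · rw [if_neg h, if_neg (by omega)]
    exact LinearMap.congr_fun e u
  simp only [Z, LinearMap.sub_apply, LinearMap.smul_apply, LinearMap.sum_apply]
  rw [h5, Finset.sum_congr rfl fun i _ => h4 _, Finset.sum_add_distrib, h3, map_sub, map_smul,
    map_sum]
  by_cases h : k = j
  · subst h
    simp only [if_true]
    push_cast
    module
  · simp only [h, if_false]
    module

/-- H_{-k} does not commute with fermions, so the counting relies on normal order: the H stand
directly behind the L_{-1}. To the right of them only other L and G occur; `Z` commutes with these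
for large cutoff and kills the vacuum. Hence only the letters L_{-1} and H have to be passed. -/
lemma Z_count {k : ℕ} (hk : 1 ≤ k) {l : List Gen} (hl : IsNormal l) :
    ∀ᶠ N in atTop, (hat c Δ q (.H (-k)) * Z c Δ q N k) (hword c Δ q l)
      = ((2 * (k : ℂ) * (c / 3 - 1)) * (l.count (.H (-k)) : ℂ)) • tt c Δ q (hword c Δ q l) := by
  have hvac : ∀ l : List Gen, (∀ x ∈ l, neg x) → (∀ x ∈ l, ∀ m, x ≠ .H m) →
      ∀ᶠ N in atTop, Z c Δ q N k (hword c Δ q l) = 0 := by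
    intro l hl hl'
    induction l with
    | nil =>
      refine Eventually.of_forall fun N => Z_apply_eq_zero (by omega)
        (hat_vac (by simp only [neg]; omega)) fun ε m hm => hat_vac (by simpa only [neg, not_lt])
    | cons x l ih =>
      have ih' := ih (fun y hy => hl y (List.mem_cons_of_mem x hy))
        fun y hy => hl' y (List.mem_cons_of_mem x hy)
      have key : ∀ᶠ N in atTop, Commute (hat c Δ q x) (Z c Δ q N k) := by
        rcases x with n | n | ⟨ε, n⟩
        · by_cases hn : n = -1
          · subst hn
            exact Eventually.of_forall fun N => commute_tt_Z N k
          · exact Eventually.of_forall fun N => commute_L_Z hn N k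
        · exact absurd rfl (hl' _ List.mem_cons_self n)
        · filter_upwards [eventually_ge_atTop ((|(k : ℤ) + n| + |n + 2| + 1).toNat)] with N hN
          have h1 := abs_nonneg ((k : ℤ) + n)
          have h2 := abs_nonneg (n + 2)
          exact commute_G_Z (by omega) (by omega) ε
      filter_upwards [ih', key] with N h1 h2
      rw [hword_cons, ← Module.End.mul_apply, ← h2.eq, Module.End.mul_apply, h1, map_zero]
  induction l with
  | nil =>
    filter_upwards [hvac [] (by simp) (by simp)] with N hN
    rw [Module.End.mul_apply, hN]
    simp
  | cons x l ih =>
    have hneg := hl.1 x List.mem_cons_self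
    by_cases hx : x = .L (-1) ∨ ∃ j : ℕ, x = .H (-j)
    · refine count_step ?_ (ih hl.tail)
      rcases hx with rfl | ⟨j, rfl⟩
      · refine Eventually.of_forall fun N => ?_
        rw [if_neg (by simp), zero_smul, add_zero]
        have h : Commute (tt c Δ q) (hat c Δ q (.H (-k)) * Z c Δ q N k) :=
          (commute_tt _).mul_right (commute_tt_Z N k)
        exact (LinearMap.congr_fun h.eq (hword c Δ q l)).symm
      · filter_upwards [Z_H (c := c) (Δ := Δ) (q := q) (k := k) (j := j) hl.tail.1] with N hN
        rw [hword_cons, Module.End.mul_apply, hN, map_add, map_smul, Module.End.mul_apply,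
          ← Module.End.mul_apply (hat c Δ q (.H (-k))), hat_HH,
          if_neg (by omega), zero_smul, add_zero, Module.End.mul_apply]
        congr 1
        have e := LinearMap.congr_fun (tt_comm (c := c) (Δ := Δ) (q := q) (.H (-k)))
          (hword c Δ q l)
        simp only [Module.End.mul_apply] at e
        rw [← e]
        by_cases h : k = j
        · subst h
          rw [if_pos rfl, if_pos rfl]
          push_cast
          rfl
        · rw [if_neg (by omega), if_neg (by simp; omega), zero_smul, zero_smul]
    · have hcls : 2 ≤ cls x := by
        rcases x with n | n | ⟨ε, n⟩ <;> simp only [neg] at hneg <;> simp only [cls]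
        · rw [if_neg (by simpa using hx)]; split_ifs <;> omega
        · refine absurd (Or.inr ⟨n.natAbs, ?_⟩) hx
          congr 1; omega
        · split_ifs <;> omega
      have hH : ∀ y ∈ x :: l, ∀ m, y ≠ .H m := by
        rintro y hy m rfl
        have hm : m < 0 := hl.1 _ hy
        have hc : cls (.H m) = 1 := if_pos hm
        rcases List.mem_cons.1 hy with rfl | hy
        · omega
        · have := (List.pairwise_cons.1 hl.2).1 _ hy
          exact this (Or.inl (lt_iff.2 (Or.inl (by omega))))
      filter_upwards [hvac _ hl.1 hH] with N hN
      rw [Module.End.mul_apply, hN, map_zero,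
        List.count_eq_zero.2 fun h => hH _ h _ rfl, Nat.cast_zero, mul_zero, zero_smul]

end H

/-- The words in `L_{-1}` and `G^±_{-1/2}`. -/
def IsKernelWord (l : List Gen) : Prop := ∀ x ∈ l, x = .L (-1) ∨ ∃ ε, x = .G ε (-1)

/-- The vectors killed by the leading parts of the positive operators are combinations of words in
`L_{-1}` and `G^±_{-1/2}`. -/
theorem isKernelWord_of_mem_support (hc : c ≠ 3) {s : NSVerma c Δ q}
    (hL : ∀ k, 1 ≤ k → hat c Δ q (.L k) s = 0) (hH : ∀ k, 1 ≤ k → hat c Δ q (.H k) s = 0)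
    (hG : ∀ ε k, 0 ≤ k → hat c Δ q (.G ε k) s = 0) :
    ∀ w ∈ ((pbw c Δ q).repr s).support, IsKernelWord w.1 := by
  have h1 : ∀ k, 1 ≤ k → ∀ w ∈ ((pbw c Δ q).repr s).support, Gen.L (-k - 1) ∉ w.1 := by
    intro k hk
    refine count_eq_zero (κ := 2 * k + 1) (by exact_mod_cast (by omega : 2 * k + 1 ≠ 0))
      (Eventually.of_forall fun N => ?_) fun w _ => L_count hk w.2.1
    rw [Module.End.mul_apply, hL k hk, map_zero]
  have h2 : ∀ k : ℕ, 1 ≤ k → ∀ w ∈ ((pbw c Δ q).repr s).support, Gen.H (-k) ∉ w.1 := by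
    intro k hk
    refine count_eq_zero (κ := 2 * k * (c / 3 - 1)) ?_
      (Eventually.of_forall fun N => ?_) fun w _ => Z_count hk w.2
    · refine mul_ne_zero (mul_ne_zero two_ne_zero (by exact_mod_cast (by omega : k ≠ 0))) ?_
      intro h
      apply hc
      linear_combination 3 * h
    · rw [Module.End.mul_apply, Z_apply_eq_zero (by omega) (hH k (by omega)) hG, map_zero]
  have h3 : ∀ w ∈ ((pbw c Δ q).repr s).support, ∀ x ∈ w.1, x = .L (-1) ∨ ∃ δ l, x = .G δ l := by
    intro w hw x hx
    have hneg := w.2.1 x hx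
    rcases x with n | n | ⟨ε, n⟩ <;> simp only [neg] at hneg
    · left
      by_contra hn
      have hn' : n ≠ -1 := fun h => hn (by rw [h])
      refine h1 (-n - 1) (by omega) w hw ?_
      have : -(-n - 1) - 1 = n := by ring
      rwa [this]
    · refine absurd ?_ (h2 n.natAbs (by omega) w hw)
      have : -(n.natAbs : ℤ) = n := by omega
      rwa [this]
    · exact Or.inr ⟨ε, n, rfl⟩
  -- The fermions come last because `G_count` needs words already free of H and of all L except
  -- L_{-1}.
  have h4 : ∀ ε : ℤˣ, ∀ k, 1 ≤ k → ∀ w ∈ ((pbw c Δ q).repr s).support,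
      Gen.G (-ε) (-k - 1) ∉ w.1 := by
    intro ε k hk
    refine count_eq_zero (κ := 2) two_ne_zero
      (Eventually.of_forall fun N => ?_) fun w hw => G_count ε hk w.2.1 (h3 w hw)
    rw [Module.End.mul_apply, hG ε (k - 1) (by omega), map_zero]
  intro w hw x hx
  rcases h3 w hw x hx with rfl | ⟨δ, n, rfl⟩
  · exact Or.inl rfl
  · right
    have hneg : n < 0 := w.2.1 _ hx
    refine ⟨δ, ?_⟩
    by_contra hn
    have hn' : n ≠ -1 := fun h => hn (by rw [h])
    refine h4 (-δ) (-n - 1) (by omega) w hw ?_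
    have : -(-n - 1) - 1 = n := by ring
    rwa [this, neg_neg]

end N2

/-! ### Levels, charges and the bounds in the Neveu-Schwarz Verma module. -/

namespace N2

open SuperPBW Gen Filtered

variable {c Δ q : ℂ}

namespace Gen

/-- The level of a letter. -/
def lev : Gen → ℚ
  | L m => -m
  | H m => -m
  | G _ k => -(k + 1 / 2)

/-- The charge of a letter. -/
def chg : Gen → ℤ
  | G ε _ => ε
  | _ => 0

lemma lev_pos {x : Gen} (hx : neg x) : 0 < lev x := by
  rcases x with m | m | ⟨ε, m⟩ <;> simp only [neg, lev] at hx ⊢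
  · have : (m : ℚ) < 0 := Int.cast_lt_zero.2 hx
    linarith
  · have : (m : ℚ) < 0 := Int.cast_lt_zero.2 hx
    linarith
  · have : (m : ℚ) ≤ ((-1 : ℤ) : ℚ) := Int.cast_le.2 (by omega)
    push_cast at this
    linarith

end Gen

lemma X_L_zero (x : Gen) : X c Δ q (.L 0) * X c Δ q x
    = X c Δ q x * X c Δ q (.L 0) + ((lev x : ℚ) : ℂ) • X c Δ q x := by
  rw [X_rel, br_data, sg_data]
  rcases x with m | m | ⟨ε, m⟩ <;>
    simp only [Gen.br, map_add, map_smul, lc_XO, XO_some, odd, sgb, Bool.and_self, Bool.false_and,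
      Bool.false_eq_true, if_false, one_smul, zero_add, lev]
  · push_cast
    simp
  · by_cases h : m = 0
    · simp [h]
    · simp [h]
  · congr 2
    push_cast
    ring

lemma X_H_zero (x : Gen) : X c Δ q (.H 0) * X c Δ q x
    = X c Δ q x * X c Δ q (.H 0) + ((chg x : ℤ) : ℂ) • X c Δ q x := by
  rw [X_rel, br_data, sg_data]
  rcases x with m | m | ⟨ε, m⟩ <;>
    simp only [Gen.br, map_add, map_smul, lc_XO, XO_some, odd, sgb, Bool.and_self, Bool.false_and,
      Bool.false_eq_true, if_false, one_smul, zero_add, chg] <;> simp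

lemma X_diag_word {x : Gen} {f : Gen → ℂ} (hx : ¬ neg x)
    (h : ∀ y, X c Δ q x * X c Δ q y = X c Δ q y * X c Δ q x + f y • X c Δ q y) (l : List Gen) :
    X c Δ q x (word c Δ q l) = (l.map f).sum • word c Δ q l := by
  induction l with
  | nil => rw [List.map_nil, List.sum_nil, zero_smul]; exact X_vac hx
  | cons y l ih =>
    have h1 := LinearMap.congr_fun (h y) (word c Δ q l)
    simp only [Module.End.mul_apply, LinearMap.add_apply, LinearMap.smul_apply] at h1
    change X c Δ q x (X c Δ q y (word c Δ q l)) = _ • X c Δ q y (word c Δ q l)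
    rw [h1, ih, map_smul, ← add_smul, List.map_cons, List.sum_cons, add_comm]

/-- Such an operator is diagonal in the Poincaré-Birkhoff-Witt basis, so an eigenvector involves
only words with its eigenvalue. -/
lemma repr_X_diag {x : Gen} {f : Gen → ℂ} (hx : ¬ neg x)
    (h : ∀ y, X c Δ q x * X c Δ q y = X c Δ q y * X c Δ q x + f y • X c Δ q y)
    {v : NSVerma c Δ q} {r : ℂ} (hv : X c Δ q x v = r • v) {w : NW}
    (hw : (pbw c Δ q).repr v w ≠ 0) : (w.1.map f).sum = r := by
  classical
  have h1 : (Finsupp.lapply w ∘ₗ (pbw c Δ q).repr.toLinearMap) ∘ₗ X c Δ q x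
      = (w.1.map f).sum • (Finsupp.lapply w ∘ₗ (pbw c Δ q).repr.toLinearMap) := by
    refine (pbw c Δ q).ext fun u => ?_
    simp only [LinearMap.comp_apply, LinearMap.smul_apply, pbw_apply, X_diag_word hx h, map_smul]
    by_cases hu : u = w
    · rw [hu]
    · rw [← pbw_apply]
      simp [hu]
  have h2 := LinearMap.congr_fun h1 v
  simp only [LinearMap.comp_apply, LinearMap.smul_apply, hv, map_smul, Finsupp.lapply_apply,
    LinearEquiv.coe_coe, smul_eq_mul] at h2
  exact (mul_right_cancel₀ hw h2).symm

lemma repr_level {v : NSVerma c Δ q} {m : ℚ} (hv : X c Δ q (.L 0) v = (m : ℂ) • v) {w : NW}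
    (hw : (pbw c Δ q).repr v w ≠ 0) : (w.1.map lev).sum = m := by
  have h := repr_X_diag (f := fun y => ((lev y : ℚ) : ℂ)) (by simp [neg]) X_L_zero hv hw
  have h1 : (((w.1.map lev).sum : ℚ) : ℂ) = m := by
    rw [← h, Rat.cast_list_sum, List.map_map]
    rfl
  exact_mod_cast h1

lemma repr_charge {v : NSVerma c Δ q} {n : ℤ} (hv : X c Δ q (.H 0) v = (n : ℂ) • v) {w : NW}
    (hw : (pbw c Δ q).repr v w ≠ 0) : (w.1.map chg).sum = n := by
  have h := repr_X_diag (f := fun y => ((chg y : ℤ) : ℂ)) (by simp [neg]) X_H_zero hv hw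
  have h1 : (((w.1.map chg).sum : ℤ) : ℂ) = n := by
    rw [← h, Int.cast_list_sum, List.map_map]
    rfl
  exact_mod_cast h1

variable (c Δ q) in
/-- The space of vectors of level `m` and charge `n` annihilated by the positive operators. -/
noncomputable def singSpace (m : ℚ) (n : ℤ) : Submodule ℂ (NSVerma c Δ q) where
  carrier := {v | X c Δ q (.L 0) v = (m : ℂ) • v ∧ X c Δ q (.H 0) v = (n : ℂ) • v ∧
    (∀ k, 1 ≤ k → X c Δ q (.L k) v = 0) ∧ (∀ k, 1 ≤ k → X c Δ q (.H k) v = 0) ∧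
    ∀ ε k, 0 ≤ k → X c Δ q (.G ε k) v = 0}
  zero_mem' := by simp
  add_mem' {a b} ha hb := by
    obtain ⟨a1, a2, a3, a4, a5⟩ := ha
    obtain ⟨b1, b2, b3, b4, b5⟩ := hb
    refine ⟨?_, ?_, fun k hk => ?_, fun k hk => ?_, fun ε k hk => ?_⟩
    · rw [map_add, a1, b1, smul_add]
    · rw [map_add, a2, b2, smul_add]
    · rw [map_add, a3 k hk, b3 k hk, add_zero]
    · rw [map_add, a4 k hk, b4 k hk, add_zero]
    · rw [map_add, a5 ε k hk, b5 ε k hk, add_zero]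
  smul_mem' r a ha := by
    obtain ⟨a1, a2, a3, a4, a5⟩ := ha
    refine ⟨?_, ?_, fun k hk => ?_, fun k hk => ?_, fun ε k hk => ?_⟩
    · rw [map_smul, a1, smul_comm]
    · rw [map_smul, a2, smul_comm]
    · rw [map_smul, a3 k hk, smul_zero]
    · rw [map_smul, a4 k hk, smul_zero]
    · rw [map_smul, a5 ε k hk, smul_zero]

lemma NSSing_subset (m : ℚ) (n : ℤ) : NSSing c Δ q m n ⊆ singSpace c Δ q m n := by
  rintro v ⟨h1, h2, h3, -⟩
  refine ⟨?_, ?_, fun k hk => ?_, fun k hk => ?_, fun ε k hk => ?_⟩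
  · simp only [X, if_true, LinearMap.sub_apply, LinearMap.smul_apply, Module.End.one_apply,
      act_apply, h1]
    module
  · simp only [X, if_true, LinearMap.sub_apply, LinearMap.smul_apply, Module.End.one_apply,
      act_apply, h2]
    module
  · have hk0 : k ≠ 0 := by omega
    simp only [X, hk0, if_false, zero_smul, sub_zero, act_apply]
    exact h3 _ (Or.inl ⟨k, by omega, Or.inl rfl⟩)
  · have hk0 : k ≠ 0 := by omega
    simp only [X, hk0, if_false, zero_smul, sub_zero, act_apply]
    exact h3 _ (Or.inl ⟨k, by omega, Or.inr rfl⟩)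
  · exact h3 _ (Or.inr ⟨ε, k, hk, rfl⟩)

/-- The words in `L_{-1}` and `G^±_{-1/2}` in normal form. -/
def kword (j : ℕ) (a b : Bool) : List Gen :=
  List.replicate j (.L (-1)) ++ ((if a then [.G 1 (-1)] else []) ++ if b then [.G (-1) (-1)] else [])

lemma kword_succ (j : ℕ) (a b : Bool) : kword (j + 1) a b = .L (-1) :: kword j a b := by
  simp [kword, List.replicate_succ]

lemma G_lt_G : (Gen.G 1 (-1)) < .G (-1) (-1) := by
  rw [lt_iff]
  simp [cls, idx]

lemma isNormal_kword (j : ℕ) (a b : Bool) : IsNormal (kword j a b) := by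
  induction j with
  | zero =>
    have h := G_lt_G.le
    cases a <;> cases b <;> simp [kword, IsNormal, neg, h]
  | succ j ih => rw [kword_succ]; exact isNormal_tt_cons ih

lemma exists_kword {l : List Gen} (h : IsNormal l) (hk : IsKernelWord l) :
    ∃ j a b, l = kword j a b := by
  induction l with
  | nil => exact ⟨0, false, false, by simp [kword]⟩
  | cons x l ih =>
    obtain ⟨j, a, b, rfl⟩ := ih h.tail fun y hy => hk y (List.mem_cons_of_mem x hy)
    have hp := (List.pairwise_cons.1 h.2).1
    rcases hk x List.mem_cons_self with rfl | ⟨ε, rfl⟩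
    · exact ⟨j + 1, a, b, (kword_succ j a b).symm⟩
    · cases j with
      | succ j =>
        refine absurd (Or.inl ?_) (hp (.L (-1)) (by simp [kword_succ]))
        rw [lt_iff]
        simp [cls]
      | zero =>
        have ha : a = false := by
          by_contra ha
          refine hp (.G 1 (-1)) (by simp [kword, ha]) ?_
          rcases Int.units_eq_one_or ε with rfl | rfl
          · exact Or.inr ⟨rfl, rfl⟩
          · exact Or.inl G_lt_G
        subst ha
        rcases Int.units_eq_one_or ε with rfl | rfl
        · exact ⟨0, true, b, by simp [kword]⟩
        · have hb : b = false := by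
            by_contra hb
            exact hp (.G (-1) (-1)) (by simp [kword, hb]) (Or.inr ⟨rfl, rfl⟩)
          subst hb
          exact ⟨0, false, true, by simp [kword]⟩

/-- The word `kword j a b` as an index of the basis. -/
def kw (j : ℕ) (a b : Bool) : NW := ⟨kword j a b, isNormal_kword j a b⟩

lemma level_kword (j : ℕ) (a b : Bool) : ((kword j a b).map lev).sum
    = j + ((if a then 1 / 2 else 0) + if b then 1 / 2 else 0) := by
  cases a <;> cases b <;> simp [kword, lev] <;> norm_num

lemma charge_kword (j : ℕ) (a b : Bool) : ((kword j a b).map chg).sum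
    = (if a then 1 else 0) - if b then 1 else 0 := by
  cases a <;> cases b <;> simp [kword, chg]

/-- The leading component of a singular vector is a combination of words in `L_{-1}` and
`G^±_{-1/2}`. -/
lemma exists_symbol (hc : c ≠ 3) {m : ℚ} {n : ℤ} {v : NSVerma c Δ q}
    (hv : v ∈ singSpace c Δ q m n) (h0 : v ≠ 0) :
    ∃ s : NSVerma c Δ q, s ≠ 0 ∧ (∀ x, X c Δ q x v = 0 → hat c Δ q x s = 0) ∧
      ∀ w, (pbw c Δ q).repr s w ≠ 0 → (pbw c Δ q).repr v w ≠ 0 ∧ ∃ j a b, w = kw j a b ∧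
        m = j + ((if a then 1 / 2 else 0) + if b then 1 / 2 else 0) ∧
        n = (if a then 1 else 0) - if b then 1 else 0 := by
  obtain ⟨d, h1, h2⟩ := exists_leading (B := pbw c Δ q) (ω := NW.weight) h0
  obtain ⟨a1, a2, a3, a4, a5⟩ := hv
  have hx : ∀ x, X c Δ q x v = 0 → hat c Δ q x (comp (pbw c Δ q) NW.weight d v) = 0 :=
    fun x hx => top_apply_eq_zero (fil_X x) h1 hx
  refine ⟨_, h2, hx, fun w hw => ?_⟩
  have hvw : (pbw c Δ q).repr v w ≠ 0 := by
    intro h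
    rw [repr_comp, h, ite_self] at hw
    exact hw rfl
  refine ⟨hvw, ?_⟩
  obtain ⟨j, a, b, hl⟩ := exists_kword w.2 (isKernelWord_of_mem_support hc (fun k hk => hx _ (a3 k hk))
    (fun k hk => hx _ (a4 k hk)) (fun ε k hk => hx _ (a5 ε k hk)) w (Finsupp.mem_support_iff.2 hw))
  refine ⟨j, a, b, Subtype.ext hl, ?_, ?_⟩
  · rw [← level_kword, ← hl, repr_level a1 hvw]
  · rw [← charge_kword, ← hl, repr_charge a2 hvw]

/-- The coordinates of the leading component are coordinates of `v`. So the coordinates at the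
admissible words in L_{-1} and G^±_{-1/2} already determine a singular vector. -/
lemma exists_coord_ne_zero (hc : c ≠ 3) {m : ℚ} {n : ℤ} {v : NSVerma c Δ q}
    (hv : v ∈ singSpace c Δ q m n) (h0 : v ≠ 0) :
    ∃ j a b, (pbw c Δ q).repr v (kw j a b) ≠ 0 ∧
      m = j + ((if a then 1 / 2 else 0) + if b then 1 / 2 else 0) ∧
      n = (if a then 1 else 0) - if b then 1 else 0 := by
  obtain ⟨s, hs, -, h⟩ := exists_symbol hc hv h0
  obtain ⟨w, hw⟩ : ∃ w, (pbw c Δ q).repr s w ≠ 0 := by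
    by_contra! h'
    exact hs ((pbw c Δ q).ext_elem fun w => by rw [h' w, map_zero, Finsupp.zero_apply])
  obtain ⟨h1, j, a, b, rfl, h2, h3⟩ := h w hw
  exact ⟨j, a, b, h1, h2, h3⟩

lemma eq_smul_of_support {s : NSVerma c Δ q} {w : NW}
    (h : ∀ u, (pbw c Δ q).repr s u ≠ 0 → u = w) :
    s = (pbw c Δ q).repr s w • pbw c Δ q w := by
  refine (pbw c Δ q).ext_elem fun u => ?_
  rw [map_smul, Module.Basis.repr_self, Finsupp.smul_apply]
  by_cases hu : u = w
  · subst hu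
    rw [Finsupp.single_eq_same, smul_eq_mul, mul_one]
  · rw [Finsupp.single_eq_of_ne hu, smul_zero]
    by_contra h'
    exact hu (h u h')

lemma hat_replicate_ne_zero {x : Gen} {l : List Gen} (h : hat c Δ q x (hword c Δ q l) ≠ 0)
    (j : ℕ) : hat c Δ q x (hword c Δ q (List.replicate j (.L (-1)) ++ l)) ≠ 0 := by
  induction j with
  | zero => simpa using h
  | succ j ih =>
    rw [List.replicate_succ, List.cons_append, hword_cons, ← Module.End.mul_apply]
    have := tt_comm (c := c) (Δ := Δ) (q := q) x
    rw [tt] at this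
    rw [← this, Module.End.mul_apply]
    intro h'
    exact ih (tt_injective (h'.trans (map_zero _).symm))

lemma hword_kw (j : ℕ) (a b : Bool) :
    hword c Δ q (kword j a b) = pbw c Δ q (kw j a b) := vec_hat (kw j a b)

/-- Singular vectors annihilated by `G^ε_{-1/2}` have a nonzero coordinate at one of the two words
of the appropriate level that are compatible with this. -/
lemma exists_coord_ne_zero_of_chiral (hc : c ≠ 3) {m : ℚ} {n : ℤ} (ε : ℤˣ) {v : NSVerma c Δ q}
    (hv : v ∈ singSpace c Δ q m n) (hε : X c Δ q (.G ε (-1)) v = 0) (h0 : v ≠ 0) :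
    ∃ j : ℕ, (n = 0 ∧ m = j + 1 ∧ (pbw c Δ q).repr v (kw j true true) ≠ 0) ∨
      (n = ε ∧ m = j + 1 / 2 ∧ (pbw c Δ q).repr v (kw j (ε = 1) (ε = -1)) ≠ 0) := by
  obtain ⟨s, hs, hx, h⟩ := exists_symbol hc hv h0
  have hθ := hx _ hε
  have hne : (pbw c Δ q) (kw 0 true true) ≠ 0 := (pbw c Δ q).ne_zero _
  -- `s` cannot be a multiple of a single word on which the leading part of G^ε_{-1/2} is nonzero;
  -- the powers of the central injective `tt` may be ignored in testing this.
  have key : ∀ j a b, hat c Δ q (.G ε (-1)) (hword c Δ q (kword 0 a b)) ≠ 0 →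
      (∀ u, (pbw c Δ q).repr s u ≠ 0 → u = kw j a b) → False := by
    intro j a b h1 h2
    have h3 := eq_smul_of_support h2
    have h4 : (pbw c Δ q).repr s (kw j a b) ≠ 0 := by
      intro h4
      rw [h4, zero_smul] at h3
      exact hs h3
    rw [h3, map_smul, ← hword_kw] at hθ
    exact hat_replicate_ne_zero h1 j ((smul_eq_zero.1 hθ).resolve_left h4)
  have hvac : hat c Δ q (.G ε (-1)) (hword c Δ q (kword 0 false false)) ≠ 0 := by
    rcases Int.units_eq_one_or ε with rfl | rfl
    · have h1 : hat c Δ q (.G 1 (-1)) (hword c Δ q (kword 0 false false))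
          = hword c Δ q (kword 0 true false) := rfl
      rw [h1, hword_kw]
      exact (pbw c Δ q).ne_zero _
    · have h1 : hat c Δ q (.G (-1) (-1)) (hword c Δ q (kword 0 false false))
          = hword c Δ q (kword 0 false true) := rfl
      rw [h1, hword_kw]
      exact (pbw c Δ q).ne_zero _
  have hθθ : hat c Δ q (.G 1 (-1)) (hword c Δ q (kword 0 false true))
      = pbw c Δ q (kw 0 true true) := hword_kw 0 true true
  -- G^- G^+ applied to the highest weight vector is 2t minus G^+ G^-, whose coordinate at L_{-1} is
  -- 2.
  have hθt : hat c Δ q (.G (-1) (-1)) (hword c Δ q (kword 0 true false)) ≠ 0 := by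
    intro h1
    have h2 := LinearMap.congr_fun (hat_GG' (c := c) (Δ := Δ) (q := q) (-1) (-1) (-1))
      (nsHW c Δ q)
    have h3 : hword c Δ q (kword 0 true false) = hat c Δ q (.G 1 (-1)) (nsHW c Δ q) := rfl
    have h4 : hword c Δ q (kword 0 false true) = hat c Δ q (.G (-1) (-1)) (nsHW c Δ q) := rfl
    have h5 : tt c Δ q (nsHW c Δ q) = pbw c Δ q (kw 1 false false) := hword_kw 1 false false
    simp only [neg_neg, Int.reduceNeg, Int.reduceAdd, if_true, LinearMap.add_apply,
      LinearMap.neg_apply, LinearMap.smul_apply, Module.End.mul_apply, h5] at h2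
    rw [← h3, h1, ← h4, hθθ] at h2
    have h6 := congrArg (fun v => (pbw c Δ q).repr v (kw 1 false false)) h2
    have h7 : kw 1 false false ≠ kw 0 true true := by
      intro h8
      have := congrArg Subtype.val h8
      simp [kw, kword] at this
    simp [Finsupp.single_eq_of_ne h7] at h6
  by_contra! hcon
  obtain ⟨w, hw⟩ : ∃ w, (pbw c Δ q).repr s w ≠ 0 := by
    by_contra! h'
    exact hs ((pbw c Δ q).ext_elem fun w => by rw [h' w, map_zero, Finsupp.zero_apply])
  obtain ⟨h1, j, a, b, rfl, h2, h3⟩ := h w hw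
  -- Two different words of equal level and charge occur only for charge 0, and then one of them
  -- contains both fermions, which `hcon` forbids. So `s` is a multiple of one word.
  have huniq : ∀ j' a' b', (pbw c Δ q).repr v (kw j' a' b') ≠ 0 →
      m = j' + ((if a' then 1 / 2 else 0) + if b' then 1 / 2 else 0) →
      n = (if a' then 1 else 0) - (if b' then 1 else 0) → a' = a ∧ b' = b := by
    intro j' a' b' h4 h5 h6
    cases a <;> cases b <;> cases a' <;> cases b' <;> simp at h3 h6 h2 h5 ⊢ <;> try omega
    · exact h4 ((hcon j').1 h6 (by rw [h5]; norm_num))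
    · exact h1 ((hcon j).1 h3 (by rw [h2]; norm_num))
  have hsupp : ∀ u, (pbw c Δ q).repr s u ≠ 0 → u = kw j a b := by
    intro u hu
    obtain ⟨h4, j', a', b', rfl, h5, h6⟩ := h u hu
    obtain ⟨rfl, rfl⟩ := huniq j' a' b' h4 h5 h6
    have : (j : ℚ) = j' := by linarith
    rw [Nat.cast_injective this]
  refine key j a b ?_ hsupp
  cases a <;> cases b
  · exact hvac
  · rcases Int.units_eq_one_or ε with rfl | rfl
    · rw [hθθ]; exact hne
    · refine absurd h1 (not_not.2 ((hcon j).2 ?_ ?_))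
      · simpa using h3
      · simpa using h2
  · rcases Int.units_eq_one_or ε with rfl | rfl
    · refine absurd h1 (not_not.2 ((hcon j).2 ?_ ?_))
      · simpa using h3
      · simpa using h2
    · exact hθt
  · exact absurd h1 (not_not.2 ((hcon j).1 (by simpa using h3) (by rw [h2]; norm_num)))

section bounds

lemma indepNumber_le {V : Type} [AddCommGroup V] [Module ℂ V] {S : Set V} (P : Submodule ℂ V)
    (hS : S ⊆ P) {d : ℕ} (f : V →ₗ[ℂ] (Fin d → ℂ)) (hf : ∀ v ∈ P, f v = 0 → v = 0) :
    indepNumber S ≤ d := by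
  have hle : Submodule.span ℂ S ≤ P := Submodule.span_le.2 hS
  have hinj : Function.Injective (f.domRestrict (Submodule.span ℂ S)) := by
    rw [injective_iff_map_eq_zero]
    rintro ⟨v, hv⟩ h
    exact Subtype.ext (hf v (hle hv) h)
  have := LinearMap.rank_le_of_injective _ hinj
  rwa [rank_fun', Fintype.card_fin] at this

lemma indepNumber_eq_zero {V : Type} [AddCommGroup V] [Module ℂ V] {S : Set V} (P : Submodule ℂ V)
    (hS : S ⊆ P) (hP : ∀ v ∈ P, v = 0) : indepNumber S ≤ (0 : ℕ) :=
  indepNumber_le P hS 0 fun v hv _ => hP v hv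

variable (c Δ q) in
/-- A coordinate with respect to the Poincaré-Birkhoff-Witt basis. -/
noncomputable def coord (w : NW) : NSVerma c Δ q →ₗ[ℂ] ℂ := (pbw c Δ q).coord w

theorem indepNumber_NSSing_le (hc : c ≠ 3) (m : ℚ) (n : ℤ) : indepNumber (NSSing c Δ q m n) ≤
    ((if n = 0 then 2 else if n = 1 ∨ n = -1 then 1 else 0 : ℕ) : Cardinal) := by
  split_ifs with h0 h1
  · refine indepNumber_le _ (NSSing_subset m n)
      -- The truncated subtraction is harmless: the word with both fermions is relevant only when m
      -- = j + 1.
      (LinearMap.pi ![coord c Δ q (kw ⌊m⌋₊ false false), coord c Δ q (kw (⌊m⌋₊ - 1) true true)])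
      fun v hv hf => ?_
    by_contra hne
    obtain ⟨j, a, b, h2, h3, h4⟩ := exists_coord_ne_zero hc hv hne
    have f0 := congrFun hf 0
    have f1 := congrFun hf 1
    rw [h0] at h4
    cases a <;> cases b <;> simp at h3 h4
    · have : ⌊m⌋₊ = j := by rw [h3, Nat.floor_natCast]
      simp [coord, this] at f0
      exact h2 f0
    · have hm : m = ((j + 1 : ℕ) : ℚ) := by rw [h3]; push_cast; norm_num
      have : ⌊m⌋₊ - 1 = j := by rw [hm, Nat.floor_natCast]; rfl
      simp [coord, this] at f1
      exact h2 f1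
  · refine indepNumber_le _ (NSSing_subset m n)
      (LinearMap.pi ![coord c Δ q (kw ⌊m⌋₊ (n = 1) (n = -1))]) fun v hv hf => ?_
    by_contra hne
    obtain ⟨j, a, b, h2, h3, h4⟩ := exists_coord_ne_zero hc hv hne
    have f0 := congrFun hf 0
    cases a <;> cases b <;> simp at h3 h4
    · omega
    · have : ⌊m⌋₊ = j := by
        -- The level is j + 1/2, a single fermion contributing 1/2.
        rw [h3, Nat.floor_eq_iff (by positivity)]
        constructor <;> norm_num
      simp [coord, this, h4] at f0
      exact h2 f0
    · have : ⌊m⌋₊ = j := by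
        rw [h3, Nat.floor_eq_iff (by positivity)]
        constructor <;> norm_num
      simp [coord, this, h4] at f0
      exact h2 f0
    · omega
  · refine indepNumber_eq_zero _ (NSSing_subset m n) fun v hv => ?_
    by_contra hne
    obtain ⟨j, a, b, h2, h3, h4⟩ := exists_coord_ne_zero hc hv hne
    cases a <;> cases b <;> simp at h4 <;> omega

variable (c Δ q) in
/-- The subspace of `singSpace` annihilated by `G^ε_{-1/2}`. -/
noncomputable def chirSpace (ε : ℤˣ) (m : ℚ) (n : ℤ) : Submodule ℂ (NSVerma c Δ q) :=
  singSpace c Δ q m n ⊓ LinearMap.ker (X c Δ q (.G ε (-1)))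

lemma NSSingChir_subset (ε : ℤˣ) (m : ℚ) (n : ℤ) :
    NSSingChir ε c Δ q m n ⊆ chirSpace c Δ q ε m n :=
  fun _ hv => ⟨NSSing_subset m n hv.1, hv.2⟩

lemma ne_zero_of_mem_NSSing {m : ℚ} {n : ℤ} {v : NSVerma c Δ q} (hv : v ∈ NSSing c Δ q m n) :
    v ≠ 0 := fun h => hv.2.2.2 (h ▸ Submodule.zero_mem _)

/-- One coordinate suffices: in charge 0 the word with both fermions alone decides, and in charge ε
there is just one word. -/
theorem indepNumber_NSSingChir_le (hc : c ≠ 3) (ε : ℤˣ) (m : ℚ) (n : ℤ) :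
    indepNumber (NSSingChir ε c Δ q m n) ≤
      ((if n = 0 ∨ n = ε then 1 else 0 : ℕ) : Cardinal) := by
  split_ifs with h
  · refine indepNumber_le _ (NSSingChir_subset ε m n) (LinearMap.pi ![coord c Δ q
      (if n = 0 then kw (⌊m⌋₊ - 1) true true else kw ⌊m⌋₊ (ε = 1) (ε = -1))]) fun v hv hf => ?_
    by_contra hne
    have f0 := congrFun hf 0
    obtain ⟨j, ⟨h1, h2, h3⟩ | ⟨h1, h2, h3⟩⟩ := exists_coord_ne_zero_of_chiral hc ε hv.1 hv.2 hne
    · have hm : m = ((j + 1 : ℕ) : ℚ) := by rw [h2]; push_cast; rfl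
      have : ⌊m⌋₊ - 1 = j := by rw [hm, Nat.floor_natCast]; rfl
      simp [coord, this, h1] at f0
      exact h3 f0
    · have : ⌊m⌋₊ = j := by
        rw [h2, Nat.floor_eq_iff (by positivity)]
        constructor <;> norm_num
      have hn : n ≠ 0 := by rw [h1]; exact ε.ne_zero
      simp [coord, this, hn] at f0
      exact h3 f0
  · refine indepNumber_eq_zero _ (NSSingChir_subset ε m n) fun v hv => ?_
    by_contra hne
    obtain ⟨j, ⟨h1, -⟩ | ⟨h1, -⟩⟩ := exists_coord_ne_zero_of_chiral hc ε hv.1 hv.2 hne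
    · exact h (Or.inl h1)
    · exact h (Or.inr h1)

theorem charge_of_NSSingChir_nonempty (hc : c ≠ 3) {ε : ℤˣ} {m : ℚ} {n : ℤ}
    (h : (NSSingChir ε c Δ q m n).Nonempty) : n = 0 ∨ n = ε := by
  obtain ⟨v, hv⟩ := h
  have hv' := NSSingChir_subset ε m n hv
  obtain ⟨j, ⟨h1, -⟩ | ⟨h1, -⟩⟩ := exists_coord_ne_zero_of_chiral hc ε hv'.1 hv'.2
    (ne_zero_of_mem_NSSing hv.1)
  · exact Or.inl h1
  · exact Or.inr h1

theorem level_of_NSSing_nonempty (hc : c ≠ 3) {m : ℚ} {n : ℤ}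
    (h : (NSSing c Δ q m n).Nonempty) : (n = 0 ∧ ∃ k : ℕ, 0 < k ∧ m = k) ∨
      ((n = 1 ∨ n = -1) ∧ ∃ k : ℕ, 0 < k ∧ m = k - 1 / 2) := by
  obtain ⟨v, hv⟩ := h
  have hv' := NSSing_subset m n hv
  -- Negative letters have positive level, so at level 0 only the empty word remains, and multiples
  -- of the highest weight vector are not singular.
  have hpos : m ≠ 0 := by
    rintro rfl
    have hsupp : ∀ u, (pbw c Δ q).repr v u ≠ 0 → u = ⟨[], isNormal_nil⟩ := by
      intro u hu
      have h1 := repr_level hv'.1 hu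
      obtain ⟨l, hl⟩ := u
      cases l with
      | nil => rfl
      | cons x l =>
        simp only [List.map_cons, List.sum_cons] at h1
        have h2 := lev_pos (hl.1 x List.mem_cons_self)
        have h3 : 0 ≤ (l.map lev).sum := by
          refine List.sum_nonneg fun y hy => ?_
          obtain ⟨z, hz, rfl⟩ := List.mem_map.1 hy
          exact (lev_pos (hl.1 z (List.mem_cons_of_mem x hz))).le
        linarith
    have h1 := eq_smul_of_support hsupp
    rw [pbw_apply] at h1
    refine hv.2.2.2 ?_
    rw [h1]
    exact Submodule.smul_mem _ _ (Submodule.mem_span_singleton_self _)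
  obtain ⟨j, a, b, -, h1, h2⟩ := exists_coord_ne_zero hc hv' (ne_zero_of_mem_NSSing hv)
  cases a <;> cases b <;> simp at h1 h2
  · exact Or.inl ⟨h2, j, Nat.pos_of_ne_zero fun h => hpos (by rw [h1, h, Nat.cast_zero]), h1⟩
  · exact Or.inr ⟨Or.inr h2, j + 1, j.succ_pos, by rw [h1]; push_cast; ring⟩
  · exact Or.inr ⟨Or.inl h2, j + 1, j.succ_pos, by rw [h1]; push_cast; ring⟩
  · exact Or.inl ⟨h2, j + 1, j.succ_pos, by rw [h1]; push_cast; norm_num⟩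

end bounds

/-- The conformal weights of chiral and antichiral singular vectors. -/
theorem weight_of_NSSingChir_nonempty {ε : ℤˣ} {m : ℚ} {n : ℤ}
    (h : (NSSingChir ε c Δ q m n).Nonempty) : Δ + (m : ℂ) = ((ε : ℤ) : ℂ) * ((q + n) / 2) := by
  obtain ⟨v, hv⟩ := h
  -- The anticommutator {G^ε_{-1/2}, G^{-ε}_{1/2}} is 2 L_0 - ε H_0 without central term, and both
  -- factors kill `v`.
  have h1 := congrArg (fun a : NSAlg => a • v) (ns_GG' ε (-1) 0)
  have h2 : ns (.G (-ε) 0) • v = 0 := hv.1.2.2.1 _ (Or.inr ⟨-ε, 0, le_rfl, rfl⟩)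
  simp only [add_smul, mul_smul, h2, hv.2, smul_zero, add_zero, Int.reduceNeg, Int.reduceAdd,
    smul_assoc, hv.1.1, hv.1.2.1, if_true] at h1
  have h3 : (2 * (Δ + (m : ℂ)) - ((ε : ℤ) : ℂ) * (q + n)) • v = 0 := by
    push_cast at h1
    norm_num at h1
    linear_combination (norm := module) -h1
  have h4 := (smul_eq_zero.1 h3).resolve_right (ne_zero_of_mem_NSSing hv.1)
  linear_combination h4 / 2

end N2

/-! ### The topological twist and the transport of singular vectors. -/

namespace N2

open SuperPBW Gen

section topological_relations

lemma tp_LL (m n : ℤ) : tp (.L m) * tp (.L n) - tp (.L n) * tp (.L m)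
    = ((m : ℂ) - n) • tp (.L (m + n)) := by
  have h := RingQuot.mkAlgHom_rel ℂ (TopRel.LL m n)
  simp only [map_sub, map_mul, map_smul] at h
  exact h

lemma tp_HH (m n : ℤ) : tp (.H m) * tp (.H n) - tp (.H n) * tp (.H m)
    = (if m + n = 0 then (m : ℂ) / 3 else 0) • tp .C := by
  have h := RingQuot.mkAlgHom_rel ℂ (TopRel.HH m n)
  simp only [map_sub, map_mul, map_smul] at h
  exact h

lemma tp_LG (m n : ℤ) : tp (.L m) * tp (.G n) - tp (.G n) * tp (.L m)
    = ((m : ℂ) - n) • tp (.G (m + n)) := by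
  have h := RingQuot.mkAlgHom_rel ℂ (TopRel.LG m n)
  simp only [map_sub, map_mul, map_smul] at h
  exact h

lemma tp_HG (m n : ℤ) : tp (.H m) * tp (.G n) - tp (.G n) * tp (.H m) = tp (.G (m + n)) := by
  have h := RingQuot.mkAlgHom_rel ℂ (TopRel.HG m n)
  simp only [map_sub, map_mul] at h
  exact h

lemma tp_LQ (m n : ℤ) : tp (.L m) * tp (.Q n) - tp (.Q n) * tp (.L m)
    = (-(n : ℂ)) • tp (.Q (m + n)) := by
  have h := RingQuot.mkAlgHom_rel ℂ (TopRel.LQ m n)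
  simp only [map_sub, map_mul, map_smul] at h
  exact h

lemma tp_HQ (m n : ℤ) : tp (.H m) * tp (.Q n) - tp (.Q n) * tp (.H m) = -tp (.Q (m + n)) := by
  have h := RingQuot.mkAlgHom_rel ℂ (TopRel.HQ m n)
  simp only [map_sub, map_mul, map_neg] at h
  exact h

lemma tp_LH (m n : ℤ) : tp (.L m) * tp (.H n) - tp (.H n) * tp (.L m)
    = (-(n : ℂ)) • tp (.H (m + n))
      + (if m + n = 0 then ((m : ℂ) ^ 2 + m) / 6 else 0) • tp .C := by
  have h := RingQuot.mkAlgHom_rel ℂ (TopRel.LH m n)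
  simp only [map_sub, map_mul, map_add, map_smul] at h
  exact h

lemma tp_GQ (m n : ℤ) : tp (.G m) * tp (.Q n) + tp (.Q n) * tp (.G m)
    = (2 : ℂ) • tp (.L (m + n)) - (2 * (n : ℂ)) • tp (.H (m + n))
      + (if m + n = 0 then ((m : ℂ) ^ 2 + m) / 3 else 0) • tp .C := by
  have h := RingQuot.mkAlgHom_rel ℂ (TopRel.GQ m n)
  simp only [map_sub, map_mul, map_add, map_smul] at h
  exact h

lemma tp_GG (m n : ℤ) : tp (.G m) * tp (.G n) + tp (.G n) * tp (.G m) = 0 := by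
  have h := RingQuot.mkAlgHom_rel ℂ (TopRel.GG m n)
  simp only [map_add, map_mul, map_zero] at h
  exact h

lemma tp_QQ (m n : ℤ) : tp (.Q m) * tp (.Q n) + tp (.Q n) * tp (.Q m) = 0 := by
  have h := RingQuot.mkAlgHom_rel ℂ (TopRel.QQ m n)
  simp only [map_add, map_mul, map_zero] at h
  exact h

lemma tp_central (x : TopGen) : tp .C * tp x = tp x * tp .C := by
  have h := RingQuot.mkAlgHom_rel ℂ (TopRel.central x)
  simp only [map_mul] at h
  exact h

end topological_relations

/-- An induction principle for the topological enveloping algebra. -/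
lemma TopAlg.induction {P : TopAlg → Prop} (hs : ∀ r : ℂ, P (algebraMap ℂ TopAlg r))
    (hx : ∀ x, P (tp x)) (hmul : ∀ a b, P a → P b → P (a * b))
    (hadd : ∀ a b, P a → P b → P (a + b)) (a : TopAlg) : P a := by
  obtain ⟨b, rfl⟩ := RingQuot.mkAlgHom_surjective ℂ TopRel a
  induction b using FreeAlgebra.induction with
  | grade0 r => exact (AlgHom.commutes (RingQuot.mkAlgHom ℂ TopRel) r).symm ▸ hs r
  | grade1 x => exact hx x
  | mul a b ha hb => exact (map_mul (RingQuot.mkAlgHom ℂ TopRel) a b).symm ▸ hmul _ _ ha hb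
  | add a b ha hb => exact (map_add (RingQuot.mkAlgHom ℂ TopRel) a b).symm ▸ hadd _ _ ha hb

lemma sign_mul_self (ε : ℤˣ) : ((ε : ℤ) : ℂ) * ((ε : ℤ) : ℂ) = 1 := by
  rcases Int.units_eq_one_or ε with rfl | rfl <;> simp

/-- The images of the generators under the topological twist. -/
noncomputable def twGen (ε : ℤˣ) : TopGen → NSAlg
  | .L m => ns (.L m) + (((ε : ℤ) : ℂ) * ((m : ℂ) + 1) / 2) • ns (.H m)
  | .H m => ((ε : ℤ) : ℂ) • ns (.H m)
  | .G m => ns (.G ε m)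
  | .Q m => ns (.G (-ε) (m - 1))
  | .C => ns .C

/-- The images of the generators under the inverse of the topological twist. -/
noncomputable def untwGen (ε : ℤˣ) : NSGen → TopAlg
  | .L m => tp (.L m) - (((m : ℂ) + 1) / 2) • tp (.H m)
  | .H m => ((ε : ℤ) : ℂ) • tp (.H m)
  | .G δ k => if δ = ε then tp (.G k) else tp (.Q (k + 1))
  | .C => tp .C

/-- Each topological relation is a linear combination of Neveu-Schwarz ones. The sign enters through
its square, so where needed both of its values are inserted before coefficients are compared. -/
lemma twGen_rel (ε : ℤˣ) {a b : FreeAlgebra ℂ TopGen} (h : TopRel a b) :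
    FreeAlgebra.lift ℂ (twGen ε) a = FreeAlgebra.lift ℂ (twGen ε) b := by
  have hε := sign_mul_self ε
  have hcase : ((ε : ℤ) : ℂ) = 1 ∨ ((ε : ℤ) : ℂ) = -1 := by
    rcases Int.units_eq_one_or ε with rfl | rfl <;> simp
  have hneg : (((-ε : ℤˣ) : ℤ) : ℂ) = -((ε : ℤ) : ℂ) := by push_cast; rfl
  generalize hs : ((ε : ℤ) : ℂ) = s at hε hcase hneg
  cases h with
  | LL m n =>
    have h1 := ns_LL m n
    have h2 := ns_LH m n
    have h3 := ns_LH n m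
    have h4 := ns_HH m n
    rw [add_comm n m] at h3
    simp only [map_sub, map_mul, map_smul, FreeAlgebra.lift_ι_apply, twGen, add_mul, mul_add,
      smul_mul_assoc, mul_smul_comm, hs]
    -- The central terms cancel: (m³ - m)/12 comes from the L, and m (1 - m²)/12 from the bracket of
    -- the added H.
    by_cases h0 : m + n = 0
    · obtain rfl : n = -m := by omega
      simp only [add_neg_cancel, if_true] at h1 h2 h3 h4 ⊢
      push_cast at h1 h2 h3 h4 ⊢
      rcases hcase with h | h <;> linear_combination (norm := (rw [h]; module)) h1 + (s * (-m + 1) / 2) • h2 - (s * (m + 1) / 2) • h3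
        + ((s * (m + 1) / 2) * (s * (-m + 1) / 2)) • h4
    · simp only [h0, if_false] at h1 h4
      push_cast at h1 h2 h3 h4 ⊢
      linear_combination (norm := module) h1 + (s * (n + 1) / 2) • h2 - (s * (m + 1) / 2) • h3
        + ((s * (m + 1) / 2) * (s * (n + 1) / 2)) • h4
  | HH m n =>
    have h4 := ns_HH m n
    simp only [map_sub, map_mul, map_smul, FreeAlgebra.lift_ι_apply, twGen,
      smul_mul_assoc, mul_smul_comm, smul_smul, hs, hε, one_smul]
    exact h4
  | LG m n =>
    have h1 := ns_LG m ε n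
    have h2 := ns_HG m ε n
    simp only [map_sub, map_mul, map_smul, FreeAlgebra.lift_ι_apply, twGen, add_mul, mul_add,
      smul_mul_assoc, mul_smul_comm, hs] at h2 ⊢
    rcases hcase with h | h <;> linear_combination (norm := (rw [h]; module)) h1 + (s * (m + 1) / 2) • h2
  | HG m n =>
    have h2 := ns_HG m ε n
    simp only [map_sub, map_mul, FreeAlgebra.lift_ι_apply, twGen,
      smul_mul_assoc, mul_smul_comm, hs] at h2 ⊢
    rw [← smul_sub, h2, smul_smul, hε, one_smul]
  | LQ m n =>
    have h1 := ns_LG m (-ε) (n - 1)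
    have h2 := ns_HG m (-ε) (n - 1)
    rw [← add_sub_assoc] at h1 h2
    simp only [map_sub, map_mul, map_smul, FreeAlgebra.lift_ι_apply, twGen, add_mul, mul_add,
      smul_mul_assoc, mul_smul_comm, hneg, hs] at h2 ⊢
    push_cast at h1
    rcases hcase with h | h <;> linear_combination (norm := (rw [h]; module)) h1 + (s * (m + 1) / 2) • h2
  | HQ m n =>
    have h2 := ns_HG m (-ε) (n - 1)
    rw [← add_sub_assoc] at h2
    simp only [map_sub, map_mul, map_neg, FreeAlgebra.lift_ι_apply, twGen,
      smul_mul_assoc, mul_smul_comm, hneg, hs] at h2 ⊢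
    rw [← smul_sub, h2, smul_smul, mul_neg, hε, neg_one_smul]
  | LH m n =>
    have h2 := ns_LH m n
    have h4 := ns_HH m n
    simp only [map_sub, map_mul, map_add, map_smul, FreeAlgebra.lift_ι_apply, twGen, add_mul, mul_add,
      smul_mul_assoc, mul_smul_comm, smul_smul, hs]
    by_cases h0 : m + n = 0
    · simp only [h0, if_true] at h2 h4 ⊢
      rcases hcase with h | h <;> linear_combination (norm := (rw [h]; module)) s • h2 + ((s * (m + 1) / 2) * s) • h4
    · simp only [h0, if_false] at h2 h4 ⊢
      linear_combination (norm := module) s • h2 + ((s * (m + 1) / 2) * s) • h4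
  | GQ m n =>
    have h2 := ns_GG' ε m (n - 1)
    rw [show m + (n - 1) + 1 = m + n by ring] at h2
    simp only [map_sub, map_mul, map_add, map_smul, FreeAlgebra.lift_ι_apply, twGen, hs] at h2 ⊢
    push_cast at h2 ⊢
    split_ifs at h2 ⊢ <;> linear_combination (norm := module) h2
  | GG m n =>
    have h2 := ns_GG ε m n
    simpa only [map_mul, map_add, map_zero, FreeAlgebra.lift_ι_apply, twGen] using h2
  | QQ m n =>
    have h2 := ns_GG (-ε) (m - 1) (n - 1)
    simpa only [map_mul, map_add, map_zero, FreeAlgebra.lift_ι_apply, twGen] using h2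
  | central x =>
    simp only [map_mul, FreeAlgebra.lift_ι_apply, twGen]
    exact ns_C_comm _

lemma untwGen_rel (ε : ℤˣ) {a b : FreeAlgebra ℂ NSGen} (h : NSRel a b) :
    FreeAlgebra.lift ℂ (untwGen ε) a = FreeAlgebra.lift ℂ (untwGen ε) b := by
  have hε := sign_mul_self ε
  have hcase : ((ε : ℤ) : ℂ) = 1 ∨ ((ε : ℤ) : ℂ) = -1 := by
    rcases Int.units_eq_one_or ε with rfl | rfl <;> simp
  have hneg : (((-ε : ℤˣ) : ℤ) : ℂ) = -((ε : ℤ) : ℂ) := by push_cast; rfl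
  have hne : -ε ≠ ε := (ne_iff_eq_neg.2 rfl).symm
  generalize hs : ((ε : ℤ) : ℂ) = s at hε hcase hneg
  cases h with
  | LL m n =>
    have h1 := tp_LL m n
    have h2 := tp_LH m n
    have h3 := tp_LH n m
    have h4 := tp_HH m n
    rw [add_comm n m] at h3
    simp only [map_sub, map_mul, map_add, map_smul, FreeAlgebra.lift_ι_apply, untwGen, sub_mul,
      mul_sub, smul_mul_assoc, mul_smul_comm]
    by_cases h0 : m + n = 0
    · obtain rfl : n = -m := by omega
      simp only [add_neg_cancel, if_true] at h1 h2 h3 h4 ⊢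
      push_cast at h1 h2 h3 h4 ⊢
      linear_combination (norm := module) h1 - ((-m + 1) / 2 : ℂ) • h2 + ((m + 1) / 2 : ℂ) • h3
        + (((m + 1) / 2) * ((-m + 1) / 2) : ℂ) • h4
    · simp only [h0, if_false] at h2 h3 h4 ⊢
      push_cast at h1 h2 h3 h4 ⊢
      linear_combination (norm := module) h1 - ((n + 1) / 2 : ℂ) • h2 + ((m + 1) / 2 : ℂ) • h3
        + (((m + 1) / 2) * ((n + 1) / 2) : ℂ) • h4
  | HH m n =>
    have h4 := tp_HH m n
    simp only [map_sub, map_mul, map_smul, FreeAlgebra.lift_ι_apply, untwGen,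
      smul_mul_assoc, mul_smul_comm, smul_smul, hs, hε, one_smul]
    exact h4
  | LH m n =>
    have h2 := tp_LH m n
    have h4 := tp_HH m n
    simp only [map_sub, map_mul, map_smul, FreeAlgebra.lift_ι_apply, untwGen, sub_mul, mul_sub,
      smul_mul_assoc, mul_smul_comm, hs]
    split_ifs at h2 h4 <;> linear_combination (norm := module) s • h2 - ((m + 1) / 2 * s : ℂ) • h4
  | LG m δ k =>
    simp only [map_sub, map_mul, map_smul, FreeAlgebra.lift_ι_apply, untwGen, sub_mul, mul_sub,
      smul_mul_assoc, mul_smul_comm]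
    split_ifs with h
    · linear_combination (norm := module) tp_LG m k - ((m + 1) / 2 : ℂ) • tp_HG m k
    · have h1 := tp_LQ m (k + 1)
      have h2 := tp_HQ m (k + 1)
      rw [← add_assoc] at h1 h2
      push_cast at h1
      linear_combination (norm := module) h1 - ((m + 1) / 2 : ℂ) • h2
  | HG m δ k =>
    simp only [map_sub, map_mul, map_smul, FreeAlgebra.lift_ι_apply, untwGen, smul_mul_assoc,
      mul_smul_comm, hs]
    split_ifs with h
    · rw [h, hs]
      linear_combination (norm := module) s • tp_HG m k
    · rw [ne_iff_eq_neg.1 (Ne.symm h), hneg]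
      have h2 := tp_HQ m (k + 1)
      rw [← add_assoc] at h2
      linear_combination (norm := module) s • h2
  | GG δ k l =>
    simp only [map_add, map_mul, map_zero, FreeAlgebra.lift_ι_apply, untwGen]
    split_ifs with h
    · exact tp_GG k l
    · exact tp_QQ (k + 1) (l + 1)
  | GG' δ k l =>
    simp only [map_add, map_mul, map_smul, FreeAlgebra.lift_ι_apply, untwGen]
    by_cases h : δ = ε
    · subst h
      have h1 := tp_GQ k (l + 1)
      rw [← add_assoc] at h1
      rw [if_pos rfl, if_neg hne, h1, hs]
      push_cast
      split_ifs <;> rcases hcase with h | h <;> rw [h] <;> module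
    · obtain rfl := ne_iff_eq_neg.1 (Ne.symm h)
      have h1 := tp_GQ l (k + 1)
      rw [show l + (k + 1) = k + l + 1 by ring] at h1
      rw [if_neg hne, neg_neg, if_pos rfl, add_comm (tp _ * tp _), h1, hneg, hs]
      push_cast
      by_cases h0 : k + l + 1 = 0
      · obtain rfl : l = -k - 1 := by omega
        rw [if_pos h0, if_pos h0]
        push_cast
        rcases hcase with h | h <;> rw [h] <;> module
      · rw [if_neg h0, if_neg h0]
        rcases hcase with h | h <;> rw [h] <;> module
  | central x =>
    simp only [map_mul, FreeAlgebra.lift_ι_apply, untwGen]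
    cases x with
    | L m => rw [mul_sub, sub_mul, mul_smul_comm, smul_mul_assoc, tp_central, tp_central]
    | H m => rw [mul_smul_comm, smul_mul_assoc, tp_central]
    | G δ k => dsimp only; split_ifs <;> exact tp_central _
    | C => rfl

/-- The topological twist as a homomorphism. -/
noncomputable def tw (ε : ℤˣ) : TopAlg →ₐ[ℂ] NSAlg :=
  RingQuot.liftAlgHom ℂ ⟨FreeAlgebra.lift ℂ (twGen ε), fun _ _ h => twGen_rel ε h⟩

/-- The inverse of the topological twist as a homomorphism. -/
noncomputable def untw (ε : ℤˣ) : NSAlg →ₐ[ℂ] TopAlg :=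
  RingQuot.liftAlgHom ℂ ⟨FreeAlgebra.lift ℂ (untwGen ε), fun _ _ h => untwGen_rel ε h⟩

lemma tw_tp (ε : ℤˣ) (x : TopGen) : tw ε (tp x) = twGen ε x := by
  rw [tw, tp]
  exact (RingQuot.liftAlgHom_mkAlgHom_apply ℂ _ _ _).trans (FreeAlgebra.lift_ι_apply _ _)

lemma untw_ns (ε : ℤˣ) (x : NSGen) : untw ε (ns x) = untwGen ε x := by
  rw [untw, ns]
  exact (RingQuot.liftAlgHom_mkAlgHom_apply ℂ _ _ _).trans (FreeAlgebra.lift_ι_apply _ _)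

lemma untw_tw (ε : ℤˣ) (a : TopAlg) : untw ε (tw ε a) = a := by
  have hε := sign_mul_self ε
  have hne : -ε ≠ ε := (ne_iff_eq_neg.2 rfl).symm
  induction a using TopAlg.induction with
  | hs r => rw [AlgHom.commutes, AlgHom.commutes]
  | hx x =>
    rw [tw_tp]
    cases x with
    | L m =>
      simp only [twGen, map_add, map_smul, untw_ns, untwGen]
      rw [smul_smul, show ((ε : ℤ) : ℂ) * ((m : ℂ) + 1) / 2 * ((ε : ℤ) : ℂ) = ((m : ℂ) + 1) / 2 by
        linear_combination (((m : ℂ) + 1) / 2) * hε, sub_add_cancel]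
    | H m => simp only [twGen, map_smul, untw_ns, untwGen, smul_smul, hε, one_smul]
    | G m => simp only [twGen, untw_ns, untwGen, if_true]
    | Q m => simp only [twGen, untw_ns, untwGen, hne, if_false, sub_add_cancel]
    | C => simp only [twGen, untw_ns, untwGen]
  | hmul a b ha hb => rw [map_mul, map_mul, ha, hb]
  | hadd a b ha hb => rw [map_add, map_add, ha, hb]

lemma tw_untw (ε : ℤˣ) (a : NSAlg) : tw ε (untw ε a) = a := by
  have hε := sign_mul_self ε
  induction a using NSAlg.induction with
  | hs r => rw [AlgHom.commutes, AlgHom.commutes]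
  | hx x =>
    rw [untw_ns]
    cases x with
    | L m =>
      simp only [untwGen, map_sub, map_smul, tw_tp, twGen]
      rw [smul_smul]
      module
    | H m => simp only [twGen, map_smul, tw_tp, untwGen, smul_smul, hε, one_smul]
    | G δ k =>
      simp only [untwGen]
      split_ifs with h
      · rw [h, tw_tp]; rfl
      · rw [ne_iff_eq_neg.1 (Ne.symm h), tw_tp, twGen, add_sub_cancel_right]
    | C => simp only [twGen, tw_tp, untwGen]
  | hmul a b ha hb => rw [map_mul, map_mul, ha, hb]
  | hadd a b ha hb => rw [map_add, map_add, ha, hb]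

/-- The topological twist. -/
noncomputable def twist (ε : ℤˣ) : TopAlg ≃ₐ[ℂ] NSAlg :=
  AlgEquiv.ofAlgHom (tw ε) (untw ε) (AlgHom.ext (tw_untw ε)) (AlgHom.ext (untw_tw ε))

lemma twist_tp (ε : ℤˣ) (x : TopGen) : twist ε (tp x) = twGen ε x := tw_tp ε x

lemma twist_symm_ns (ε : ℤˣ) (x : NSGen) : (twist ε).symm (ns x) = untwGen ε x := untw_ns ε x

section verma

variable {c Δ q : ℂ} {ε : ℤˣ}

lemma mem_TopIdealG_of {a : TopAlg} {Δ' q' : ℂ} (h : a ∈ TopPos ∪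
    {tp (.G 0), tp (.L 0) - algebraMap ℂ TopAlg Δ', tp (.H 0) - algebraMap ℂ TopAlg q',
      tp .C - algebraMap ℂ TopAlg c}) : a ∈ TopIdealG c Δ' q' := Submodule.subset_span h

lemma mem_NSIdeal_of {a : NSAlg} (h : a ∈ NSPos ∪
    {ns (.L 0) - algebraMap ℂ NSAlg Δ, ns (.H 0) - algebraMap ℂ NSAlg q,
      ns .C - algebraMap ℂ NSAlg c}) : a ∈ NSIdeal c Δ q := Submodule.subset_span h

/-- It suffices to check generators of the left ideal. The mode G^ε_{1/2} goes to the topological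
G_0, which is why that element belongs to the topological ideal, and G^{-ε}_{1/2} goes to Q_1. -/
lemma twist_symm_mem {a : NSAlg} (h : a ∈ NSIdeal c Δ q) : (twist ε).symm a ∈
    (TopIdealG c (Δ + ((ε : ℤ) : ℂ) * q / 2) (((ε : ℤ) : ℂ) * q)).restrictScalars ℂ := by
  set I := (TopIdealG c (Δ + ((ε : ℤ) : ℂ) * q / 2) (((ε : ℤ) : ℂ) * q)).restrictScalars ℂ
  have hH : tp (.H 0) - algebraMap ℂ TopAlg (((ε : ℤ) : ℂ) * q) ∈ I := mem_TopIdealG_of (by simp)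
  have hL : tp (.L 0) - algebraMap ℂ TopAlg (Δ + ((ε : ℤ) : ℂ) * q / 2) ∈ I :=
    mem_TopIdealG_of (by simp)
  induction h using Submodule.span_induction with
  | mem a h =>
    rcases h with (⟨m, hm, rfl | rfl⟩ | ⟨δ, k, hk, rfl⟩) | h
    · rw [twist_symm_ns]
      exact I.sub_mem (mem_TopIdealG_of (Or.inl ⟨m, hm, Or.inl rfl⟩))
        (I.smul_mem _ (mem_TopIdealG_of (Or.inl ⟨m, hm, Or.inr (Or.inl rfl)⟩)))
    · rw [twist_symm_ns]
      exact I.smul_mem _ (mem_TopIdealG_of (Or.inl ⟨m, hm, Or.inr (Or.inl rfl)⟩))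
    · rw [twist_symm_ns, untwGen]
      split_ifs with hδ
      · rcases hk.eq_or_lt with rfl | hk
        · exact mem_TopIdealG_of (by simp)
        · exact mem_TopIdealG_of (Or.inl ⟨k, hk, Or.inr (Or.inr (Or.inl rfl))⟩)
      · exact mem_TopIdealG_of (Or.inl ⟨k + 1, by omega, Or.inr (Or.inr (Or.inr rfl))⟩)
    · rcases h with rfl | rfl | rfl
      · have h1 := I.sub_mem hL (I.smul_mem (1 / 2 : ℂ) hH)
        rw [map_sub, twist_symm_ns, AlgEquiv.commutes]
        convert h1 using 1
        simp only [untwGen, Algebra.algebraMap_eq_smul_one, Int.cast_zero, zero_add]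
        module
      · have h1 := I.smul_mem (((ε : ℤ) : ℂ)) hH
        rw [map_sub, twist_symm_ns, AlgEquiv.commutes]
        convert h1 using 1
        simp only [untwGen, Algebra.algebraMap_eq_smul_one, smul_sub, smul_smul, ← mul_assoc,
          sign_mul_self, one_mul]
      · rw [map_sub, twist_symm_ns, AlgEquiv.commutes]
        exact mem_TopIdealG_of (by simp [untwGen])
  | zero => rw [map_zero]; exact I.zero_mem
  | add a b _ _ ha hb => rw [map_add]; exact I.add_mem ha hb
  | smul a b _ hb =>
    rw [smul_eq_mul, map_mul]
    exact Submodule.smul_mem (TopIdealG c (Δ + ((ε : ℤ) : ℂ) * q / 2) (((ε : ℤ) : ℂ) * q)) _ hb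

lemma twist_mem {a : TopAlg}
    (h : a ∈ TopIdealG c (Δ + ((ε : ℤ) : ℂ) * q / 2) (((ε : ℤ) : ℂ) * q)) :
    twist ε a ∈ (NSIdeal c Δ q).restrictScalars ℂ := by
  set I := (NSIdeal c Δ q).restrictScalars ℂ
  have hH : ns (.H 0) - algebraMap ℂ NSAlg q ∈ I := mem_NSIdeal_of (by simp)
  have hL : ns (.L 0) - algebraMap ℂ NSAlg Δ ∈ I := mem_NSIdeal_of (by simp)
  have hG : ∀ δ k, 0 ≤ k → ns (.G δ k) ∈ I := fun δ k hk =>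
    mem_NSIdeal_of (Or.inl (Or.inr ⟨δ, k, hk, rfl⟩))
  induction h using Submodule.span_induction with
  | mem a h =>
    rcases h with ⟨m, hm, rfl | rfl | rfl | rfl⟩ | h
    · rw [twist_tp]
      exact I.add_mem (mem_NSIdeal_of (Or.inl (Or.inl ⟨m, hm, Or.inl rfl⟩)))
        (I.smul_mem _ (mem_NSIdeal_of (Or.inl (Or.inl ⟨m, hm, Or.inr rfl⟩))))
    · rw [twist_tp]
      exact I.smul_mem _ (mem_NSIdeal_of (Or.inl (Or.inl ⟨m, hm, Or.inr rfl⟩)))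
    · rw [twist_tp]
      exact hG _ _ hm.le
    · rw [twist_tp]
      exact hG _ _ (by omega)
    · rcases h with rfl | rfl | rfl | rfl
      · rw [twist_tp]
        exact hG _ _ le_rfl
      · have h1 := I.add_mem hL (I.smul_mem (((ε : ℤ) : ℂ) / 2) hH)
        rw [map_sub, twist_tp, AlgEquiv.commutes]
        convert h1 using 1
        simp only [twGen, Algebra.algebraMap_eq_smul_one, Int.cast_zero, zero_add, mul_one]
        module
      · have h1 := I.smul_mem (((ε : ℤ) : ℂ)) hH
        rw [map_sub, twist_tp, AlgEquiv.commutes]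
        convert h1 using 1
        simp only [twGen, Algebra.algebraMap_eq_smul_one, smul_sub, smul_smul]
      · rw [map_sub, twist_tp, AlgEquiv.commutes]
        exact mem_NSIdeal_of (by simp [twGen])
  | zero => rw [map_zero]; exact I.zero_mem
  | add a b _ _ ha hb => rw [map_add]; exact I.add_mem ha hb
  | smul a b _ hb =>
    rw [smul_eq_mul, map_mul]
    exact Submodule.smul_mem (NSIdeal c Δ q) _ hb

variable (c Δ q ε) in
/-- The isomorphism of Verma modules along the topological twist. -/
noncomputable def vermaEquiv : NSVerma c Δ q ≃ₗ[ℂ]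
    TopVermaG c (Δ + ((ε : ℤ) : ℂ) * q / 2) (((ε : ℤ) : ℂ) * q) :=
  ((Submodule.Quotient.restrictScalarsEquiv ℂ (NSIdeal c Δ q)).symm.trans
    (Submodule.Quotient.equiv ((NSIdeal c Δ q).restrictScalars ℂ)
      ((TopIdealG c (Δ + ((ε : ℤ) : ℂ) * q / 2) (((ε : ℤ) : ℂ) * q)).restrictScalars ℂ)
      (twist ε).symm.toLinearEquiv (by
        refine le_antisymm (Submodule.map_le_iff_le_comap.2 fun a ha => twist_symm_mem ha) ?_
        intro a ha
        exact ⟨twist ε a, twist_mem ha, (twist ε).symm_apply_apply a⟩))).trans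
    (Submodule.Quotient.restrictScalarsEquiv ℂ
      (TopIdealG c (Δ + ((ε : ℤ) : ℂ) * q / 2) (((ε : ℤ) : ℂ) * q)))

lemma vermaEquiv_smul_nsHW (a : NSAlg) :
    vermaEquiv c Δ q ε (a • nsHW c Δ q) = (twist ε).symm a • topHW c _ _ := by
  change vermaEquiv c Δ q ε (a • (NSIdeal c Δ q).mkQ 1) = (twist ε).symm a •
    (TopIdealG c (Δ + ((ε : ℤ) : ℂ) * q / 2) (((ε : ℤ) : ℂ) * q)).mkQ 1
  rw [← map_smul, ← map_smul, smul_eq_mul, smul_eq_mul, mul_one, mul_one]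
  rfl

lemma vermaEquiv_nsHW : vermaEquiv c Δ q ε (nsHW c Δ q) = topHW c _ _ := by
  have h := vermaEquiv_smul_nsHW (c := c) (Δ := Δ) (q := q) (ε := ε) 1
  rwa [one_smul, map_one, one_smul] at h

lemma vermaEquiv_smul (a : TopAlg) (v : NSVerma c Δ q) :
    vermaEquiv c Δ q ε (twist ε a • v) = a • vermaEquiv c Δ q ε v := by
  obtain ⟨b, rfl⟩ := v.exists_smul
  rw [smul_smul, vermaEquiv_smul_nsHW, vermaEquiv_smul_nsHW, map_mul,
    AlgEquiv.symm_apply_apply, mul_smul]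

lemma vermaEquiv_mem_span {v : NSVerma c Δ q} :
    vermaEquiv c Δ q ε v ∈ Submodule.span ℂ {topHW c (Δ + ((ε : ℤ) : ℂ) * q / 2) (((ε : ℤ) : ℂ) * q)}
      ↔ v ∈ Submodule.span ℂ {nsHW c Δ q} := by
  rw [Submodule.mem_span_singleton, Submodule.mem_span_singleton]
  refine exists_congr fun r => ?_
  rw [← vermaEquiv_nsHW, ← map_smul, (vermaEquiv c Δ q ε).injective.eq_iff]

/-- The twist adds (ε/2) H_0 to L_0, so on charge n the level is shifted by εn/2; conversely, the
charge equation is solved first and then inserted into the one for the level. -/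
lemma eigen_iff (v : NSVerma c Δ q) (m : ℚ) (n : ℤ) :
    (tp (.L 0) • vermaEquiv c Δ q ε v = (Δ + ((ε : ℤ) : ℂ) * q / 2
          + ((m + ((ε : ℤ) : ℚ) * n / 2 : ℚ) : ℂ)) • vermaEquiv c Δ q ε v
      ∧ tp (.H 0) • vermaEquiv c Δ q ε v
        = (((ε : ℤ) : ℂ) * q + (((ε : ℤ) * n : ℤ) : ℂ)) • vermaEquiv c Δ q ε v)
    ↔ ns (.L 0) • v = (Δ + (m : ℂ)) • v ∧ ns (.H 0) • v = (q + (n : ℂ)) • v := by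
  have hε := sign_mul_self ε
  have hε0 : ((ε : ℤ) : ℂ) ≠ 0 := fun h => by simp [h] at hε
  rw [← vermaEquiv_smul, ← vermaEquiv_smul, ← map_smul, ← map_smul,
    (vermaEquiv c Δ q ε).injective.eq_iff, (vermaEquiv c Δ q ε).injective.eq_iff, twist_tp,
    twist_tp]
  simp only [twGen, add_smul, smul_assoc, Int.cast_zero, zero_add, mul_one]
  push_cast
  generalize ns (.L 0) • v = a
  generalize ns (.H 0) • v = b
  constructor
  · rintro ⟨h1, h2⟩
    have h3 : b = q • v + (n : ℂ) • v := by
      have : ((ε : ℤ) : ℂ) • b = ((ε : ℤ) : ℂ) • (q • v + (n : ℂ) • v) := by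
        rw [h2]; module
      exact smul_right_injective _ hε0 this
    refine ⟨?_, h3⟩
    rw [h3] at h1
    linear_combination (norm := module) h1
  · rintro ⟨rfl, rfl⟩
    constructor <;> module

/-- The topological positive operators miss only G^ε_{1/2}, the image of G_0. The H part of the
twisted L_m is removed using the condition on H_m. -/
lemma pos_iff (v : NSVerma c Δ q) :
    ((∀ a ∈ TopPos, a • vermaEquiv c Δ q ε v = 0) ∧ tp (.G 0) • vermaEquiv c Δ q ε v = 0)
      ↔ ∀ a ∈ NSPos, a • v = 0 := by
  have hiff : ∀ a : TopAlg, a • vermaEquiv c Δ q ε v = 0 ↔ twist ε a • v = 0 := fun a => by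
    rw [← vermaEquiv_smul, LinearEquiv.map_eq_zero_iff]
  have hε := sign_mul_self ε
  have hε0 : ((ε : ℤ) : ℂ) ≠ 0 := fun h => by simp [h] at hε
  constructor
  · rintro ⟨h1, h2⟩
    have hH : ∀ m : ℤ, 0 < m → ns (.H m) • v = 0 := by
      intro m hm
      have h3 := (hiff _).1 (h1 _ ⟨m, hm, Or.inr (Or.inl rfl)⟩)
      rw [twist_tp, twGen, smul_assoc] at h3
      exact (smul_eq_zero.1 h3).resolve_left hε0
    rintro a (⟨m, hm, rfl | rfl⟩ | ⟨δ, k, hk, rfl⟩)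
    · have h3 := (hiff _).1 (h1 _ ⟨m, hm, Or.inl rfl⟩)
      rwa [twist_tp, twGen, add_smul, smul_assoc, hH m hm, smul_zero, add_zero] at h3
    · exact hH m hm
    · rcases eq_or_eq_neg ε δ with rfl | rfl
      · rcases hk.eq_or_lt with rfl | hk
        · have h3 := (hiff _).1 h2
          rwa [twist_tp] at h3
        · have h3 := (hiff _).1 (h1 _ ⟨k, hk, Or.inr (Or.inr (Or.inl rfl))⟩)
          rwa [twist_tp] at h3
      · have h3 := (hiff _).1 (h1 _ ⟨k + 1, by omega, Or.inr (Or.inr (Or.inr rfl))⟩)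
        rwa [twist_tp, twGen, add_sub_cancel_right] at h3
  · intro h
    have hH : ∀ m : ℤ, 0 < m → ns (.H m) • v = 0 := fun m hm =>
      h _ (Or.inl ⟨m, hm, Or.inr rfl⟩)
    refine ⟨?_, ?_⟩
    · rintro a ⟨m, hm, rfl | rfl | rfl | rfl⟩ <;> rw [hiff, twist_tp, twGen]
      · rw [add_smul, smul_assoc, hH m hm, smul_zero, add_zero]
        exact h _ (Or.inl ⟨m, hm, Or.inl rfl⟩)
      · rw [smul_assoc, hH m hm, smul_zero]
      · exact h _ (Or.inr ⟨ε, m, hm.le, rfl⟩)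
      · exact h _ (Or.inr ⟨-ε, m - 1, by omega, rfl⟩)
    · rw [hiff, twist_tp]
      exact h _ (Or.inr ⟨ε, 0, le_rfl, rfl⟩)

lemma mem_TopSingG_iff (v : NSVerma c Δ q) (m : ℚ) (n : ℤ) :
    vermaEquiv c Δ q ε v ∈ TopSingG c (Δ + ((ε : ℤ) : ℂ) * q / 2) (((ε : ℤ) : ℂ) * q)
      (m + ((ε : ℤ) : ℚ) * n / 2) ((ε : ℤ) * n) ↔ v ∈ NSSing c Δ q m n := by
  have h1 := eigen_iff (ε := ε) v m n
  have h2 := pos_iff (ε := ε) v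
  have h3 := vermaEquiv_mem_span (ε := ε) (v := v)
  simp only [TopSingG, NSSing, Set.mem_ofPred_eq, h3, ← h2]
  rw [← and_assoc, h1]
  tauto

/-- Q_0 corresponds to G^{-ε}_{-1/2}, hence the opposite sign. -/
lemma mem_TopSingGQ_iff (v : NSVerma c Δ q) (m : ℚ) (n : ℤ) :
    vermaEquiv c Δ q ε v ∈ TopSingGQ c (Δ + ((ε : ℤ) : ℂ) * q / 2) (((ε : ℤ) : ℂ) * q)
      (m + ((ε : ℤ) : ℚ) * n / 2) ((ε : ℤ) * n) ↔ v ∈ NSSingChir (-ε) c Δ q m n := by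
  have h1 : tp (.Q 0) • vermaEquiv c Δ q ε v = 0 ↔ ns (.G (-ε) (-1)) • v = 0 := by
    rw [← vermaEquiv_smul, LinearEquiv.map_eq_zero_iff, twist_tp, twGen, zero_sub]
  simp only [TopSingGQ, NSSingChir, Set.mem_ofPred_eq, mem_TopSingG_iff, h1]

lemma image_eq_of_mem_iff {A B : Type} {f : A → B} (hf : Function.Surjective f) {S : Set A}
    {S' : Set B} (h : ∀ v, f v ∈ S' ↔ v ∈ S) : f '' S = S' := by
  rw [show S = f ⁻¹' S' from Set.ext fun v => (h v).symm, Set.image_preimage_eq _ hf]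

lemma image_NSSing (m : ℚ) (n : ℤ) : vermaEquiv c Δ q ε '' NSSing c Δ q m n =
    TopSingG c (Δ + ((ε : ℤ) : ℂ) * q / 2) (((ε : ℤ) : ℂ) * q)
      (m + ((ε : ℤ) : ℚ) * n / 2) ((ε : ℤ) * n) :=
  image_eq_of_mem_iff (vermaEquiv c Δ q ε).surjective fun v => mem_TopSingG_iff v m n

lemma image_NSSingChir (m : ℚ) (n : ℤ) : vermaEquiv c Δ q ε '' NSSingChir (-ε) c Δ q m n =
    TopSingGQ c (Δ + ((ε : ℤ) : ℂ) * q / 2) (((ε : ℤ) : ℂ) * q)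
      (m + ((ε : ℤ) : ℚ) * n / 2) ((ε : ℤ) * n) :=
  image_eq_of_mem_iff (vermaEquiv c Δ q ε).surjective fun v => mem_TopSingGQ_iff v m n

end verma

lemma indepNumber_image {V V' : Type} [AddCommGroup V] [Module ℂ V] [AddCommGroup V'] [Module ℂ V']
    (T : V ≃ₗ[ℂ] V') (S : Set V) : indepNumber (T '' S) = indepNumber S := by
  rw [indepNumber, indepNumber]
  have h : Submodule.span ℂ (T '' S) = (Submodule.span ℂ S).map T.toLinearMap :=
    (Submodule.map_span T.toLinearMap S).symm
  rw [h]
  exact (T.submoduleMap (Submodule.span ℂ S)).rank_eq.symm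

section

variable (c Δ q : ℂ) (ε : ℤˣ) (m : ℚ) (n : ℤ)

theorem indepNumber_NSSing_eq : indepNumber (NSSing c Δ q m n) =
    indepNumber (TopSingG c (Δ + ((ε : ℤ) : ℂ) * q / 2) (((ε : ℤ) : ℂ) * q)
      (m + ((ε : ℤ) : ℚ) * n / 2) ((ε : ℤ) * n)) := by
  rw [← image_NSSing, indepNumber_image]

theorem indepNumber_NSSingChir_eq : indepNumber (NSSingChir (-ε) c Δ q m n) =
    indepNumber (TopSingGQ c (Δ + ((ε : ℤ) : ℂ) * q / 2) (((ε : ℤ) : ℂ) * q)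
      (m + ((ε : ℤ) : ℚ) * n / 2) ((ε : ℤ) * n)) := by
  rw [← image_NSSingChir, indepNumber_image]

/-- The twist with ε = 1 read backwards: Δ - q/2 and m - n/2 solve the equations for weight and
level. So every topological Verma module is reached and inherits the Neveu-Schwarz bounds. -/
theorem indepNumber_TopSingG_eq : indepNumber (TopSingG c Δ q m n)
    = indepNumber (NSSing c (Δ - q / 2) q (m - n / 2) n) := by
  rw [indepNumber_NSSing_eq c (Δ - q / 2) q 1]
  have e1 : Δ - q / 2 + (((1 : ℤˣ) : ℤ) : ℂ) * q / 2 = Δ := by simp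
  have e2 : (((1 : ℤˣ) : ℤ) : ℂ) * q = q := by simp
  have e3 : m - n / 2 + (((1 : ℤˣ) : ℤ) : ℚ) * n / 2 = m := by simp
  have e4 : ((1 : ℤˣ) : ℤ) * n = n := by simp
  rw [e1, e2, e3, e4]

theorem indepNumber_TopSingGQ_eq : indepNumber (TopSingGQ c Δ q m n)
    = indepNumber (NSSingChir (-1) c (Δ - q / 2) q (m - n / 2) n) := by
  rw [indepNumber_NSSingChir_eq c (Δ - q / 2) q 1]
  have e1 : Δ - q / 2 + (((1 : ℤˣ) : ℤ) : ℂ) * q / 2 = Δ := by simp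
  have e2 : (((1 : ℤˣ) : ℤ) : ℂ) * q = q := by simp
  have e3 : m - n / 2 + (((1 : ℤˣ) : ℤ) : ℚ) * n / 2 = m := by simp
  have e4 : ((1 : ℤˣ) : ℤ) * n = n := by simp
  rw [e1, e2, e3, e4]

end

end N2

/-! ### The theorem. -/

open N2 in
theorem mainTheorem9 (c : ℂ) :
    -- the topological twists, one for each sign `ε = ±1`, identify singular vectors
    (∀ ε : ℤˣ, ∃ τ : TopAlg ≃ₐ[ℂ] NSAlg,
      (∀ m : ℤ, τ (tp (.L m)) = ns (.L m) + (((ε : ℤ) : ℂ) * ((m : ℂ) + 1) / 2) • ns (.H m)) ∧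
      (∀ m : ℤ, τ (tp (.H m)) = ((ε : ℤ) : ℂ) • ns (.H m)) ∧
      (∀ m : ℤ, τ (tp (.G m)) = ns (.G ε m)) ∧
      (∀ m : ℤ, τ (tp (.Q m)) = ns (.G (-ε) (m - 1))) ∧
      τ (tp .C) = ns .C ∧
      ∀ Δ q : ℂ, ∃ T : NSVerma c Δ q ≃ₗ[ℂ]
          TopVermaG c (Δ + ((ε : ℤ) : ℂ) * q / 2) (((ε : ℤ) : ℂ) * q),
        T (nsHW c Δ q) = topHW c (Δ + ((ε : ℤ) : ℂ) * q / 2) (((ε : ℤ) : ℂ) * q) ∧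
        (∀ (a : TopAlg) (v : NSVerma c Δ q), T (τ a • v) = a • T v) ∧
        ∀ (m : ℚ) (n : ℤ),
          T '' NSSing c Δ q m n =
            TopSingG c (Δ + ((ε : ℤ) : ℂ) * q / 2) (((ε : ℤ) : ℂ) * q)
              (m + ((ε : ℤ) : ℚ) * n / 2) ((ε : ℤ) * n) ∧
          T '' NSSingChir (-ε) c Δ q m n =
            TopSingGQ c (Δ + ((ε : ℤ) : ℂ) * q / 2) (((ε : ℤ) : ℂ) * q)
              (m + ((ε : ℤ) : ℚ) * n / 2) ((ε : ℤ) * n)) ∧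
    -- hence equal dimensions
    (∀ (ε : ℤˣ) (Δ q : ℂ) (m : ℚ) (n : ℤ),
      indepNumber (NSSing c Δ q m n) =
        indepNumber (TopSingG c (Δ + ((ε : ℤ) : ℂ) * q / 2) (((ε : ℤ) : ℂ) * q)
          (m + ((ε : ℤ) : ℚ) * n / 2) ((ε : ℤ) * n)) ∧
      indepNumber (NSSingChir (-ε) c Δ q m n) =
        indepNumber (TopSingGQ c (Δ + ((ε : ℤ) : ℂ) * q / 2) (((ε : ℤ) : ℂ) * q)
          (m + ((ε : ℤ) : ℚ) * n / 2) ((ε : ℤ) * n))) ∧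
    -- upper limits for the topological singular vectors
    (c ≠ 3 → ∀ (Δ q : ℂ) (l : ℚ) (n : ℤ),
      indepNumber (TopSingG c Δ q l n) ≤
        ((if n = 0 then 2 else if n = 1 ∨ n = -1 then 1 else 0 : ℕ) : Cardinal) ∧
      indepNumber (TopSingGQ c Δ q l n) ≤
        ((if n = -1 ∨ n = 0 then 1 else 0 : ℕ) : Cardinal)) ∧
    -- upper limits for the Neveu-Schwarz singular vectors
    (c ≠ 3 → ∀ (Δ q : ℂ) (m : ℚ) (n : ℤ),
      indepNumber (NSSing c Δ q m n) ≤
        ((if n = 0 then 2 else if n = 1 ∨ n = -1 then 1 else 0 : ℕ) : Cardinal) ∧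
      indepNumber (NSSingCh c Δ q m n) ≤
        ((if n = 0 ∨ n = 1 then 1 else 0 : ℕ) : Cardinal) ∧
      indepNumber (NSSingA c Δ q m n) ≤
        ((if n = -1 ∨ n = 0 then 1 else 0 : ℕ) : Cardinal) ∧
      ((NSSing c Δ q m n).Nonempty →
        (n = 0 ∧ ∃ k : ℕ, 0 < k ∧ m = k) ∨
        ((n = 1 ∨ n = -1) ∧ ∃ k : ℕ, 0 < k ∧ m = k - 1 / 2)) ∧
      ((NSSingCh c Δ q m n).Nonempty → n = 0 ∨ n = 1) ∧
      ((NSSingA c Δ q m n).Nonempty → n = -1 ∨ n = 0)) ∧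
    -- conformal weights of chiral and antichiral singular vectors
    (∀ (Δ q : ℂ) (m : ℚ) (n : ℤ),
      ((NSSingCh c Δ q m n).Nonempty → Δ + (m : ℂ) = (q + n) / 2) ∧
      ((NSSingA c Δ q m n).Nonempty → Δ + (m : ℂ) = -((q + n) / 2))) := by
  refine ⟨fun ε => ⟨twist ε, fun m => twist_tp ε _, fun m => twist_tp ε _, fun m => twist_tp ε _,
    fun m => twist_tp ε _, twist_tp ε _, fun Δ q => ⟨vermaEquiv c Δ q ε, vermaEquiv_nsHW,
      vermaEquiv_smul, fun m n => ⟨image_NSSing m n, image_NSSingChir m n⟩⟩⟩,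
    fun ε Δ q m n => ⟨indepNumber_NSSing_eq c Δ q ε m n, indepNumber_NSSingChir_eq c Δ q ε m n⟩,
    fun hc Δ q l n => ⟨?_, ?_⟩, fun hc Δ q m n => ⟨indepNumber_NSSing_le hc m n, ?_, ?_,
      level_of_NSSing_nonempty hc, charge_of_NSSingChir_nonempty hc, fun h => ?_⟩,
    fun Δ q m n => ⟨fun h => ?_, fun h => ?_⟩⟩
  · rw [indepNumber_TopSingG_eq]
    exact indepNumber_NSSing_le hc _ n
  · rw [indepNumber_TopSingGQ_eq]
    have h := indepNumber_NSSingChir_le (Δ := Δ - q / 2) (q := q) hc (-1) (l - n / 2) n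
    simpa only [Units.val_neg, Units.val_one, or_comm] using h
  · exact indepNumber_NSSingChir_le hc 1 m n
  · have h := indepNumber_NSSingChir_le (Δ := Δ) (q := q) hc (-1) m n
    simpa only [Units.val_neg, Units.val_one, or_comm] using h
  · exact (charge_of_NSSingChir_nonempty hc h).symm
  · have := weight_of_NSSingChir_nonempty h
    simpa using this
  · have := weight_of_NSSingChir_nonempty h
    simpa using this
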